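/- **Setting.** Let $X$ be a Polish space, $Y$, $\mathcal H$, $\mathcal H'$ real separable Hilbert spaces, where $\mathcal H'$ is a reproducing kernel Hilbert space of functions $X\to Y$ with kernel sections $K_x:Y\to\mathcal H'$ that are Hilbert–Schmidt with $\|K_x\|_{HS}\le\kappa$ for all $x$, and such that $(x,t)\mapsto\langle K_tv,K_xw\rangle_{\mathcal H'}$ is measurable for all $v,w\in Y$. Let $\rho(x,y)=\rho(y|x)\nu(x)$ be a probability measure on $X\times Y$ with $\int\|y\|^2d\rho<\infty$, let $I_\nu:\mathcal H'\to L^2(X,\nu;Y)$ be the canonical injection, $T_\nu=I_\nu^*I_\nu$ and $\mathcal N(\lambda)=\operatorname{Tr}((T_\nu+\lambda I)^{-1}T_\nu)$. Let $L:\mathcal D(L)\subset\mathcal H\to\mathcal H$ be densely defined, self-adjoint and strictly positive with $\ell_L\|f\|\le\|Lf\|$ on $\mathcal D(L)$, $\ell_L>0$, and write $\|f\|_{a}=\|L^af\|$ for the norms of the Hilbert scale $\mathcal H_a$ generated by $L$. Let $A:\mathcal D(A)\subset\mathcal H\to\mathcal H'$ be weak-to-weak sequentially continuous with $\mathcal D(A)$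 convex and closed, and let $\bar f\in\mathcal D(A)\cap\mathcal D(L)$. **Assumptions.** 1. There is a unique $\hat f\in\operatorname{int}\mathcal D(A)$ with $\int y\,d\rho(y|x)=A(\hat f)(x)$. 2. With $\varepsilon=y-A(\hat f)(x)$ and constants $M>0$, $\Sigma\ge0$: $\int(e^{\|\varepsilon\|/M}-\|\varepsilon\|/M-1)\,d\rho(y|x)\le\Sigma^2/(2M^2)$ for $\nu$-almost all $x$. 3. For some $p\ge0$, $s>0$, $\alpha,\beta>0$, $\theta\ge0$, $d>0$ and a set $Q\subset\mathcal D(A)$ with $\|f-\hat f\|_{\theta}\le d$ on $Q$, all $f\in Q$ satisfy $$\|f-\hat f\|_{-p}\le\alpha\|I_\nu[A(f)-A(\hat f)]\|_{L^2}^s\le\beta\|f-\hat f\|_{-p}.$$ 4. $A$ is $\ell_A$-Lipschitz on $\mathcal D(A)\cap\{f:\|f-\hat f\|\le D\}$, a ball large enough to contain $Q$. 5. $\hat f-\bar f=L^{-r}v$ with $r\ge0$ and $\|v\|\le R^\dagger$, $R^\dagger>0$. 6. $\mathcal N(\lambda)\le C_{\mathcal N}\lambda^{-b}$ for all $\lambda>0$,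 where $0<b<1$, $C_{\mathcal N}>0$. 7. The benchmark smoothness $q$ satisfies $1\le q\le2+p$ and $q(s-1)<p+s$. For a sample $\mathbf z=((x_i,y_i))_{i=1}^m$ drawn independently from $\rho$ let $f_{\mathbf z,\lambda}$ denote any minimizer over $\mathcal D(A)\cap\mathcal D(L)$ of $\frac1m\sum_{i=1}^m\|A(f)(x_i)-y_i\|^2+\lambda\|L(f-\bar f)\|^2$. For $R>0$ let $\hat f^R$ be the minimizer of $\|f-\hat f\|$ over all $f$ with $f-\bar f=L^{-q}v$, $\|v\|\le R$, and let $d_A(R)=\|I_\nu[A(\hat f^R)-A(\hat f)]\|_{L^2}$. **Conclusion.** There is a constant $C>0$, depending only on $p,q,s,r,b,C_{\mathcal N},\ell_L,\ell_A,D,\kappa,M,\Sigma,\alpha,\beta,R^\dagger$ and, if $r<1$, on $\mathcal N(1)$, such that for all $m\ge1$ and $0<\eta<1$ the following holds with $$\lambda^*=m^{-1/(2u+b)},\qquad\text{provided that }\ \mathcal N(\lambda^*)\le m\lambda^*.$$ (a) If $r\ge q$ and $u=\frac{p+q}{2(p+q)-2s(q-1)}$, then with probability at least $1-\eta$ every $f_{\mathbf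 z,\lambda^*}$ that lies in $Q$ satisfies $$\|f_{\mathbf z,\lambda^*}-\hat f\|_{\mathcal H}\le C\,(\lambda^*)^{\frac{2u(s+p)-p}{2(p+1)}}\Big(\log\frac4\eta\Big)^{\max\{1,\frac{p+s}{p+1}\}}.$$ (b) If $r\le q$, $r+p\le2q$ and $u=\frac{p+r}{2(p+r)-2s(r-1)}$, the same bound holds in the same sense, provided that $\hat f^{R}\in Q$ for $R=R(\lambda^*)$. Here $R(\lambda)>0$ is either $$R(\lambda)=(R^\dagger)^{\frac{(p+q)-s(q-1)}{(p+r)-s(r-1)}}\lambda^{\frac{s(r-q)}{2(p+r)-2s(r-1)}}$$ or a solution of $d_A(R)\,R^{-\frac{p+1}{(p+q)-s(q-1)}}=\lambda^{\frac{p+q}{2(p+q)-2s(q-1)}}$. For $0<s\le1$ the logarithmic factor is $\log(4/\eta)$. -/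

import Mathlib

open MeasureTheory ProbabilityTheory Set Filter Topology
open scoped ENNReal InnerProductSpace

noncomputable section

namespace HilbertScales

/-! ### Traces and Hilbert-Schmidt norms -/

section Trace

variable {E F : Type*} [NormedAddCommGroup E] [InnerProductSpace ℝ E]
  [NormedAddCommGroup F] [InnerProductSpace ℝ F]

/-- The trace of a positive bounded operator `T`, as an element of `[0, ∞]`: the supremum of
`∑ e ∈ s, ⟪T e, e⟫` over all finite orthonormal sets `s`. For positive `T` it equals the sum of
`⟪T e, e⟫` over any orthonormal basis. -/
def posTrace (T : E →L[ℝ] E) : ℝ≥0∞ :=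
  ⨆ (s : Finset E) (_ : Orthonormal ℝ (Subtype.val : s → E)),
    ENNReal.ofReal (∑ e ∈ s, ⟪T e, e⟫_ℝ)

/-- The squared Hilbert-Schmidt norm `tr (K* K)`. -/
def hsNormSq [CompleteSpace E] [CompleteSpace F] (K : E →L[ℝ] F) : ℝ≥0∞ :=
  posTrace (ContinuousLinearMap.adjoint K ∘L K)

/-- The effective dimension `Tr ((T + lam I)⁻¹ T)`. -/
def effDim (T : E →L[ℝ] E) (lam : ℝ) : ℝ≥0∞ :=
  posTrace (Ring.inverse (T + lam • (1 : E →L[ℝ] E)) * T)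

theorem norm_le_of_hsNormSq_le [CompleteSpace E] [CompleteSpace F] {K : E →L[ℝ] F} {c : ℝ}
    (hc : 0 ≤ c) (h : hsNormSq K ≤ ENNReal.ofReal (c ^ 2)) : ‖K‖ ≤ c := by
  refine ContinuousLinearMap.opNorm_le_of_unit_norm hc fun v hv => ?_
  have ho : Orthonormal ℝ (Subtype.val : (({v} : Finset E) : Type _) → E) := by
    rw [orthonormal_iff_ite]
    rintro ⟨i, hi⟩ ⟨j, hj⟩
    rw [Finset.mem_singleton] at hi hj
    subst hi
    subst hj
    simp [hv]
  have h1 : ENNReal.ofReal (‖K v‖ ^ 2) ≤ hsNormSq K := by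
    unfold hsNormSq posTrace
    refine le_trans (le_of_eq ?_) (le_iSup₂ (f := fun (s : Finset E)
      (_ : Orthonormal ℝ (Subtype.val : s → E)) =>
        ENNReal.ofReal (∑ e ∈ s, ⟪(ContinuousLinearMap.adjoint K ∘L K) e, e⟫_ℝ)) {v} ho)
    simp [ContinuousLinearMap.adjoint_inner_left]
  have h2 := (ENNReal.ofReal_le_ofReal_iff (sq_nonneg c)).1 (h1.trans h)
  exact (sq_le_sq₀ (norm_nonneg _) hc).1 h2

end Trace

/-! ### Powers of the inverse of an unbounded operator -/

section Powers

variable {H : Type*} [NormedAddCommGroup H] [InnerProductSpace ℝ H]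

/-- `L` is densely defined, self-adjoint (hence closed), strictly positive, and bounded below by
`ell > 0`. -/
structure IsScaleGenerator [CompleteSpace H] (L : H →ₗ.[ℝ] H) (ell : ℝ) : Prop where
  dense : Dense (L.domain : Set H)
  selfAdjoint : IsSelfAdjoint L
  strictPos : ∀ f : L.domain, f ≠ 0 → 0 < ⟪L f, (f : H)⟫_ℝ
  bounded_below : ∀ f : L.domain, ell * ‖(f : H)‖ ≤ ‖L f‖

open Classical in
/-- The everywhere defined bounded inverse `L⁻¹ : H → H` of `L` (`0` if there is none). -/
def invOp (L : H →ₗ.[ℝ] H) : H →L[ℝ] H :=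
  if h : ∃ B : H →L[ℝ] H, (∀ f : L.domain, B (L f) = f) ∧
      ∀ g : H, ∃ f : L.domain, L f = g then h.choose else 0

/-- `T = φ(B)` in the continuous functional calculus of the positive bounded operator `B`:
there are polynomials `P` arbitrarily close to `φ`, uniformly on the interval `[0, ‖B‖]` that
contains the spectrum of `B`, for which `P(B)` is arbitrarily close to `T` in operator norm. This
determines `T`. -/
def IsFunctionalCalculus (B : H →L[ℝ] H) (φ : ℝ → ℝ) (T : H →L[ℝ] H) : Prop :=
  ∀ ε > 0, ∃ P : Polynomial ℝ,
    (∀ t ∈ Icc 0 ‖B‖, |P.eval t - φ t| ≤ ε) ∧ ‖Polynomial.aeval B P - T‖ ≤ ε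

open Classical in
/-- The power `L^{-a}` for `a ≥ 0`, namely `(L⁻¹)^a` in the continuous functional calculus of the
positive bounded operator `L⁻¹`. For `a ≥ 0` the space `H_a = D(L^a)` is the range of `L^{-a}`,
with norm `‖L^{-a} v‖_a = ‖v‖`, and for `f ∈ H` one has `‖f‖_{-a} = ‖L^{-a} f‖`. -/
def negPow (L : H →ₗ.[ℝ] H) (a : ℝ) : H →L[ℝ] H :=
  if h : ∃ T, IsFunctionalCalculus (invOp L) (fun t => t ^ a) T then h.choose else 0

/-- For `a ≥ 0`: the set of `f` with `f - c ∈ H_a` and `‖f - c‖_a ≤ R`. -/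
def scaleBall (L : H →ₗ.[ℝ] H) (a : ℝ) (c : H) (R : ℝ) : Set H :=
  {f | ∃ v : H, f - c = negPow L a v ∧ ‖v‖ ≤ R}

end Powers

/-! ### The vector-valued reproducing kernel Hilbert space -/

section Kernel

variable {X Y : Type*} [MeasurableSpace X] [NormedAddCommGroup Y] [InnerProductSpace ℝ Y]
  [CompleteSpace Y] (G : Type*) [NormedAddCommGroup G] [InnerProductSpace ℝ G] [CompleteSpace G]
  [RKHS ℝ G X Y]

/-- The kernel sections `K_x : Y → G` are Hilbert-Schmidt with `‖K_x‖_HS ≤ κ` for all `x`, and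
`(x, t) ↦ ⟪K_t v, K_x w⟫` is measurable for all `v, w`. -/
structure KernelCondition (κ : ℝ) : Prop where
  nonneg : 0 ≤ κ
  hilbertSchmidt : ∀ x : X, hsNormSq (RKHS.kerFun G x) ≤ ENNReal.ofReal (κ ^ 2)
  measurable : ∀ v w : Y,
    Measurable fun z : X × X => ⟪RKHS.kerFun G z.2 v, RKHS.kerFun G z.1 w⟫_ℝ

variable {G}

theorem KernelCondition.norm_apply_le {κ : ℝ} (h : KernelCondition (X := X) (Y := Y) G κ) (g : G)
    (x : X) : ‖g x‖ ≤ κ * ‖g‖ := by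
  rw [← RKHS.adjoint_kerFun x g]
  refine (ContinuousLinearMap.le_opNorm _ _).trans ?_
  rw [LinearIsometryEquiv.norm_map]
  exact mul_le_mul_of_nonneg_right (norm_le_of_hsNormSq_le h.nonneg (h.hilbertSchmidt x))
    (norm_nonneg _)

theorem KernelCondition.measurable_inner {κ : ℝ} (h : KernelCondition (X := X) (Y := Y) G κ)
    (g : G) (w : Y) : Measurable fun x => ⟪g x, w⟫_ℝ := by
  have hg : g ∈ closure ((Submodule.span ℝ {RKHS.kerFun G x v | (x : X) (v : Y)} :
      Submodule ℝ G) : Set G) := by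
    rw [← Submodule.topologicalClosure_coe, RKHS.kerFun_dense]
    trivial
  obtain ⟨u, hu, hlim⟩ := mem_closure_iff_seq_limit.1 hg
  have hm : ∀ n, Measurable fun x => ⟪(u n) x, w⟫_ℝ := by
    intro n
    refine Submodule.span_induction (p := fun (k : G) _ => Measurable fun x => ⟪k x, w⟫_ℝ)
      ?_ ?_ ?_ ?_ (hu n)
    · rintro _ ⟨t, v, rfl⟩
      have := (h.measurable v w).comp (measurable_id.prodMk (measurable_const (a := t)))
      simpa [Function.comp_def] using this
    · simp
    · intro a b _ _ ha hb
      simp only [RKHS.coe_add, Pi.add_apply, inner_add_left]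
      exact ha.add hb
    · intro c a _ ha
      simp only [RKHS.coe_smul, Pi.smul_apply, inner_smul_left]
      exact ha.const_mul _
  refine measurable_of_tendsto_metrizable hm (tendsto_pi_nhds.2 fun x => ?_)
  exact (((RKHS.continuous_eval x).tendsto g).comp hlim).inner tendsto_const_nhds

theorem KernelCondition.stronglyMeasurable [TopologicalSpace.SeparableSpace Y] {κ : ℝ}
    (h : KernelCondition (X := X) (Y := Y) G κ) (g : G) : StronglyMeasurable fun x : X => g x := by
  let U : ℕ → Submodule ℝ Y := fun n =>
    Submodule.span ℝ (TopologicalSpace.denseSeq Y '' Iic n)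
  have hfin : ∀ n, FiniteDimensional ℝ (U n) := fun n =>
    FiniteDimensional.span_of_finite ℝ ((finite_Iic n).image _)
  have hmono : Monotone U := fun a b hab =>
    Submodule.span_mono (image_mono (Iic_subset_Iic.2 hab))
  have htop : ⊤ ≤ (⨆ n, U n).topologicalClosure := by
    intro y _
    have hy : y ∈ closure (range (TopologicalSpace.denseSeq Y)) :=
      TopologicalSpace.denseRange_denseSeq Y y
    refine closure_mono ?_ hy
    rintro _ ⟨n, rfl⟩
    exact (le_iSup U n) (Submodule.subset_span ⟨n, mem_Iic.2 le_rfl, rfl⟩)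
  refine stronglyMeasurable_of_tendsto (u := atTop)
    (f := fun n x => (U n).starProjection (g x)) (fun n => ?_)
    (tendsto_pi_nhds.2 fun x => Submodule.starProjection_tendsto_self U hmono (g x) htop)
  have hsum : (fun x : X => (U n).starProjection (g x)) = fun x =>
      ∑ i, ⟪g x, ((stdOrthonormalBasis ℝ (U n) i : U n) : Y)⟫_ℝ •
        ((stdOrthonormalBasis ℝ (U n) i : U n) : Y) := by
    funext x
    rw [(stdOrthonormalBasis ℝ (U n)).starProjection_eq_sum_rankOne]
    simp [real_inner_comm]
  rw [hsum]
  refine Finset.stronglyMeasurable_fun_sum _ fun i _ => ?_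
  exact (h.measurable_inner g _).stronglyMeasurable.smul_const _

theorem KernelCondition.memLp [TopologicalSpace.SeparableSpace Y] {κ : ℝ}
    (h : KernelCondition (X := X) (Y := Y) G κ) (ν : Measure X) [IsFiniteMeasure ν] (g : G) :
    MemLp (fun x : X => g x) 2 ν :=
  MemLp.of_bound (h.stronglyMeasurable g).aestronglyMeasurable (κ * ‖g‖)
    (ae_of_all _ (h.norm_apply_le g))

/-- The canonical injection `I_ν : G → L²(X, ν; Y)`. -/
def embL2 [TopologicalSpace.SeparableSpace Y] {κ : ℝ}
    (h : KernelCondition (X := X) (Y := Y) G κ) (ν : Measure X) [IsProbabilityMeasure ν] :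
    G →L[ℝ] Lp Y 2 ν :=
  LinearMap.mkContinuous
    { toFun := fun g => (h.memLp ν g).toLp
      map_add' := fun a b => by
        rw [← MemLp.toLp_add]
        exact MemLp.toLp_congr _ _ (ae_of_all _ fun x => by simp)
      map_smul' := fun c a => by
        rw [RingHom.id_apply, ← MemLp.toLp_const_smul]
        exact MemLp.toLp_congr _ _ (ae_of_all _ fun x => by simp) }
    κ (fun g => by
      refine (Lp.norm_le_of_ae_bound (C := κ * ‖g‖) (mul_nonneg h.nonneg (norm_nonneg _))
        ?_).trans (by simp [measureUnivNNReal])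
      filter_upwards [(h.memLp ν g).coeFn_toLp] with x hx
      simp only [LinearMap.coe_mk, AddHom.coe_mk]
      rw [hx]
      exact h.norm_apply_le g x)

/-- The covariance operator `T_ν = I_ν* I_ν`. -/
def covOp [TopologicalSpace.SeparableSpace Y] {κ : ℝ}
    (h : KernelCondition (X := X) (Y := Y) G κ) (ν : Measure X) [IsProbabilityMeasure ν] :
    G →L[ℝ] G :=
  ContinuousLinearMap.adjoint (embL2 h ν) ∘L embL2 h ν

end Kernel

/-! ### The statistical inverse problem -/

section Model

variable (X Y H G : Type*) [MeasurableSpace X]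
  [NormedAddCommGroup Y] [InnerProductSpace ℝ Y] [CompleteSpace Y]
  [TopologicalSpace.SeparableSpace Y] [MeasurableSpace Y] [BorelSpace Y]
  [NormedAddCommGroup H] [InnerProductSpace ℝ H] [CompleteSpace H]
  [NormedAddCommGroup G] [InnerProductSpace ℝ G] [CompleteSpace G] [RKHS ℝ G X Y]

/-- The data of the inverse problem `A(f) = g`: the input distribution `ν`, the conditional
distribution `ρ(y | x)`, the operator `L`, the forward operator `A` with domain `dom` (the values
of `A` outside `dom` are never used), the true solution `fhat`, and the initial guess
`fbar ∈ D(A) ∩ D(L)`. -/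
structure InverseProblem where
  ν : Measure X
  cond : Kernel X Y
  isProbabilityMeasure : IsProbabilityMeasure ν
  isMarkovKernel : IsMarkovKernel cond
  L : H →ₗ.[ℝ] H
  A : H → G
  dom : Set H
  fhat : H
  fbar : L.domain
  fbar_mem : (fbar : H) ∈ dom

attribute [instance] InverseProblem.isProbabilityMeasure InverseProblem.isMarkovKernel

variable {X Y H G}

namespace InverseProblem

variable (P : InverseProblem X Y H G)

/-- The joint law `ρ(dx, dy) = ρ(dy | x) ν(dx)` of one observation. -/
def dataLaw : Measure (X × Y) := P.ν ⊗ₘ P.cond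

/-- `ρ` has a finite second moment in `y`, and `fhat` is the only point of the interior of the
domain of `A` for which the conditional mean of `y` given `x` is `A(fhat)(x)`. -/
structure TrueSolution : Prop where
  secondMoment : ∫⁻ z, ‖z.2‖ₑ ^ 2 ∂P.dataLaw < ∞
  mem_interior : P.fhat ∈ interior P.dom
  condMean : ∀ᵐ x ∂P.ν, Integrable (fun y => y) (P.cond x) ∧ ∫ y, y ∂P.cond x = P.A P.fhat x
  unique : ∀ f ∈ interior P.dom, (∀ x : X, P.A f x = P.A P.fhat x) → f = P.fhat

/-- The Bernstein-type condition on the noise `ε = y - A(fhat)(x)`. -/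
def NoiseCondition (M Sig : ℝ) : Prop :=
  ∀ᵐ x ∂P.ν, ∫⁻ y, ENNReal.ofReal (Real.exp (‖y - P.A P.fhat x‖ / M)
    - ‖y - P.A P.fhat x‖ / M - 1) ∂P.cond x ≤ ENNReal.ofReal (Sig ^ 2 / (2 * M ^ 2))

/-- The domain of `A` is convex and closed, `A` is weak-to-weak sequentially continuous, and
`A` is `ellA`-Lipschitz on the part of its domain in the ball of radius `D` around `fhat`. -/
structure OperatorCondition (ellA D : ℝ) : Prop where
  convex : Convex ℝ P.dom
  closed : IsClosed P.dom
  weakContinuous : ∀ (f : ℕ → H) (f₀ : H), (∀ n, f n ∈ P.dom) → f₀ ∈ P.dom →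
    (∀ w : H, Tendsto (fun n => ⟪f n, w⟫_ℝ) atTop (𝓝 ⟪f₀, w⟫_ℝ)) →
    ∀ g : G, Tendsto (fun n => ⟪P.A (f n), g⟫_ℝ) atTop (𝓝 ⟪P.A f₀, g⟫_ℝ)
  lipschitz : ∀ f ∈ Metric.closedBall P.fhat D ∩ P.dom,
    ∀ g ∈ Metric.closedBall P.fhat D ∩ P.dom, ‖P.A f - P.A g‖ ≤ ellA * ‖f - g‖

/-- The prediction distance `‖I_ν (A(f) - A(fhat))‖` in `L²(X, ν; Y)`. -/
def predDist {κ : ℝ} (hK : KernelCondition (X := X) (Y := Y) G κ) (f : H) : ℝ :=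
  ‖embL2 hK P.ν (P.A f - P.A P.fhat)‖

/-- The conditional stability estimate on `Q`, where `Q` is contained in the domain of `A` and in
the ball of radius `d` around `fhat` for the norm of `H_θ`. -/
structure ConditionalStability {κ : ℝ} (hK : KernelCondition (X := X) (Y := Y) G κ) (Q : Set H)
    (p s α θ d : ℝ) : Prop where
  subset : Q ⊆ scaleBall P.L θ P.fhat d ∩ P.dom
  estimate : ∀ f ∈ Q, ‖negPow P.L p (f - P.fhat)‖ ≤ α * P.predDist hK f ^ s

/-- The converse estimate on `Q`. -/
def ConverseStability {κ : ℝ} (hK : KernelCondition (X := X) (Y := Y) G κ) (Q : Set H)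
    (p s α β : ℝ) : Prop :=
  ∀ f ∈ Q, α * P.predDist hK f ^ s ≤ β * ‖negPow P.L p (f - P.fhat)‖

/-- `f` minimizes the distance to `fhat` among the elements of the form `fbar + L^{-q} v` with
`‖v‖ ≤ R`, i.e. `f` is the element attaining the distance function `d(R)`. -/
def IsBenchmark (q R : ℝ) (f : H) : Prop :=
  f ∈ scaleBall P.L q P.fbar R ∧ ∀ g ∈ scaleBall P.L q P.fbar R, ‖f - P.fhat‖ ≤ ‖g - P.fhat‖

/-- The Tikhonov functional for the sample `z` and the regularization parameter `lam`. -/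
def tikhonov {m : ℕ} (z : Fin m → X × Y) (lam : ℝ) (f : P.L.domain) : ℝ :=
  (1 / (m : ℝ)) * ∑ i, ‖P.A f (z i).1 - (z i).2‖ ^ 2 + lam * ‖P.L (f - P.fbar)‖ ^ 2

/-- `f` is a global minimizer of the Tikhonov functional over `D(A) ∩ D(L)`. -/
def IsTikhonovMinimizer {m : ℕ} (z : Fin m → X × Y) (lam : ℝ) (f : P.L.domain) : Prop :=
  (f : H) ∈ P.dom ∧ ∀ g : P.L.domain, (g : H) ∈ P.dom → P.tikhonov z lam f ≤ P.tikhonov z lam g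

/-- For `m` independent observations, with probability at least `1 - η`, every Tikhonov minimizer
that lies in `Q` is within distance `B` of `fhat`. -/
def ErrorBound (Q : Set H) (m : ℕ) (lam η B : ℝ) : Prop :=
  ∃ E : Set (Fin m → X × Y), MeasurableSet E ∧
    ENNReal.ofReal (1 - η) ≤ Measure.pi (fun _ : Fin m => P.dataLaw) E ∧
    ∀ z ∈ E, ∀ f : P.L.domain, P.IsTikhonovMinimizer z lam f → (f : H) ∈ Q →
      ‖(f : H) - P.fhat‖ ≤ B

end InverseProblem

end Model

end HilbertScales

end

set_option linter.unusedSectionVars false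

noncomputable section

namespace HilbertScales

/-! ### Functional calculus of a positive operator on a real Hilbert space -/

section Calculus

variable {H : Type*} [NormedAddCommGroup H] [InnerProductSpace ℝ H]

/-! A Tikhonov minimizer `f` is compared with a reference point `f0` that has smoothness `q` around
`fbar`: the true solution if `r ≥ q`, and otherwise its projection `fR` onto a ball of `H_q`.
Minimality, once expanded, becomes a single scalar inequality (`BasicIneq`) between the prediction
error `x`, the penalty error `y = ‖L(f - f0)‖` and the weak error `z = ‖f - f0‖_{-p}`.

Randomness enters through two sums preconditioned by `W = (T_ν + λ)^{-1/2}`: the noise `∑ W K_{x_i}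
ε_i` and the covariance deviation `∑ (W K_{x_i} K_{x_i}* - W T_ν)`. Pinelis' inequality, based on `E
cosh ‖s + ξ‖ ≤ cosh ‖s‖ (1 + E(exp ‖ξ‖ - 1 - ‖ξ‖))`, bounds both of them after division by `m`, with
probability `1 - η`, by a multiple of `(1/(m√λ) + √(N/m)) log(4/η)`, where `N = C_N λ^{-b}`. For `λ
= m^{-1/(2u+b)}` the second summand has order `λ^u`. The first is no larger when `u ≥ 1/2`, in
particular when `r ≥ 1`; for `r < 1` this follows from `𝒩(λ) ≤ mλ` and `𝒩(1) ≤ 𝒩(λ)`.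

Put `μ = λ^u log(4/η)` and `F = x + √λ y + μ`. The stochastic terms of the energy inequality are at
most a constant times `μF`. Here the Lipschitz bound on the ball of radius `D` controls one of the
two factors `‖A(f) - A(fhat)‖`, so that an additive estimate for the covariance suffices. The
penalty cross term is `⟪L^{-(q-1)} L(f - f0), v⟫`; interpolation between `H_{-p}` and `H_1` together
with conditional stability bounds it by `μ^k F^{2-k}` with `k = ((p+q) - s(q-1))/(p+1)`. Since
`q(s-1) < p+s` means `k > 0`, this forces `F ≲ μ` (`BasicIneq.energy_le`), and one more
interpolation gives the rate in `H` (`BasicIneq.exists_bound`).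

In the benchmark case the Lagrange condition for the projection writes `fhat - fR = L^{-r} e` with
`e = μ(L^{-2q} + μ)^{-1} v` for a multiplier `μ` (`exists_residual`, unless the residual vanishes).
Interpolation in the scale and the converse stability estimate then bound the prediction error of
`fR`, and `benchmark_radius_bounds` shows that either choice of `R` balances the cross term.

All operator powers come from a polynomial functional calculus whose key estimate is
`IsPos.norm_aeval_le`. -/

/-- Symmetry and positivity of a bounded operator on a real Hilbert space. -/
structure IsPos (B : H →L[ℝ] H) : Prop where
  symm : ∀ x y, ⟪B x, y⟫_ℝ = ⟪x, B y⟫_ℝ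
  nonneg : ∀ x, 0 ≤ ⟪B x, x⟫_ℝ

/-- `B` is bounded below. -/
def BddBelow (B : H →L[ℝ] H) : Prop := ∃ c > 0, ∀ x, c * ‖x‖ ≤ ‖B x‖

theorem BddBelow.mul {A B : H →L[ℝ] H} (hA : BddBelow A) (hB : BddBelow B) :
    BddBelow (A * B) := by
  obtain ⟨a, ha, hA⟩ := hA
  obtain ⟨b, hb, hB⟩ := hB
  refine ⟨a * b, mul_pos ha hb, fun x => ?_⟩
  calc a * b * ‖x‖ = a * (b * ‖x‖) := by ring
    _ ≤ a * ‖B x‖ := by gcongr; exact hB x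
    _ ≤ ‖A (B x)‖ := hA _

theorem BddBelow.of_inner {B : H →L[ℝ] H} {c : ℝ} (hc : 0 < c)
    (h : ∀ x, c * ‖x‖ ^ 2 ≤ |⟪B x, x⟫_ℝ|) : BddBelow B := by
  refine ⟨c, hc, fun x => ?_⟩
  rcases eq_or_ne x 0 with rfl | hx
  · simp
  have h1 : c * ‖x‖ ^ 2 ≤ ‖B x‖ * ‖x‖ := (h x).trans (abs_real_inner_le_norm _ _)
  have h2 : 0 < ‖x‖ := norm_pos_iff.2 hx
  nlinarith

variable {B : H →L[ℝ] H}

theorem IsPos.inner_le (x : H) : ⟪B x, x⟫_ℝ ≤ ‖B‖ * ‖x‖ ^ 2 := by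
  calc ⟪B x, x⟫_ℝ ≤ ‖B x‖ * ‖x‖ := real_inner_le_norm _ _
    _ ≤ ‖B‖ * ‖x‖ * ‖x‖ := by gcongr; exact B.le_opNorm x
    _ = ‖B‖ * ‖x‖ ^ 2 := by ring

/-- A real irreducible polynomial is linear or a quadratic without real roots. In the linear case
the root lies outside `[0, ‖B‖]`, hence away from all Rayleigh quotients of `B`; the quadratic case
is completion of the square. -/
theorem IsPos.bddBelow_aeval_irreducible (hB : IsPos B) {S : Polynomial ℝ} (hS : Irreducible S)
    (h0 : ∀ t ∈ Icc 0 ‖B‖, S.eval t ≠ 0) : BddBelow (Polynomial.aeval B S) := by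
  have hdeg := hS.degree_le_two
  have hform := Polynomial.eq_quadratic_of_degree_le_two hdeg
  set a := S.coeff 2
  set b := S.coeff 1
  set c := S.coeff 0
  have hev : ∀ t, S.eval t = a * t ^ 2 + b * t + c := fun t => by rw [hform]; simp
  have haev : ∀ x, Polynomial.aeval B S x = a • B (B x) + b • B x + c • x := fun x => by
    rw [hform]
    simp [Polynomial.aeval_C, Algebra.algebraMap_eq_smul_one, pow_two]
  have hin : ∀ x, ⟪Polynomial.aeval B S x, x⟫_ℝ = a * ‖B x‖ ^ 2 + b * ⟪B x, x⟫_ℝ + c * ‖x‖ ^ 2 := by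
    intro x
    rw [haev, inner_add_left, inner_add_left, inner_smul_left, inner_smul_left, inner_smul_left,
      hB.symm (B x) x, real_inner_self_eq_norm_sq, real_inner_self_eq_norm_sq]
    simp
  by_cases ha : a = 0
  · have hb : b ≠ 0 := by
      intro hb
      apply hS.not_isUnit
      have hS' : S = Polynomial.C c := by rw [hform, ha, hb]; simp
      have : c ≠ 0 := by rintro hc; exact hS.ne_zero (by rw [hS', hc]; simp)
      rw [hS', Polynomial.isUnit_C]
      exact isUnit_iff_ne_zero.2 this
    have hr : -c / b ∉ Icc 0 ‖B‖ := fun h => h0 _ h (by rw [hev, ha]; field_simp; ring)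
    have key : ∀ x, ⟪Polynomial.aeval B S x, x⟫_ℝ = b * (⟪B x, x⟫_ℝ - (-c / b) * ‖x‖ ^ 2) := by
      intro x; rw [hin, ha]; field_simp; ring
    set r := -c / b
    rw [mem_Icc, not_and_or, not_le, not_le] at hr
    rcases hr with hr | hr
    · refine BddBelow.of_inner (c := |b| * (-r)) (mul_pos (abs_pos.2 hb) (by linarith)) fun x => ?_
      rw [key, abs_mul, mul_assoc]
      gcongr
      rw [abs_of_nonneg] <;> nlinarith [hB.nonneg x, sq_nonneg ‖x‖]
    · refine BddBelow.of_inner (c := |b| * (r - ‖B‖)) (mul_pos (abs_pos.2 hb) (by linarith))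
        fun x => ?_
      rw [key, abs_mul, mul_assoc]
      gcongr
      rw [abs_sub_comm]
      refine le_trans ?_ (le_abs_self _)
      nlinarith [IsPos.inner_le (B := B) x]
  · have hd : b ^ 2 - 4 * a * c < 0 := by
      by_contra hd
      push Not at hd
      have hroot : S.IsRoot ((-b + √(b ^ 2 - 4 * a * c)) / (2 * a)) := by
        rw [Polynomial.IsRoot, hev]
        have := Real.sq_sqrt hd
        field_simp
        ring_nf at this ⊢
        linear_combination this
      have h1 := Polynomial.degree_eq_one_of_irreducible_of_root hS hroot
      have : S.natDegree = 1 := Polynomial.natDegree_eq_of_degree_eq_some h1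
      exact ha (Polynomial.coeff_eq_zero_of_natDegree_lt (by omega))
    have ha2 : 0 < |a| := abs_pos.2 ha
    refine BddBelow.of_inner (c := (4 * a * c - b ^ 2) / (4 * |a|)) (by apply div_pos <;> linarith)
      fun x => ?_
    -- Completing the square: `4a S(B) = (2aB + b)² + (4ac - b²)`, with a positive last term.
    have h1 : 0 ≤ ‖(2 * a) • B x + b • x‖ ^ 2 := sq_nonneg _
    rw [norm_add_sq_real, norm_smul, norm_smul, inner_smul_left, inner_smul_right, mul_pow, mul_pow,
      Real.norm_eq_abs, sq_abs, Real.norm_eq_abs, sq_abs] at h1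
    simp only [conj_trivial] at h1
    have h2 : 4 * |a| * |⟪Polynomial.aeval B S x, x⟫_ℝ| ≥ (4 * a * c - b ^ 2) * ‖x‖ ^ 2 := by
      rw [mul_assoc, ← abs_mul, hin]
      refine le_trans ?_ (mul_le_mul_of_nonneg_left (le_abs_self _) (by norm_num))
      nlinarith
    rw [div_mul_eq_mul_div, div_le_iff₀ (by positivity)]
    linarith

/-- A substitute for spectral mapping: factor over `ℝ` and multiply the lower bounds of the factors.
-/
theorem IsPos.bddBelow_aeval (hB : IsPos B) (S : Polynomial ℝ)
    (h0 : ∀ t ∈ Icc 0 ‖B‖, S.eval t ≠ 0) : BddBelow (Polynomial.aeval B S) := by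
  induction S using UniqueFactorizationMonoid.induction_on_prime with
  | h₁ => exact absurd (by simp) (h0 0 ⟨le_rfl, norm_nonneg _⟩)
  | h₂ S hS =>
    obtain ⟨c, hc, rfl⟩ := Polynomial.isUnit_iff.1 hS
    refine ⟨‖c‖, norm_pos_iff.2 hc.ne_zero, fun x => ?_⟩
    simp [Polynomial.aeval_C, Algebra.algebraMap_eq_smul_one, norm_smul]
  | h₃ S R hS hR ih =>
    rw [map_mul]
    refine (hB.bddBelow_aeval_irreducible hR.irreducible fun t ht h => h0 t ht ?_).mul
      (ih fun t ht h => h0 t ht ?_) <;> simp [h]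

theorem IsPos.aeval_symm (hB : IsPos B) (S : Polynomial ℝ) (x y : H) :
    ⟪Polynomial.aeval B S x, y⟫_ℝ = ⟪x, Polynomial.aeval B S y⟫_ℝ := by
  have hpow : ∀ n : ℕ, ∀ x y, ⟪B^[n] x, y⟫_ℝ = ⟪x, B^[n] y⟫_ℝ := by
    intro n
    induction n with
    | zero => intro x y; simp
    | succ n ih =>
      intro x y
      rw [Function.iterate_succ_apply, ih, hB.symm, Function.iterate_succ_apply']
  induction S using Polynomial.induction_on' with
  | add P Q hP hQ => simp [inner_add_left, inner_add_right, hP, hQ]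
  | monomial n a =>
    simp [Polynomial.aeval_monomial, Algebra.algebraMap_eq_smul_one, inner_smul_left,
      inner_smul_right, hpow]

/-- If `N = ‖S(B)‖` exceeded `c`, then `S² - N²` would have no zero on `[0, ‖B‖]`, so `S(B)² - N²`
would be bounded below. Expanding the square of that lower bound gives `‖S(B)‖ < N`, a
contradiction. -/
theorem IsPos.norm_aeval_le (hB : IsPos B) (S : Polynomial ℝ) {c : ℝ}
    (h : ∀ t ∈ Icc 0 ‖B‖, |S.eval t| ≤ c) : ‖Polynomial.aeval B S‖ ≤ c := by
  by_contra hlt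
  push Not at hlt
  set N := ‖Polynomial.aeval B S‖
  have hc : 0 ≤ c := (abs_nonneg _).trans (h 0 ⟨le_rfl, norm_nonneg _⟩)
  have hN : 0 < N := hc.trans_lt hlt
  obtain ⟨k, hk, hbd⟩ := hB.bddBelow_aeval (S ^ 2 - Polynomial.C (N ^ 2)) (fun t ht h0 => by
    have h1 : S.eval t ^ 2 = N ^ 2 := by simpa [sub_eq_zero] using h0
    have h2 := h t ht
    have h3 : |S.eval t| ^ 2 = N ^ 2 := by rw [sq_abs, h1]
    have h4 := pow_lt_pow_left₀ (h2.trans_lt hlt) (abs_nonneg _) two_ne_zero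
    linarith)
  set A := Polynomial.aeval B S
  have hA : ∀ x, Polynomial.aeval B (S ^ 2 - Polynomial.C (N ^ 2)) x = A (A x) - N ^ 2 • x := by
    intro x
    simp [A, pow_two, Algebra.algebraMap_eq_smul_one, mul_smul]
  have key : ∀ x, ‖A x‖ ^ 2 * (2 * N ^ 2) ≤ (2 * N ^ 4 - k ^ 2) * ‖x‖ ^ 2 := by
    intro x
    have h1 := pow_le_pow_left₀ (by positivity) (hbd x) 2
    rw [hA, norm_sub_sq_real, inner_smul_right, norm_smul, hB.aeval_symm S (A x) x,
      real_inner_self_eq_norm_sq, Real.norm_of_nonneg (by positivity)] at h1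
    have h2 : ‖A (A x)‖ ^ 2 ≤ N ^ 2 * ‖A x‖ ^ 2 := by
      rw [← mul_pow]; exact pow_le_pow_left₀ (norm_nonneg _) (A.le_opNorm _) 2
    have h3 : ‖A x‖ ^ 2 ≤ N ^ 2 * ‖x‖ ^ 2 := by
      rw [← mul_pow]; exact pow_le_pow_left₀ (norm_nonneg _) (A.le_opNorm _) 2
    change (k * ‖x‖) ^ 2 ≤ ‖A (A x)‖ ^ 2 - 2 * (N ^ 2 * ‖A x‖ ^ 2) + (N ^ 2 * ‖x‖) ^ 2 at h1
    have h4 := mul_le_mul_of_nonneg_left h3 (sq_nonneg N)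
    nlinarith
  set M := (2 * N ^ 4 - k ^ 2) / (2 * N ^ 2)
  have hM : M < N ^ 2 := by
    rw [div_lt_iff₀ (by positivity)]
    nlinarith [sq_pos_of_pos hk]
  have h5 : N ≤ √(max M 0) := by
    refine ContinuousLinearMap.opNorm_le_bound _ (Real.sqrt_nonneg _) fun x => ?_
    have h6 : ‖A x‖ ^ 2 ≤ M * ‖x‖ ^ 2 := by
      rw [div_mul_eq_mul_div, le_div_iff₀ (by positivity)]; exact key x
    rw [← Real.sqrt_sq (norm_nonneg x), ← Real.sqrt_mul (le_max_right _ _)]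
    refine Real.le_sqrt_of_sq_le (h6.trans ?_)
    gcongr
    exact le_max_left _ _
  have h7 : √(max M 0) < N := by
    rw [Real.sqrt_lt' hN]
    exact max_lt hM (by positivity)
  linarith

variable {φ ψ : ℝ → ℝ} {S T : H →L[ℝ] H}

/-- Weierstrass polynomials for `φ` are uniformly Cauchy on `[0, ‖B‖]`, hence so are their values at
`B`, by the norm bound for polynomials. -/
theorem IsPos.exists_isFunctionalCalculus [CompleteSpace H] (hB : IsPos B)
    (hφ : ContinuousOn φ (Icc 0 ‖B‖)) : ∃ T, IsFunctionalCalculus B φ T := by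
  choose P hP using fun n : ℕ =>
    exists_polynomial_near_of_continuousOn 0 ‖B‖ φ hφ (1 / ((n : ℝ) + 1)) (by positivity)
  have hc : CauchySeq fun n => Polynomial.aeval B (P n) := by
    refine cauchySeq_of_le_tendsto_0 (fun N : ℕ => 2 * (1 / ((N : ℝ) + 1))) (fun n m N hn hm => ?_)
      (by simpa using (tendsto_one_div_add_atTop_nhds_zero_nat (𝕜 := ℝ)).const_mul 2)
    rw [dist_eq_norm, ← map_sub]
    refine hB.norm_aeval_le _ fun t ht => ?_
    have h1 := (hP n t ht).le.trans (one_div_le_one_div_of_le (by positivity)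
      (by gcongr : (N : ℝ) + 1 ≤ n + 1))
    have h2 := (hP m t ht).le.trans (one_div_le_one_div_of_le (by positivity)
      (by gcongr : (N : ℝ) + 1 ≤ m + 1))
    rw [abs_sub_comm] at h2
    rw [Polynomial.eval_sub]
    linarith [abs_sub_le ((P n).eval t) (φ t) ((P m).eval t)]
  obtain ⟨T, hT⟩ := cauchySeq_tendsto_of_complete hc
  refine ⟨T, fun ε hε => ?_⟩
  have h1 := (tendsto_one_div_add_atTop_nhds_zero_nat (𝕜 := ℝ)).eventually (gt_mem_nhds hε)
  have h2 := (tendsto_iff_norm_sub_tendsto_zero.1 hT).eventually (gt_mem_nhds hε)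
  obtain ⟨n, hn1, hn2⟩ := (h1.and h2).exists
  exact ⟨P n, fun t ht => (hP n t ht).le.trans hn1.le, hn2.le⟩

theorem IsFunctionalCalculus.norm_le (hB : IsPos B) (hT : IsFunctionalCalculus B φ T) {c : ℝ}
    (h : ∀ t ∈ Icc 0 ‖B‖, |φ t| ≤ c) : ‖T‖ ≤ c := by
  refine le_of_forall_pos_le_add fun ε hε => ?_
  obtain ⟨P, hP, hPT⟩ := hT (ε / 2) (by linarith)
  have h1 : ‖Polynomial.aeval B P‖ ≤ c + ε / 2 := hB.norm_aeval_le _ fun t ht => by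
    have := abs_add_le (P.eval t - φ t) (φ t)
    rw [sub_add_cancel] at this
    linarith [h t ht, hP t ht]
  have h2 := norm_sub_norm_le T (Polynomial.aeval B P)
  rw [norm_sub_rev] at h2
  linarith

theorem isFunctionalCalculus_aeval (P : Polynomial ℝ) :
    IsFunctionalCalculus B (fun t => P.eval t) (Polynomial.aeval B P) :=
  fun ε hε => ⟨P, by simp [hε.le], by simp [hε.le]⟩

theorem isFunctionalCalculus_const (c : ℝ) : IsFunctionalCalculus B (fun _ => c) (c • 1) := by
  simpa [Algebra.algebraMap_eq_smul_one] using
    isFunctionalCalculus_aeval (B := B) (Polynomial.C c)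

theorem isFunctionalCalculus_id : IsFunctionalCalculus B (fun t => t) B := by
  simpa using isFunctionalCalculus_aeval (B := B) Polynomial.X

theorem IsFunctionalCalculus.add (hT : IsFunctionalCalculus B φ T)
    (hS : IsFunctionalCalculus B ψ S) : IsFunctionalCalculus B (fun t => φ t + ψ t) (T + S) := by
  intro ε hε
  obtain ⟨P, hP, hPT⟩ := hT (ε / 2) (by linarith)
  obtain ⟨Q, hQ, hQS⟩ := hS (ε / 2) (by linarith)
  refine ⟨P + Q, fun t ht => ?_, ?_⟩
  · rw [Polynomial.eval_add, add_sub_add_comm]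
    linarith [hP t ht, hQ t ht, abs_add_le (P.eval t - φ t) (Q.eval t - ψ t)]
  · rw [map_add, add_sub_add_comm]
    linarith [norm_add_le (Polynomial.aeval B P - T) (Polynomial.aeval B Q - S)]

theorem IsFunctionalCalculus.mul (hB : IsPos B) (hT : IsFunctionalCalculus B φ T)
    (hS : IsFunctionalCalculus B ψ S) : IsFunctionalCalculus B (fun t => φ t * ψ t) (T * S) := by
  intro ε hε
  obtain ⟨Q, hQ, hQS⟩ := hS 1 one_pos
  obtain ⟨P, hP, hPT⟩ := hT 1 one_pos
  have hbd : ∀ R : Polynomial ℝ, ∃ c, ∀ t ∈ Icc 0 ‖B‖, |R.eval t| ≤ c := fun R =>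
    (isCompact_Icc (a := (0 : ℝ)) (b := ‖B‖)).exists_bound_of_continuousOn
      R.continuous.continuousOn
  obtain ⟨c, hc⟩ := hbd P
  obtain ⟨d, hd⟩ := hbd Q
  have hc0 := (abs_nonneg _).trans (hc 0 ⟨le_rfl, norm_nonneg _⟩)
  have hd0 := (abs_nonneg _).trans (hd 0 ⟨le_rfl, norm_nonneg _⟩)
  have hφ : ∀ t ∈ Icc 0 ‖B‖, |φ t| ≤ c + 1 := fun t ht => by
    have := abs_sub_le (φ t) (P.eval t) 0
    simp only [sub_zero] at this
    linarith [hP t ht, abs_sub_comm (φ t) (P.eval t), hc t ht]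
  have hψ : ∀ t ∈ Icc 0 ‖B‖, |ψ t| ≤ d + 1 := fun t ht => by
    have := abs_sub_le (ψ t) (Q.eval t) 0
    simp only [sub_zero] at this
    linarith [hQ t ht, abs_sub_comm (ψ t) (Q.eval t), hd t ht]
  have hTn := hT.norm_le hB hφ
  have hSn := hS.norm_le hB hψ
  -- The product error splits into three terms with total at most `δ + δ(d+1) + (c+1)δ = δ(c+d+3)`.
  set δ := min 1 (ε / (c + d + 3))
  have hδ : 0 < δ := lt_min one_pos (by positivity)
  have hδ2 : δ * (c + d + 3) ≤ ε := by
    rw [← le_div_iff₀ (by positivity)]; exact min_le_right _ _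
  have hδ1 : δ ≤ 1 := min_le_left _ _
  obtain ⟨P', hP', hPT'⟩ := hT δ hδ
  obtain ⟨Q', hQ', hQS'⟩ := hS δ hδ
  refine ⟨P' * Q', fun t ht => ?_, ?_⟩
  · rw [Polynomial.eval_mul]
    calc |P'.eval t * Q'.eval t - φ t * ψ t|
        = |(P'.eval t - φ t) * (Q'.eval t - ψ t) + (P'.eval t - φ t) * ψ t
            + φ t * (Q'.eval t - ψ t)| := by congr 1; ring
      _ ≤ |P'.eval t - φ t| * |Q'.eval t - ψ t| + |P'.eval t - φ t| * |ψ t|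
            + |φ t| * |Q'.eval t - ψ t| := by
          rw [← abs_mul, ← abs_mul, ← abs_mul]; exact abs_add_three _ _ _
      _ ≤ δ * 1 + δ * (d + 1) + (c + 1) * δ := by
          gcongr
          exacts [hP' t ht, (hQ' t ht).trans hδ1, hP' t ht, hψ t ht, hφ t ht, hQ' t ht]
      _ ≤ ε := by linarith
  · rw [map_mul]
    set U := Polynomial.aeval B P'
    set V := Polynomial.aeval B Q'
    calc ‖U * V - T * S‖ = ‖(U - T) * (V - S) + (U - T) * S + T * (V - S)‖ := by
          congr 1; noncomm_ring
      _ ≤ ‖U - T‖ * ‖V - S‖ + ‖U - T‖ * ‖S‖ + ‖T‖ * ‖V - S‖ := by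
          refine (norm_add₃_le).trans ?_
          gcongr <;> exact norm_mul_le _ _
      _ ≤ δ * 1 + δ * (d + 1) + (c + 1) * δ := by
          gcongr
          exact hQS'.trans hδ1
      _ ≤ ε := by linarith

theorem IsFunctionalCalculus.const_mul (hB : IsPos B) (hT : IsFunctionalCalculus B φ T) (c : ℝ) :
    IsFunctionalCalculus B (fun t => c * φ t) (c • T) := by
  simpa using (isFunctionalCalculus_const c).mul hB hT

theorem IsFunctionalCalculus.sub (hB : IsPos B) (hT : IsFunctionalCalculus B φ T)
    (hS : IsFunctionalCalculus B ψ S) : IsFunctionalCalculus B (fun t => φ t - ψ t) (T - S) := by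
  simpa [sub_eq_add_neg] using hT.add (hS.const_mul hB (-1))

theorem IsFunctionalCalculus.unique (hB : IsPos B) (hT : IsFunctionalCalculus B φ T)
    (hS : IsFunctionalCalculus B ψ S) (h : ∀ t ∈ Icc 0 ‖B‖, φ t = ψ t) : T = S := by
  have := (hT.sub hB hS).norm_le hB (c := 0) fun t ht => by simp [h t ht]
  exact sub_eq_zero.1 (norm_le_zero_iff.1 this)

theorem IsFunctionalCalculus.symm (hB : IsPos B) (hT : IsFunctionalCalculus B φ T) (x y : H) :
    ⟪T x, y⟫_ℝ = ⟪x, T y⟫_ℝ := by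
  rw [← sub_eq_zero, ← abs_nonpos_iff]
  refine le_of_forall_pos_le_add fun ε hε => ?_
  obtain ⟨P, -, hP⟩ := hT (ε / (2 * (‖x‖ * ‖y‖ + 1))) (by positivity)
  set U := Polynomial.aeval B P
  have h1 : ⟪T x, y⟫_ℝ - ⟪x, T y⟫_ℝ = ⟪x, (U - T) y⟫_ℝ - ⟪(U - T) x, y⟫_ℝ := by
    simp only [sub_apply, inner_sub_left, inner_sub_right, U,
      hB.aeval_symm P x y]
    ring
  have h2 : |⟪x, (U - T) y⟫_ℝ| ≤ ‖x‖ * (‖U - T‖ * ‖y‖) :=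
    (abs_real_inner_le_norm _ _).trans (by gcongr; exact (U - T).le_opNorm y)
  have h3 : |⟪(U - T) x, y⟫_ℝ| ≤ ‖U - T‖ * ‖x‖ * ‖y‖ :=
    (abs_real_inner_le_norm _ _).trans (by gcongr; exact (U - T).le_opNorm x)
  have h4 : ‖U - T‖ * (2 * (‖x‖ * ‖y‖ + 1)) ≤ ε := by
    rwa [← le_div_iff₀ (by positivity)]
  rw [h1]
  linarith [abs_sub ⟪x, (U - T) y⟫_ℝ ⟪(U - T) x, y⟫_ℝ, norm_nonneg (U - T)]

/-- `√φ` is continuous, so `T` is the square of a symmetric operator. -/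
theorem IsFunctionalCalculus.nonneg [CompleteSpace H] (hB : IsPos B)
    (hT : IsFunctionalCalculus B φ T)
    (hφ : ContinuousOn φ (Icc 0 ‖B‖)) (h : ∀ t ∈ Icc 0 ‖B‖, 0 ≤ φ t) (x : H) :
    0 ≤ ⟪T x, x⟫_ℝ := by
  obtain ⟨S, hS⟩ := hB.exists_isFunctionalCalculus (φ := fun t => √(φ t)) hφ.sqrt
  have : T = S * S := hT.unique hB (hS.mul hB hS) fun t ht => (Real.mul_self_sqrt (h t ht)).symm
  rw [this, mul_apply_eq_comp, hS.symm hB]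
  exact real_inner_self_nonneg

/-- Pointwise inequalities between symbols pass to quadratic forms; this is what replaces
integration against a spectral measure. -/
theorem IsFunctionalCalculus.norm_sq_le_of_le [CompleteSpace H] (hB : IsPos B)
    (hT : IsFunctionalCalculus B φ T) (hS : IsFunctionalCalculus B ψ S)
    (hφ : ContinuousOn φ (Icc 0 ‖B‖)) (hψ : ContinuousOn ψ (Icc 0 ‖B‖)) {c d : ℝ}
    (h : ∀ t ∈ Icc 0 ‖B‖, φ t ^ 2 ≤ c * ψ t ^ 2 + d) (x : H) :
    ‖T x‖ ^ 2 ≤ c * ‖S x‖ ^ 2 + d * ‖x‖ ^ 2 := by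
  have h1 := ((((hS.mul hB hS).const_mul hB c).add (isFunctionalCalculus_const d)).sub hB
    (hT.mul hB hT)).nonneg hB (by fun_prop) (fun t ht => by nlinarith [h t ht]) x
  simp only [sub_apply, add_apply,
    smul_apply, mul_apply_eq_comp, inner_sub_left,
    inner_add_left, inner_smul_left, hS.symm hB (S x) x, hT.symm hB (T x) x,
    one_apply_eq_self, real_inner_self_eq_norm_sq, conj_trivial] at h1
  linarith

/-- With a spectral measure this would be Hölder's inequality. Here Young's inequality bounds
`t^{2a}` by a weighted sum of `t^{2b}` and a constant, and the weight is tuned to the vector `x`. -/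
theorem IsFunctionalCalculus.interpolation [CompleteSpace H] (hB : IsPos B) {a b : ℝ}
    (ha : 0 ≤ a) (hab : a ≤ b)
    (hS : IsFunctionalCalculus B (fun t => t ^ a) S)
    (hT : IsFunctionalCalculus B (fun t => t ^ b) T) (x : H) :
    ‖S x‖ ≤ ‖T x‖ ^ (a / b) * ‖x‖ ^ (1 - a / b) := by
  rcases ha.eq_or_lt with rfl | ha
  · have : S = (1 : ℝ) • 1 := hS.unique hB (isFunctionalCalculus_const 1) (by simp)
    simp [this]
  rcases hab.eq_or_lt with rfl | hab'
  · rw [hS.unique hB hT fun _ _ => rfl, div_self ha.ne']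
    simp
  have hb : 0 < b := ha.trans_le hab
  set θ := a / b with hθ
  have hθ0 : 0 < θ := div_pos ha hb
  have hθ1 : θ < 1 := (div_lt_one hb).2 hab'
  rcases eq_or_ne x 0 with rfl | hx
  · have : (0 : ℝ) ^ (1 - θ) = 0 := Real.zero_rpow (by linarith)
    simp [this]
  have hW : 0 < ‖x‖ ^ 2 := by positivity
  have hcont : ∀ c : ℝ, 0 < c → ContinuousOn (fun t : ℝ => t ^ c) (Icc 0 ‖B‖) := fun c hc =>
    (Real.continuous_rpow_const hc.le).continuousOn
  -- The optimal weight involves `‖x‖² / ‖T x‖²`. Replacing `‖T x‖²` by a larger `U` avoids a zero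
  -- denominator; the limit `U ↓ ‖T x‖²` is taken afterwards.
  have key : ∀ U : ℝ, ‖T x‖ ^ 2 < U → ‖S x‖ ^ 2 ≤ U ^ θ * (‖x‖ ^ 2) ^ (1 - θ) := by
    intro U hU
    have hU0 : 0 < U := (sq_nonneg _).trans_lt hU
    set w := ‖x‖ ^ 2 with hw
    set k := (w / U) ^ (1 - θ) with hk
    have hk0 : 0 < k := by positivity
    have h1 := hS.norm_sq_le_of_le hB hT (hcont a ha) (hcont b hb) (c := θ * k)
      (d := (1 - θ) * (w / U) ^ (-θ)) (fun t ht => by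
        have h2 := Real.geom_mean_le_arith_mean2_weighted hθ0.le (by linarith : 0 ≤ 1 - θ)
          (by positivity : 0 ≤ k * (t ^ b) ^ 2) (by positivity : 0 ≤ (w / U) ^ (-θ)) (by ring)
        have ht0 := ht.1
        rw [Real.mul_rpow hk0.le (by positivity), hk, ← Real.rpow_mul (by positivity),
          ← Real.rpow_mul (by positivity), ← Real.rpow_natCast, ← Real.rpow_mul (by positivity),
          ← Real.rpow_mul ht0] at h2
        have h3 : (w / U) ^ ((1 - θ) * θ) * (w / U) ^ (-θ * (1 - θ)) = 1 := by
          rw [← Real.rpow_add (by positivity)]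
          ring_nf
          simp
        have h4 : t ^ (b * ((2 : ℕ) * θ)) = (t ^ a) ^ 2 := by
          rw [← Real.rpow_natCast (t ^ a), ← Real.rpow_mul ht0, hθ]
          congr 1
          field_simp
        rw [mul_right_comm, h3, one_mul, h4, Real.rpow_natCast, ← mul_assoc] at h2
        exact h2) x
    have h6 : k * U = U ^ θ * w ^ (1 - θ) := by
      rw [hk, Real.div_rpow hW.le hU0.le, Real.rpow_sub hU0, Real.rpow_one]
      field_simp
    have h7 : (w / U) ^ (-θ) * w = U ^ θ * w ^ (1 - θ) := by
      rw [Real.rpow_neg (by positivity), Real.div_rpow hW.le hU0.le, inv_div,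
        Real.rpow_sub hW, Real.rpow_one]
      ring
    calc ‖S x‖ ^ 2 ≤ θ * k * ‖T x‖ ^ 2 + (1 - θ) * (w / U) ^ (-θ) * w := h1
      _ ≤ θ * k * U + (1 - θ) * (w / U) ^ (-θ) * w := by gcongr
      _ = θ * (k * U) + (1 - θ) * ((w / U) ^ (-θ) * w) := by ring
      _ = U ^ θ * w ^ (1 - θ) := by rw [h6, h7]; ring
  have hlim : ‖S x‖ ^ 2 ≤ (‖T x‖ ^ 2) ^ θ * (‖x‖ ^ 2) ^ (1 - θ) := by
    have hct : Tendsto (fun U : ℝ => U ^ θ * (‖x‖ ^ 2) ^ (1 - θ)) (𝓝[>] (‖T x‖ ^ 2))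
        (𝓝 ((‖T x‖ ^ 2) ^ θ * (‖x‖ ^ 2) ^ (1 - θ))) :=
      (((Real.continuous_rpow_const hθ0.le).tendsto _).mul_const _).mono_left nhdsWithin_le_nhds
    exact ge_of_tendsto hct (eventually_mem_nhdsWithin.mono fun U hU => key U hU)
  have hsq : ∀ y c : ℝ, 0 ≤ y → (y ^ 2) ^ c = (y ^ c) ^ 2 := fun y c hy => by
    rw [← Real.rpow_natCast, ← Real.rpow_natCast, ← Real.rpow_mul hy, ← Real.rpow_mul hy, mul_comm]
  rw [hsq _ _ (norm_nonneg _), hsq _ _ (norm_nonneg _), ← mul_pow] at hlim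
  exact le_of_sq_le_sq hlim (by positivity)

/-- The inverse square root of `T + lam`. -/
theorem IsPos.exists_inv_sqrt [CompleteSpace H] (hB : IsPos B) {lam : ℝ} (hlam : 0 < lam) :
    ∃ W : H →L[ℝ] H, (∀ x y, ⟪W x, y⟫_ℝ = ⟪x, W y⟫_ℝ) ∧ ‖W‖ ≤ 1 / √lam ∧
      W * W * (B + lam • 1) = 1 ∧ (B + lam • 1) * (W * W) = 1 ∧ W * B = B * W := by
  have hne : ∀ t ∈ Icc 0 ‖B‖, √(t + lam) ≠ 0 := fun t ht =>
    (Real.sqrt_pos.2 (by linarith [ht.1])).ne'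
  have hc : ContinuousOn (fun t => 1 / √(t + lam)) (Icc 0 ‖B‖) :=
    ContinuousOn.div (by fun_prop) (by fun_prop) hne
  obtain ⟨W, hW⟩ := hB.exists_isFunctionalCalculus hc
  have hmul : ∀ t ∈ Icc 0 ‖B‖, 1 / √(t + lam) * (1 / √(t + lam)) * (t + lam) = 1 := by
    intro t ht
    have h1 := hne t ht
    have h2 := Real.mul_self_sqrt (by linarith [ht.1] : 0 ≤ t + lam)
    field_simp
    rw [sq, h2]
  have hBl := (isFunctionalCalculus_id (B := B)).add (isFunctionalCalculus_const lam)
  have hone : IsFunctionalCalculus B (fun _ => 1) 1 := by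
    simpa using isFunctionalCalculus_const (B := B) 1
  refine ⟨W, hW.symm hB, hW.norm_le hB fun t ht => ?_, ?_, ?_, ?_⟩
  · rw [abs_of_nonneg (by positivity)]
    exact one_div_le_one_div_of_le (Real.sqrt_pos.2 hlam) (Real.sqrt_le_sqrt (by linarith [ht.1]))
  · exact ((hW.mul hB hW).mul hB hBl).unique hB hone hmul
  · exact (hBl.mul hB (hW.mul hB hW)).unique hB hone fun t ht => by
      rw [mul_comm]; exact hmul t ht
  · exact (hW.mul hB isFunctionalCalculus_id).unique hB (isFunctionalCalculus_id.mul hB hW)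
      fun t _ => mul_comm _ _

end Calculus

/-! ### Negative powers of the generator of a Hilbert scale -/

section Scale

variable {H : Type*} [NormedAddCommGroup H] [InnerProductSpace ℝ H] [CompleteSpace H]
  {L : H →ₗ.[ℝ] H} {ell : ℝ}

theorem IsScaleGenerator.inner_symm (hL : IsScaleGenerator L ell) (f g : L.domain) :
    ⟪L f, (g : H)⟫_ℝ = ⟪(f : H), L g⟫_ℝ := by
  have h := LinearPMap.adjoint_isFormalAdjoint hL.dense
  rw [LinearPMap.isSelfAdjoint_def.1 hL.selfAdjoint] at h
  exact h f g

/-- The range is closed, by the lower bound and the closed graph, and its orthogonal complement lies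
in the kernel of the adjoint, which is `L` itself and is injective. -/
theorem IsScaleGenerator.surjective (hL : IsScaleGenerator L ell) (hell : 0 < ell) (g : H) :
    ∃ f : L.domain, L f = g := by
  have hs : L.adjoint = L := LinearPMap.isSelfAdjoint_def.1 hL.selfAdjoint
  let R : Submodule ℝ H := LinearMap.range L.toFun
  have hclosed : IsClosed (R : Set H) := by
    refine IsSeqClosed.isClosed fun u y hu hy => ?_
    choose f hf using hu
    have hfc : CauchySeq fun n => (f n : H) := by
      rw [Metric.cauchySeq_iff]
      intro ε hε
      obtain ⟨N, hN⟩ := Metric.cauchySeq_iff.1 hy.cauchySeq (ell * ε) (by positivity)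
      refine ⟨N, fun m hm n hn => ?_⟩
      have h1 := hN m hm n hn
      have h2 := hL.bounded_below (f m - f n)
      rw [dist_eq_norm] at h1 ⊢
      rw [← hf m, ← hf n, ← map_sub] at h1
      exact lt_of_mul_lt_mul_left (h2.trans_lt h1) hell.le
    obtain ⟨f₀, hf₀⟩ := cauchySeq_tendsto_of_complete hfc
    have hg : (f₀, y) ∈ L.graph := by
      refine hL.selfAdjoint.isClosed.mem_of_tendsto (hf₀.prodMk_nhds hy) (Eventually.of_forall ?_)
      intro n
      exact L.mem_graph_iff.2 ⟨f n, rfl, hf n⟩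
    obtain ⟨f₁, -, h⟩ := L.mem_graph_iff.1 hg
    exact ⟨f₁, h⟩
  have : CompleteSpace R := hclosed.completeSpace_coe
  have htop : R = ⊤ := by
    rw [← Submodule.orthogonal_eq_bot_iff, Submodule.eq_bot_iff]
    intro y hy
    have hy' : ∀ f : L.domain, ⟪(0 : H), (f : H)⟫_ℝ = ⟪y, L f⟫_ℝ := fun f => by
      rw [inner_zero_left, (Submodule.mem_orthogonal' R y).1 hy (L f) ⟨f, rfl⟩]
    have hmem := L.mem_adjoint_domain_of_exists y ⟨0, hy'⟩
    have hg : (y, (0 : H)) ∈ L.adjoint.graph := LinearPMap.mem_graph_iff _ |>.2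
      ⟨⟨y, hmem⟩, rfl, LinearPMap.adjoint_apply_eq hL.dense ⟨y, hmem⟩ hy'⟩
    rw [hs] at hg
    obtain ⟨f, h1, h2⟩ := L.mem_graph_iff.1 hg
    have h3 := hL.bounded_below f
    simp only at h1 h2
    rw [h2, norm_zero, h1] at h3
    exact norm_le_zero_iff.1 (by nlinarith [norm_nonneg y])
  have : g ∈ R := htop ▸ Submodule.mem_top
  exact this

theorem IsScaleGenerator.invOp_spec (hL : IsScaleGenerator L ell) (hell : 0 < ell) :
    (∀ f : L.domain, invOp L (L f) = f) ∧ ∀ g : H, ∃ f : L.domain, L f = g := by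
  have hex : ∃ B : H →L[ℝ] H, (∀ f : L.domain, B (L f) = f) ∧
      ∀ g : H, ∃ f : L.domain, L f = g := by
    choose F hF using hL.surjective hell
    have hinj : ∀ f g : L.domain, L f = L g → f = g := fun f g h => by
      have h1 := hL.bounded_below (f - g)
      rw [LinearPMap.map_sub, h, sub_self, norm_zero] at h1
      have h2 : ‖((f - g : L.domain) : H)‖ ≤ 0 := by nlinarith [norm_nonneg ((f - g : L.domain) : H)]
      exact sub_eq_zero.1 (Subtype.ext (norm_le_zero_iff.1 h2))
    refine ⟨LinearMap.mkContinuous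
      { toFun := fun g => (F g : H)
        map_add' := fun a b => by
          rw [← Submodule.coe_add, hinj (F (a + b)) (F a + F b) (by rw [LinearPMap.map_add, hF, hF, hF])]
        map_smul' := fun c a => by
          rw [RingHom.id_apply, ← Submodule.coe_smul,
            hinj (F (c • a)) (c • F a) (by rw [LinearPMap.map_smul, hF, hF])] } (1 / ell) (fun g => ?_),
      fun f => ?_, hL.surjective hell⟩
    · have := hL.bounded_below (F g)
      rw [hF] at this
      rw [div_mul_eq_mul_div, le_div_iff₀ hell, one_mul, mul_comm]
      exact this
    · exact congrArg Subtype.val (hinj _ _ (hF (L f)))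
  unfold invOp
  rw [dif_pos hex]
  exact hex.choose_spec

theorem IsScaleGenerator.exists_domain (hL : IsScaleGenerator L ell) (hell : 0 < ell) (g : H) :
    ∃ f : L.domain, (f : H) = invOp L g ∧ L f = g := by
  obtain ⟨f, rfl⟩ := (hL.invOp_spec hell).2 g
  exact ⟨f, ((hL.invOp_spec hell).1 f).symm, rfl⟩

theorem IsScaleGenerator.isPos_invOp (hL : IsScaleGenerator L ell) (hell : 0 < ell) :
    IsPos (invOp L) := by
  refine ⟨fun x y => ?_, fun x => ?_⟩
  · obtain ⟨f, hf, rfl⟩ := hL.exists_domain hell x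
    obtain ⟨g, hg, rfl⟩ := hL.exists_domain hell y
    rw [← hf, ← hg, hL.inner_symm]
  · obtain ⟨f, hf, rfl⟩ := hL.exists_domain hell x
    rw [← hf, real_inner_comm]
    rcases eq_or_ne f 0 with rfl | h
    · simp
    · exact (hL.strictPos f h).le

theorem IsScaleGenerator.norm_invOp_le (hL : IsScaleGenerator L ell) (hell : 0 < ell) :
    ‖invOp L‖ ≤ 1 / ell := by
  refine ContinuousLinearMap.opNorm_le_bound _ (by positivity) fun g => ?_
  obtain ⟨f, hf, rfl⟩ := hL.exists_domain hell g
  rw [← hf, div_mul_eq_mul_div, le_div_iff₀ hell, one_mul, mul_comm]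
  exact hL.bounded_below f

theorem IsScaleGenerator.negPow_spec (hL : IsScaleGenerator L ell) (hell : 0 < ell) {a : ℝ}
    (ha : 0 ≤ a) : IsFunctionalCalculus (invOp L) (fun t => t ^ a) (negPow L a) := by
  have hex := (hL.isPos_invOp hell).exists_isFunctionalCalculus
    (Real.continuous_rpow_const ha).continuousOn
  unfold negPow
  rw [dif_pos hex]
  exact hex.choose_spec

theorem IsScaleGenerator.negPow_symm (hL : IsScaleGenerator L ell) (hell : 0 < ell) {a : ℝ}
    (ha : 0 ≤ a) (x y : H) : ⟪negPow L a x, y⟫_ℝ = ⟪x, negPow L a y⟫_ℝ :=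
  (hL.negPow_spec hell ha).symm (hL.isPos_invOp hell) x y

theorem IsScaleGenerator.negPow_negPow (hL : IsScaleGenerator L ell) (hell : 0 < ell) {a b : ℝ}
    (ha : 0 ≤ a) (hb : 0 ≤ b) (x : H) : negPow L a (negPow L b x) = negPow L (a + b) x := by
  have hB := hL.isPos_invOp hell
  have h := ((hL.negPow_spec hell ha).mul hB (hL.negPow_spec hell hb)).unique hB
    (hL.negPow_spec hell (add_nonneg ha hb)) fun t ht => (Real.rpow_add_of_nonneg ht.1 ha hb).symm
  rw [← h, mul_apply_eq_comp]

theorem IsScaleGenerator.negPow_zero (hL : IsScaleGenerator L ell) (hell : 0 < ell) (x : H) :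
    negPow L 0 x = x := by
  have h := (hL.negPow_spec hell le_rfl).unique (hL.isPos_invOp hell)
    (isFunctionalCalculus_const 1) (by simp)
  simp [h]

theorem IsScaleGenerator.negPow_one (hL : IsScaleGenerator L ell) (hell : 0 < ell) :
    negPow L 1 = invOp L :=
  (hL.negPow_spec hell zero_le_one).unique (hL.isPos_invOp hell) isFunctionalCalculus_id (by simp)

theorem IsScaleGenerator.norm_negPow_apply_le (hL : IsScaleGenerator L ell) (hell : 0 < ell) {a : ℝ}
    (ha : 0 ≤ a) (x : H) : ‖negPow L a x‖ ≤ (1 / ell) ^ a * ‖x‖ := by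
  refine (ContinuousLinearMap.le_opNorm _ _).trans ?_
  gcongr
  refine (hL.negPow_spec hell ha).norm_le (hL.isPos_invOp hell) fun t ht => ?_
  rw [abs_of_nonneg (Real.rpow_nonneg ht.1 _)]
  exact Real.rpow_le_rpow ht.1 (ht.2.trans (hL.norm_invOp_le hell)) ha

theorem IsScaleGenerator.negPow_interpolation (hL : IsScaleGenerator L ell) (hell : 0 < ell)
    {a b : ℝ} (ha : 0 ≤ a) (hab : a ≤ b) (x : H) :
    ‖negPow L a x‖ ≤ ‖negPow L b x‖ ^ (a / b) * ‖x‖ ^ (1 - a / b) :=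
  (hL.negPow_spec hell ha).interpolation (hL.isPos_invOp hell) ha hab
    (hL.negPow_spec hell (ha.trans hab)) x

/-- Integer powers are iterates of the injective `L⁻¹`; a real exponent `a` is raised to an integer
`n ≥ a` by applying `L^{-(n-a)}`. -/
theorem IsScaleGenerator.negPow_eq_zero (hL : IsScaleGenerator L ell) (hell : 0 < ell) {a : ℝ}
    (ha : 0 ≤ a) {x : H} (h : negPow L a x = 0) : x = 0 := by
  have hinv : ∀ y, invOp L y = 0 → y = 0 := fun y hy => by
    obtain ⟨f, hf, rfl⟩ := hL.exists_domain hell y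
    have : f = 0 := Subtype.ext (hf.trans hy)
    simp [this]
  have hnat : ∀ n : ℕ, ∀ y, negPow L (n : ℝ) y = 0 → y = 0 := by
    intro n
    induction n with
    | zero => intro y hy; rwa [Nat.cast_zero, hL.negPow_zero hell] at hy
    | succ n ih =>
      intro y hy
      rw [Nat.cast_succ, ← hL.negPow_negPow hell (Nat.cast_nonneg n) zero_le_one,
        hL.negPow_one hell] at hy
      exact hinv y (ih _ hy)
  obtain ⟨n, hn⟩ := exists_nat_ge a
  refine hnat n x ?_
  rw [← sub_add_cancel (n : ℝ) a, ← hL.negPow_negPow hell (by linarith) ha, h, map_zero]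

theorem IsScaleGenerator.isPos_negPow (hL : IsScaleGenerator L ell) (hell : 0 < ell) {a : ℝ}
    (ha : 0 ≤ a) : IsPos (negPow L (2 * a)) := by
  refine ⟨hL.negPow_symm hell (by positivity), fun x => ?_⟩
  rw [two_mul, ← hL.negPow_negPow hell ha ha, hL.negPow_symm hell ha]
  exact real_inner_self_nonneg

omit [CompleteSpace H] in
theorem convex_scaleBall (L : H →ₗ.[ℝ] H) (a : ℝ) (c : H) (R : ℝ) :
    Convex ℝ (scaleBall L a c R) := by
  rintro f ⟨v, hv, hvR⟩ g ⟨w, hw, hwR⟩ s t hs ht hst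
  refine ⟨s • v + t • w, ?_, ?_⟩
  · rw [map_add, map_smul, map_smul, ← hv, ← hw, smul_sub, smul_sub, sub_add_sub_comm,
      ← add_smul, hst, one_smul]
  · refine (norm_add_le _ _).trans ?_
    rw [norm_smul, norm_smul, Real.norm_of_nonneg hs, Real.norm_of_nonneg ht]
    calc s * ‖v‖ + t * ‖w‖ ≤ s * R + t * R := by gcongr
      _ = R := by rw [← add_mul, hst, one_mul]

/-- The residual of the best approximation of `fh` from a ball of `H_q` is of Tikhonov type. -/
theorem IsScaleGenerator.exists_residual (hL : IsScaleGenerator L ell) (hell : 0 < ell)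
    {q r R : ℝ} (hq : 0 ≤ q) (hr : 0 ≤ r) (hR : 0 < R) {f fh fb v : H}
    (hf : f ∈ scaleBall L q fb R) (hmin : ∀ g ∈ scaleBall L q fb R, ‖f - fh‖ ≤ ‖g - fh‖)
    (hv : fh - fb = negPow L r v) :
    ∃ e : H, fh - f = negPow L r e ∧ ‖e‖ ≤ ‖v‖ ∧ (e = 0 ∨ ∃ μ > 0,
      ‖negPow L (2 * q) e‖ ≤ μ * ‖v‖ ∧ R * μ = ‖negPow L (q + r) e‖) := by
  by_cases h0 : negPow L q (fh - f) = 0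
  · exact ⟨0, by simp [hL.negPow_eq_zero hell hq h0], by simp, Or.inl rfl⟩
  -- Variational inequality for the projection onto a convex set.
  have hinner : ∀ g ∈ scaleBall L q fb R, ⟪fh - f, g - f⟫_ℝ ≤ 0 := by
    refine (norm_eq_iInf_iff_real_inner_le_zero (convex_scaleBall L q fb R) hf).1 ?_
    have : Nonempty (scaleBall L q fb R) := ⟨⟨f, hf⟩⟩
    refine le_antisymm (le_ciInf fun w => ?_)
      (ciInf_le ⟨0, by rintro _ ⟨w, rfl⟩; exact norm_nonneg _⟩ (⟨f, hf⟩ : scaleBall L q fb R))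
    rw [norm_sub_rev, norm_sub_rev fh]
    exact hmin w w.2
  obtain ⟨vR, hvR, hvRn⟩ := hf
  set n := ‖negPow L q (fh - f)‖ with hn
  have hn0 : 0 < n := norm_pos_iff.2 h0
  -- The point of the `R`-ball that maximizes `v ↦ ⟪L^{-q}(fh - f), v⟫`. Testing with it gives
  -- equality in Cauchy-Schwarz, so the source element `vR` of `f` is `v'`: the constraint is
  -- active.
  set v' := (R / n) • negPow L q (fh - f) with hv'
  have hv'n : ‖v'‖ = R := by
    rw [hv', norm_smul, Real.norm_of_nonneg (by positivity), ← hn]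
    field_simp
  have h1 := hinner (fb + negPow L q v') ⟨v', by simp, hv'n.le⟩
  rw [show fb + negPow L q v' - f = negPow L q (v' - vR) by rw [map_sub, ← hvR]; abel,
    ← hL.negPow_symm hell hq, inner_sub_right, hv', inner_smul_right,
    real_inner_self_eq_norm_sq, ← hn, sub_nonpos] at h1
  have h2 : vR = v' := by
    rw [← sub_eq_zero, ← norm_le_zero_iff]
    refine le_of_sq_le_sq ?_ le_rfl
    rw [norm_sub_sq_real, hv'n, hv', inner_smul_right, real_inner_comm]
    have h3 : R / n * (R / n * n ^ 2) = R ^ 2 := by field_simp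
    have h4 : R / n * (R / n * n ^ 2) ≤ R / n * ⟪negPow L q (fh - f), vR⟫_ℝ := by gcongr
    have h5 := pow_le_pow_left₀ (norm_nonneg _) hvRn 2
    rw [h3] at h4
    linarith
  -- The Lagrange multiplier: `μ vR = L^{-q}(fh - f)`.
  set μ := n / R with hμ
  have hμ0 : 0 < μ := div_pos hn0 hR
  have h3 : μ • vR = negPow L q (fh - f) := by
    rw [h2, hv', smul_smul, hμ]
    field_simp
    simp
  have hpos := hL.isPos_negPow hell hq
  obtain ⟨W, -, -, hW1, hW2, -⟩ := hpos.exists_inv_sqrt hμ0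
  -- `W * W` inverts `L^{-2q} + μ`, so `e = μ(L^{-2q} + μ)⁻¹ v`. Both `fh - f` and `L^{-r} e` solve
  -- the equation with right-hand side `μ L^{-r} v`.
  set e := (W * W) (μ • v) with he
  have he1 : negPow L (2 * q) e + μ • e = μ • v := by
    have := congrArg (fun S : H →L[ℝ] H => S (μ • v)) hW2
    simp only [mul_apply_eq_comp, add_apply, smul_apply, one_apply_eq_self] at this
    exact this
  have hinj : ∀ x, negPow L (2 * q) x + μ • x = 0 → x = 0 := fun x hx => by
    have := congrArg (fun S : H →L[ℝ] H => S x) hW1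
    simp only [mul_apply_eq_comp, add_apply, smul_apply, one_apply_eq_self, hx, map_zero] at this
    exact this.symm
  have he2 : fh - f = negPow L r e := by
    rw [← sub_eq_zero]
    apply hinj
    have h4 : negPow L (2 * q) (fh - f) = μ • (negPow L r v) - μ • (fh - f) := by
      rw [two_mul, ← hL.negPow_negPow hell hq hq, ← h3, map_smul, ← hvR, ← hv, ← smul_sub]
      congr 1
      abel
    have h5 : negPow L (2 * q) (negPow L r e) = μ • (negPow L r v) - μ • (negPow L r e) := by
      rw [hL.negPow_negPow hell (by positivity) hr, add_comm, ← hL.negPow_negPow hell hr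
        (by positivity), eq_sub_of_add_eq he1, map_sub, map_smul, map_smul]
    rw [map_sub, h4, h5]
    module
  refine ⟨e, he2, ?_, Or.inr ⟨μ, hμ0, ?_, ?_⟩⟩
  · have h4 := congrArg (fun y => ⟪y, e⟫_ℝ) he1
    simp only [inner_add_left, inner_smul_left, conj_trivial, real_inner_self_eq_norm_sq] at h4
    have h5 := hpos.nonneg e
    have h6 : μ * ‖e‖ ^ 2 ≤ μ * (‖v‖ * ‖e‖) := by
      have := mul_le_mul_of_nonneg_left (real_inner_le_norm v e) hμ0.le
      linarith
    have h7 := le_of_mul_le_mul_left h6 hμ0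
    rcases (norm_nonneg e).eq_or_lt with h | h
    · rw [← h]; exact norm_nonneg _
    · nlinarith
  · set E := negPow L (2 * q) e
    have h4 := congrArg (fun y => ⟪y, E⟫_ℝ) he1
    simp only [inner_add_left, inner_smul_left, conj_trivial, real_inner_self_eq_norm_sq] at h4
    have h5 : 0 ≤ ⟪e, E⟫_ℝ := by rw [real_inner_comm]; exact hpos.nonneg e
    have h6 : ‖E‖ ^ 2 ≤ μ * ‖v‖ * ‖E‖ := by
      have := mul_le_mul_of_nonneg_left (real_inner_le_norm v E) hμ0.le
      nlinarith
    rcases (norm_nonneg E).eq_or_lt with h | h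
    · rw [← h]; positivity
    · nlinarith
  · rw [← hL.negPow_negPow hell hq hr, ← he2, ← hn, hμ]
    field_simp

/-- Approximation rate of the benchmark element in the norm of `H_{-p}`. -/
theorem IsScaleGenerator.norm_negPow_residual_le (hL : IsScaleGenerator L ell) (hell : 0 < ell)
    {p q r R ρ : ℝ} (hp : 0 ≤ p) (hr : 0 ≤ r) (hrq : r < q) (hrp : r + p ≤ 2 * q) (hR : 0 < R)
    (hρ : 0 < ρ) {e v : H} (hv : ‖v‖ ≤ ρ) (hev : ‖e‖ ≤ ‖v‖)
    (h : e = 0 ∨ ∃ μ > 0, ‖negPow L (2 * q) e‖ ≤ μ * ‖v‖ ∧ R * μ = ‖negPow L (q + r) e‖) :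
    ‖negPow L (p + r) e‖ ≤ ρ * (ρ / R) ^ ((r + p) / (q - r)) := by
  rcases h with rfl | ⟨μ, hμ, h1, h2⟩
  · rw [map_zero, norm_zero]; positivity
  have hq : 0 < q := hr.trans_lt hrq
  have hint : ∀ a, 0 ≤ a → a ≤ 2 * q → ‖negPow L a e‖ ≤ μ ^ (a / (2 * q)) * ρ := by
    intro a ha ha2
    have h3 : a / (2 * q) ≤ 1 := (div_le_one (by positivity)).2 ha2
    have h4 : 0 ≤ a / (2 * q) := by positivity
    calc ‖negPow L a e‖ ≤ ‖negPow L (2 * q) e‖ ^ (a / (2 * q)) * ‖e‖ ^ (1 - a / (2 * q)) :=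
          hL.negPow_interpolation hell ha ha2 e
      _ ≤ (μ * ρ) ^ (a / (2 * q)) * ρ ^ (1 - a / (2 * q)) := by
          gcongr
          · exact h1.trans (by gcongr)
          · exact hev.trans hv
      _ = μ ^ (a / (2 * q)) * ρ := by
          rw [Real.mul_rpow hμ.le hρ.le, mul_assoc, ← Real.rpow_add hρ]
          simp
  -- At the exponent `q + r` the left side equals `R μ`, so the interpolation bound becomes an upper
  -- bound for `μ` itself. It is inserted at the exponent `p + r`, which is admissible because `p +
  -- r ≤ 2q`.
  have h3 := hint (q + r) (by positivity) (by linarith)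
  rw [← h2] at h3
  have h4 : μ ^ ((q - r) / (2 * q)) ≤ ρ / R := by
    rw [le_div_iff₀ hR]
    have h5 : μ = μ ^ ((q - r) / (2 * q)) * μ ^ ((q + r) / (2 * q)) := by
      rw [← Real.rpow_add hμ, ← add_div, show q - r + (q + r) = 2 * q by ring,
        div_self (by positivity), Real.rpow_one]
    have h6 : 0 < μ ^ ((q + r) / (2 * q)) := Real.rpow_pos_of_pos hμ _
    refine le_of_mul_le_mul_right ?_ h6
    calc μ ^ ((q - r) / (2 * q)) * R * μ ^ ((q + r) / (2 * q))
        = R * (μ ^ ((q - r) / (2 * q)) * μ ^ ((q + r) / (2 * q))) := by ring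
      _ = R * μ := by rw [← h5]
      _ ≤ μ ^ ((q + r) / (2 * q)) * ρ := h3
      _ = _ := mul_comm _ _
  refine (hint (p + r) (by positivity) (by linarith)).trans ?_
  rw [mul_comm]
  gcongr
  have hqr : 0 < q - r := by linarith
  calc μ ^ ((p + r) / (2 * q)) = (μ ^ ((q - r) / (2 * q))) ^ ((r + p) / (q - r)) := by
        rw [← Real.rpow_mul hμ.le]; congr 1; field_simp; ring
    _ ≤ _ := by gcongr

end Scale

/-! ### Pinelis' exponential inequality in Hilbert spaces -/

section Pinelis

/-- Convexity of `z ↦ cosh √z`. -/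
theorem cosh_le_of_sq_eq {A B z τ : ℝ} (h0 : 0 ≤ τ) (h1 : τ ≤ 1)
    (hz : z ^ 2 = (1 - τ) * A ^ 2 + τ * B ^ 2) :
    Real.cosh z ≤ (1 - τ) * Real.cosh A + τ * Real.cosh B := by
  refine hasSum_le (fun n => ?_) (Real.hasSum_cosh z)
    (((Real.hasSum_cosh A).mul_left (1 - τ)).add ((Real.hasSum_cosh B).mul_left τ))
  rw [pow_mul, pow_mul, pow_mul, hz, ← mul_div_assoc, ← mul_div_assoc, ← add_div]
  gcongr
  have := (convexOn_pow n).2 (sq_nonneg A : A ^ 2 ∈ Ici (0 : ℝ)) (sq_nonneg B : B ^ 2 ∈ Ici (0 : ℝ))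
    (sub_nonneg.2 h1) h0 (by ring)
  simpa using this

/-- The difference of the two sides is `(cosh a - sinh a)(sinh b - b)`. -/
theorem cosh_add_le {a b : ℝ} (hb : 0 ≤ b) :
    Real.cosh (a + b) ≤
      Real.cosh a + b * Real.sinh a + Real.cosh a * (Real.exp b - 1 - b) := by
  have h1 : b ≤ Real.sinh b := Real.self_le_sinh_iff.2 hb
  have h2 : 0 < Real.cosh a - Real.sinh a := by rw [Real.cosh_sub_sinh]; exact Real.exp_pos _
  rw [Real.cosh_add, ← Real.cosh_add_sinh b]
  nlinarith [mul_nonneg h2.le (sub_nonneg.2 h1)]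

variable {E : Type*} [NormedAddCommGroup E] [InnerProductSpace ℝ E]

/-- `‖s + v‖²` is a convex combination of `(‖s‖ - ‖v‖)²` and `(‖s‖ + ‖v‖)²`, so convexity of `cosh
√` reduces the claim to the scalar case at `±‖s‖`. The middle term is linear in `v` and disappears
for a centered random vector. -/
theorem cosh_norm_add_le (s v : E) :
    Real.cosh ‖s + v‖ ≤ Real.cosh ‖s‖ + ⟪(Real.sinh ‖s‖ / ‖s‖) • s, v⟫_ℝ +
      Real.cosh ‖s‖ * (Real.exp ‖v‖ - 1 - ‖v‖) := by
  rcases eq_or_ne s 0 with rfl | hs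
  · have := cosh_add_le (a := 0) (norm_nonneg v)
    simpa using this
  rcases eq_or_ne v 0 with rfl | hv
  · simp
  have ha : 0 < ‖s‖ := norm_pos_iff.2 hs
  have hb : 0 < ‖v‖ := norm_pos_iff.2 hv
  have hc := abs_le.1 (abs_real_inner_le_norm s v)
  set a := ‖s‖
  set b := ‖v‖
  set c := ⟪s, v⟫_ℝ with hcdef
  set τ := (c / (a * b) + 1) / 2 with hτ
  have hτ0 : 0 ≤ τ := by
    have : -1 ≤ c / (a * b) := by rw [le_div_iff₀ (by positivity)]; linarith
    linarith
  have hτ1 : τ ≤ 1 := by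
    have : c / (a * b) ≤ 1 := by rw [div_le_iff₀ (by positivity)]; linarith
    linarith
  have hτc : (2 * τ - 1) * (a * b) = c := by rw [hτ]; field_simp; ring
  have h1 := cosh_le_of_sq_eq (A := a - b) (B := a + b) (z := ‖s + v‖) hτ0 hτ1 (by
    rw [norm_add_sq_real]
    linear_combination (-2) * hτc)
  have h2 := cosh_add_le (a := a) hb.le
  have h3 := cosh_add_le (a := -a) hb.le
  rw [← Real.cosh_neg (a - b), neg_sub, show b - a = -a + b by ring] at h1
  rw [Real.cosh_neg, Real.sinh_neg] at h3
  rw [inner_smul_left, conj_trivial, ← hcdef]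
  have h4 : Real.sinh a / a * c = (2 * τ - 1) * b * Real.sinh a := by
    rw [← hτc]; field_simp
  rw [h4]
  nlinarith [mul_le_mul_of_nonneg_left h2 hτ0, mul_le_mul_of_nonneg_left h3 (sub_nonneg.2 hτ1)]

theorem exp_sub_nonneg (x : ℝ) : 0 ≤ Real.exp x - 1 - x := by
  linarith [Real.add_one_le_exp x]

variable {Z : Type*} [MeasurableSpace Z] {ρ : Measure Z} [IsProbabilityMeasure ρ] {ξ : Z → E}

omit [InnerProductSpace ℝ E] in
theorem integrable_norm_of_exp (hξ : StronglyMeasurable ξ) {c : ℝ}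
    (he : ∫⁻ z, ENNReal.ofReal (Real.exp ‖ξ z‖ - 1 - ‖ξ z‖) ∂ρ ≤ ENNReal.ofReal c) :
    Integrable (fun z => Real.exp ‖ξ z‖ - 1 - ‖ξ z‖) ρ ∧ Integrable ξ ρ := by
  have hm : Measurable fun z => Real.exp ‖ξ z‖ - 1 - ‖ξ z‖ := by
    have := hξ.norm.measurable
    fun_prop
  have h1 : Integrable (fun z => Real.exp ‖ξ z‖ - 1 - ‖ξ z‖) ρ := by
    refine ⟨hm.aestronglyMeasurable, ?_⟩
    rw [hasFiniteIntegral_iff_ofReal (ae_of_all _ fun z => exp_sub_nonneg _)]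
    exact he.trans_lt ENNReal.ofReal_lt_top
  refine ⟨h1, (h1.add (integrable_const 1)).mono' hξ.aestronglyMeasurable
    (ae_of_all _ fun z => ?_)⟩
  have := Real.quadratic_le_exp_of_nonneg (norm_nonneg (ξ z))
  simp only [Pi.add_apply]
  nlinarith [sq_nonneg (‖ξ z‖ - 1)]

theorem lintegral_cosh_norm_add_le (hξ : StronglyMeasurable ξ)
    (hmean : ∀ w, ∫ z, ⟪w, ξ z⟫_ℝ ∂ρ = 0) {c : ℝ} (hc : 0 ≤ c)
    (he : ∫⁻ z, ENNReal.ofReal (Real.exp ‖ξ z‖ - 1 - ‖ξ z‖) ∂ρ ≤ ENNReal.ofReal c) (s : E) :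
    ∫⁻ z, ENNReal.ofReal (Real.cosh ‖s + ξ z‖) ∂ρ ≤ ENNReal.ofReal (Real.cosh ‖s‖ * (1 + c)) := by
  obtain ⟨h1, h2⟩ := integrable_norm_of_exp hξ he
  set D := (Real.sinh ‖s‖ / ‖s‖) • s
  have h3 : Integrable (fun z => Real.cosh ‖s‖ + ⟪D, ξ z⟫_ℝ) ρ :=
    (integrable_const _).add (h2.const_inner D)
  have h4 : Integrable (fun z => Real.cosh ‖s‖ * (Real.exp ‖ξ z‖ - 1 - ‖ξ z‖)) ρ :=
    h1.const_mul _
  calc ∫⁻ z, ENNReal.ofReal (Real.cosh ‖s + ξ z‖) ∂ρ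
      ≤ ∫⁻ z, ENNReal.ofReal (Real.cosh ‖s‖ + ⟪D, ξ z⟫_ℝ +
          Real.cosh ‖s‖ * (Real.exp ‖ξ z‖ - 1 - ‖ξ z‖)) ∂ρ :=
        lintegral_mono fun z => ENNReal.ofReal_le_ofReal (cosh_norm_add_le s (ξ z))
    _ = ENNReal.ofReal (∫ z, (Real.cosh ‖s‖ + ⟪D, ξ z⟫_ℝ +
          Real.cosh ‖s‖ * (Real.exp ‖ξ z‖ - 1 - ‖ξ z‖)) ∂ρ) := by
        exact (ofReal_integral_eq_lintegral_ofReal (h3.add h4) (ae_of_all _ fun z =>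
          (Real.cosh_pos _).le.trans (cosh_norm_add_le s (ξ z)))).symm
    _ ≤ _ := by
        refine ENNReal.ofReal_le_ofReal ?_
        rw [integral_add h3 h4, integral_add (integrable_const _) (h2.const_inner D), hmean,
          integral_const_mul]
        have h5 : ∫ z, (Real.exp ‖ξ z‖ - 1 - ‖ξ z‖) ∂ρ ≤ c := by
          rw [integral_eq_lintegral_of_nonneg_ae (ae_of_all _ fun z => exp_sub_nonneg _)
            h1.aestronglyMeasurable]
          exact ENNReal.toReal_le_of_le_ofReal hc he
        have h6 := mul_le_mul_of_nonneg_left h5 (Real.cosh_pos ‖s‖).le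
        simp only [integral_const, probReal_univ, one_smul]
        linarith

omit [InnerProductSpace ℝ E] in
theorem stronglyMeasurable_sum_pi (hξ : StronglyMeasurable ξ) (m : ℕ) :
    StronglyMeasurable fun z : Fin m → Z => ∑ i, ξ (z i) :=
  Finset.stronglyMeasurable_fun_sum _ fun i _ => hξ.comp_measurable (measurable_pi_apply i)

/-- Integrating out one sample point costs a factor `1 + c`. The arbitrary starting point `s` lets
the induction absorb that sample. -/
theorem lintegral_cosh_norm_sum_le (hξ : StronglyMeasurable ξ)
    (hmean : ∀ w, ∫ z, ⟪w, ξ z⟫_ℝ ∂ρ = 0) {c : ℝ} (hc : 0 ≤ c)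
    (he : ∫⁻ z, ENNReal.ofReal (Real.exp ‖ξ z‖ - 1 - ‖ξ z‖) ∂ρ ≤ ENNReal.ofReal c) (m : ℕ) :
    ∀ s : E, ∫⁻ z : Fin m → Z, ENNReal.ofReal (Real.cosh ‖s + ∑ i, ξ (z i)‖)
      ∂(Measure.pi fun _ => ρ) ≤ ENNReal.ofReal (Real.cosh ‖s‖ * (1 + c) ^ m) := by
  induction m with
  | zero => intro s; simp
  | succ m ih =>
    intro s
    have hmp := (measurePreserving_piFinSuccAbove (fun _ : Fin (m + 1) => ρ) 0).symm
    have hmeas : StronglyMeasurable fun p : Z × (Fin m → Z) => s + (ξ p.1 + ∑ i, ξ (p.2 i)) :=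
      stronglyMeasurable_const.add ((hξ.comp_measurable measurable_fst).add
        ((stronglyMeasurable_sum_pi hξ m).comp_measurable measurable_snd))
    rw [← hmp.map_eq, lintegral_map_equiv]
    have hsum : ∀ p : Z × (Fin m → Z),
        ∑ i, ξ ((MeasurableEquiv.piFinSuccAbove (fun _ => Z) 0).symm p i) =
          ξ p.1 + ∑ i, ξ (p.2 i) := fun p => by
      rw [Fin.sum_univ_succ]
      rfl
    simp only [hsum]
    rw [lintegral_prod _ (by
      exact (Real.continuous_cosh.measurable.comp hmeas.norm.measurable).ennreal_ofReal.aemeasurable)]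
    calc _ ≤ ∫⁻ x, ENNReal.ofReal (Real.cosh ‖s + ξ x‖ * (1 + c) ^ m) ∂ρ := by
          refine lintegral_mono fun x => ?_
          simp only [← add_assoc]
          exact ih (s + ξ x)
      _ = (∫⁻ x, ENNReal.ofReal (Real.cosh ‖s + ξ x‖) ∂ρ) * ENNReal.ofReal ((1 + c) ^ m) := by
          rw [← lintegral_mul_const' _ _ ENNReal.ofReal_ne_top]
          exact lintegral_congr fun x => ENNReal.ofReal_mul (Real.cosh_pos _).le
      _ ≤ ENNReal.ofReal (Real.cosh ‖s‖ * (1 + c)) * ENNReal.ofReal ((1 + c) ^ m) := by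
          gcongr
          exact lintegral_cosh_norm_add_le hξ hmean hc he s
      _ = _ := by
          rw [← ENNReal.ofReal_mul (mul_nonneg (Real.cosh_pos _).le (by linarith)), pow_succ]
          congr 1
          ring

/-- Bernstein-type tail bound for sums of independent, identically distributed, centered random
vectors in a Hilbert space. -/
theorem measure_norm_sum_gt_le (hξ : StronglyMeasurable ξ)
    (hmean : ∀ w, ∫ z, ⟪w, ξ z⟫_ℝ ∂ρ = 0) {m : ℕ} (hm : 1 ≤ m) {t : ℝ} (ht : 0 < t)
    (he : ∫⁻ z, ENNReal.ofReal (Real.exp (t * ‖ξ z‖) - 1 - t * ‖ξ z‖) ∂ρ ≤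
      ENNReal.ofReal (1 / m)) {η : ℝ} (hη : 0 < η) :
    (Measure.pi fun _ : Fin m => ρ) {z | 1 / t * (1 + Real.log (4 / η)) < ‖∑ i, ξ (z i)‖} ≤
      ENNReal.ofReal (η / 2) := by
  have hm0 : (0 : ℝ) < m := by exact_mod_cast hm
  have hn : ∀ z, ‖t • ξ z‖ = t * ‖ξ z‖ := fun z => by rw [norm_smul, Real.norm_of_nonneg ht.le]
  have h1 := lintegral_cosh_norm_sum_le (ρ := ρ) (hξ.const_smul t) (fun w => by
    simp [inner_smul_right, integral_const_mul, hmean]) (c := 1 / m)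
    (by positivity) (by simpa only [Pi.smul_apply, hn] using he) m 0
  simp only [zero_add, norm_zero, Real.cosh_zero, one_mul, Pi.smul_apply] at h1
  simp only [← Finset.smul_sum] at h1
  -- The summand `1` compensates `(1 + 1/m)^m ≤ e`; Markov's inequality with `cosh ≥ exp / 2` then
  -- leaves exactly `η / 2`.
  set ℓ := 1 + Real.log (4 / η)
  set S : (Fin m → Z) → E := fun z => ∑ i, ξ (z i)
  have hS : StronglyMeasurable S := stronglyMeasurable_sum_pi hξ m
  have hpos : 0 < Real.exp ℓ / 2 := by positivity
  have h2 : {z | 1 / t * ℓ < ‖S z‖} ⊆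
      {z | ENNReal.ofReal (Real.exp ℓ / 2) ≤ ENNReal.ofReal (Real.cosh ‖t • S z‖)} := by
    intro z hz
    refine ENNReal.ofReal_le_ofReal ?_
    have h3 : ℓ < t * ‖S z‖ := by
      rw [mem_ofPred_eq, div_mul_eq_mul_div, div_lt_iff₀ ht] at hz
      linarith
    rw [norm_smul, Real.norm_of_nonneg ht.le, Real.cosh_eq]
    have := Real.exp_le_exp.2 h3.le
    have := Real.exp_pos (-(t * ‖S z‖))
    linarith
  refine (measure_mono h2).trans ?_
  have hmeas : AEMeasurable (fun z => ENNReal.ofReal (Real.cosh ‖t • S z‖))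
      (Measure.pi fun _ : Fin m => ρ) :=
    (Real.continuous_cosh.measurable.comp
      (hS.const_smul t).norm.measurable).ennreal_ofReal.aemeasurable
  refine (meas_ge_le_lintegral_div hmeas (ENNReal.ofReal_pos.2 hpos).ne'
    ENNReal.ofReal_ne_top).trans ?_
  refine (ENNReal.div_le_div_right h1 _).trans ?_
  rw [← ENNReal.ofReal_div_of_pos hpos]
  refine ENNReal.ofReal_le_ofReal ?_
  rw [div_le_iff₀ hpos, Real.exp_add, Real.exp_log (by positivity)]
  calc (1 + 1 / (m : ℝ)) ^ m ≤ Real.exp (1 / m) ^ m := by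
        gcongr; linarith [Real.add_one_le_exp (1 / (m : ℝ))]
    _ = Real.exp 1 := by rw [← Real.exp_nat_mul]; congr 1; field_simp
    _ = η / 2 * (Real.exp 1 * (4 / η) / 2) := by field_simp; norm_num

theorem exp_sub_le_sq {x : ℝ} (h0 : 0 ≤ x) (h1 : x ≤ 1) : Real.exp x - 1 - x ≤ x ^ 2 := by
  have := Real.abs_exp_sub_one_sub_id_le (x := x) (by rwa [abs_of_nonneg h0])
  exact (le_abs_self _).trans this

/-- `(exp x - 1 - x) / x ^ 2` is increasing. -/
theorem exp_mul_sub_le {x k : ℝ} (hx : 0 ≤ x) (hk0 : 0 ≤ k) (hk1 : k ≤ 1) :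
    Real.exp (k * x) - 1 - k * x ≤ k ^ 2 * (Real.exp x - 1 - x) := by
  have hs : ∀ y : ℝ, HasSum (fun n : ℕ => y ^ (n + 2) / (n + 2).factorial)
      (Real.exp y - 1 - y) := fun y => by
    have h := (hasSum_nat_add_iff' 2).2 (NormedSpace.expSeries_div_hasSum_exp y)
    rw [← Real.exp_eq_exp_ℝ] at h
    simpa [Finset.sum_range_succ, sub_sub] using h
  refine hasSum_le (fun n => ?_) (hs (k * x)) ((hs x).mul_left (k ^ 2))
  rw [mul_pow, mul_div_assoc]
  have : k ^ (n + 2) ≤ k ^ 2 := pow_le_pow_of_le_one hk0 hk1 (by omega)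
  gcongr

theorem exp_sub_mono {x y : ℝ} (hx : 0 ≤ x) (hxy : x ≤ y) :
    Real.exp x - 1 - x ≤ Real.exp y - 1 - y := by
  rcases hx.eq_or_lt with rfl | hx'
  · simpa using exp_sub_nonneg y
  have hy := hx'.trans_le hxy
  have h1 := exp_mul_sub_le hy.le (div_nonneg hx hy.le) ((div_le_one hy).2 hxy)
  rw [div_mul_cancel₀ _ hy.ne'] at h1
  have h2 : (x / y) ^ 2 ≤ 1 := pow_le_one₀ (div_nonneg hx hy.le) ((div_le_one hy).2 hxy)
  nlinarith [exp_sub_nonneg y]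

end Pinelis

/-- Pettis' theorem in a separable Hilbert space: projections onto an increasing sequence of
finite-dimensional subspaces with dense union converge pointwise. -/
theorem stronglyMeasurable_of_inner {E Z : Type*} [NormedAddCommGroup E] [InnerProductSpace ℝ E]
    [CompleteSpace E] [TopologicalSpace.SeparableSpace E] [MeasurableSpace Z] {f : Z → E}
    (h : ∀ w, Measurable fun z => ⟪f z, w⟫_ℝ) : StronglyMeasurable f := by
  let U : ℕ → Submodule ℝ E := fun n =>
    Submodule.span ℝ (TopologicalSpace.denseSeq E '' Iic n)
  have hfin : ∀ n, FiniteDimensional ℝ (U n) := fun n =>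
    FiniteDimensional.span_of_finite ℝ ((finite_Iic n).image _)
  have hmono : Monotone U := fun a b hab =>
    Submodule.span_mono (image_mono (Iic_subset_Iic.2 hab))
  have htop : ⊤ ≤ (⨆ n, U n).topologicalClosure := by
    intro y _
    refine closure_mono ?_ (TopologicalSpace.denseRange_denseSeq E y)
    rintro _ ⟨n, rfl⟩
    exact (le_iSup U n) (Submodule.subset_span ⟨n, mem_Iic.2 le_rfl, rfl⟩)
  refine stronglyMeasurable_of_tendsto (u := atTop)
    (f := fun n x => (U n).starProjection (f x)) (fun n => ?_)
    (tendsto_pi_nhds.2 fun x => Submodule.starProjection_tendsto_self U hmono (f x) htop)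
  have hsum : (fun x => (U n).starProjection (f x)) = fun x =>
      ∑ i, ⟪f x, ((stdOrthonormalBasis ℝ (U n) i : U n) : E)⟫_ℝ •
        ((stdOrthonormalBasis ℝ (U n) i : U n) : E) := by
    funext x
    rw [(stdOrthonormalBasis ℝ (U n)).starProjection_eq_sum_rankOne]
    simp [real_inner_comm]
  rw [hsum]
  refine Finset.stronglyMeasurable_fun_sum _ fun i _ => ?_
  exact (h _).stronglyMeasurable.smul_const _

/-! ### Traces -/

section TraceBounds

variable {E F : Type*} [NormedAddCommGroup E] [InnerProductSpace ℝ E]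
  [NormedAddCommGroup F] [InnerProductSpace ℝ F]

theorem sum_inner_le_of_posTrace_le {T : E →L[ℝ] E} {c : ℝ} (hc : 0 ≤ c)
    (h : posTrace T ≤ ENNReal.ofReal c) {ι : Type*} {e : ι → E} (he : Orthonormal ℝ e)
    (s : Finset ι) : ∑ i ∈ s, ⟪T (e i), e i⟫_ℝ ≤ c := by
  classical
  have hinj := he.linearIndependent.injective
  have ho : Orthonormal ℝ (Subtype.val : {x // x ∈ s.image e} → E) := by
    have h1 : ((s.image e : Finset E) : Set E) ⊆ range e := by
      rw [Finset.coe_image]; exact image_subset_range _ _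
    exact he.toSubtypeRange.comp (Set.inclusion h1) (Set.inclusion_injective h1)
  have h1 := (le_iSup₂ (f := fun (s : Finset E) (_ : Orthonormal ℝ (Subtype.val : s → E)) =>
    ENNReal.ofReal (∑ e ∈ s, ⟪T e, e⟫_ℝ)) _ ho).trans h
  rw [Finset.sum_image fun _ _ _ _ h => hinj h] at h1
  exact (ENNReal.ofReal_le_ofReal_iff hc).1 h1

/-- The Hilbert-Schmidt norms of `K` and of its adjoint agree. -/
theorem sum_norm_sq_adjoint_le [CompleteSpace E] [CompleteSpace F] {K : E →L[ℝ] F} {c : ℝ}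
    (hc : 0 ≤ c) (h : hsNormSq K ≤ ENNReal.ofReal c) {ι : Type*} {e : ι → F}
    (he : Orthonormal ℝ e) (s : Finset ι) :
    ∑ i ∈ s, ‖ContinuousLinearMap.adjoint K (e i)‖ ^ 2 ≤ c := by
  classical
  let U : Submodule ℝ E :=
    Submodule.span ℝ ((fun i => ContinuousLinearMap.adjoint K (e i)) '' (s : Set ι))
  have hfin : FiniteDimensional ℝ U := FiniteDimensional.span_of_finite ℝ (s.finite_toSet.image _)
  let b := stdOrthonormalBasis ℝ U
  have hb : Orthonormal ℝ fun j => (b j : E) := b.orthonormal.comp_linearIsometry U.subtypeₗᵢ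
  calc ∑ i ∈ s, ‖ContinuousLinearMap.adjoint K (e i)‖ ^ 2
      = ∑ i ∈ s, ∑ j, ‖⟪e i, K (b j)⟫_ℝ‖ ^ 2 := by
        refine Finset.sum_congr rfl fun i hi => ?_
        have hmem : ContinuousLinearMap.adjoint K (e i) ∈ U :=
          Submodule.subset_span ⟨i, hi, rfl⟩
        have h1 := b.sum_sq_norm_inner_left ⟨_, hmem⟩
        simp only [Submodule.coe_inner, ContinuousLinearMap.adjoint_inner_left,
          Submodule.coe_norm] at h1
        exact h1.symm
    _ = ∑ j, ∑ i ∈ s, ‖⟪e i, K (b j)⟫_ℝ‖ ^ 2 := Finset.sum_comm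
    _ ≤ ∑ j, ‖K (b j)‖ ^ 2 := Finset.sum_le_sum fun j _ => he.sum_inner_products_le _
    _ = ∑ j, ⟪(ContinuousLinearMap.adjoint K ∘L K) (b j), (b j : E)⟫_ℝ := by
        simp [ContinuousLinearMap.adjoint_inner_left]
    _ ≤ c := sum_inner_le_of_posTrace_le hc h hb _

/-- The operator norm is at most the Hilbert-Schmidt norm, with the latter tested on finite parts of
a basis only. -/
theorem norm_le_of_sum_norm_sq_le [CompleteSpace E] {ι : Type*} (e : HilbertBasis ι ℝ E)
    (A : E →L[ℝ] F) {τ : ℝ} (hτ : 0 ≤ τ) (h : ∀ s : Finset ι, ∑ i ∈ s, ‖A (e i)‖ ^ 2 ≤ τ ^ 2)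
    (g : E) : ‖A g‖ ≤ τ * ‖g‖ := by
  have hlim : Tendsto (fun s : Finset ι => ‖∑ i ∈ s, A (e.repr g i • e i)‖) atTop (𝓝 ‖A g‖) :=
    ((e.hasSum_repr g).mapL A).norm
  refine le_of_tendsto hlim (Eventually.of_forall fun s => ?_)
  calc ‖∑ i ∈ s, A (e.repr g i • e i)‖ ≤ ∑ i ∈ s, ‖⟪e i, g⟫_ℝ‖ * ‖A (e i)‖ := by
        refine (norm_sum_le _ _).trans (le_of_eq (Finset.sum_congr rfl fun i _ => ?_))
        rw [map_smul, norm_smul, e.repr_apply_apply]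
    _ ≤ √(∑ i ∈ s, ‖⟪e i, g⟫_ℝ‖ ^ 2) * √(∑ i ∈ s, ‖A (e i)‖ ^ 2) :=
        Real.sum_mul_le_sqrt_mul_sqrt _ _ _
    _ ≤ √(‖g‖ ^ 2) * √(τ ^ 2) := by
        gcongr
        · exact e.orthonormal.sum_inner_products_le g
        · exact h s
    _ = τ * ‖g‖ := by rw [Real.sqrt_sq (norm_nonneg _), Real.sqrt_sq hτ, mul_comm]

/-- Orthonormal vectors have distance `√2`, so the balls of radius `1/2` around them are disjoint.
-/
theorem countable_of_orthonormal [TopologicalSpace.SeparableSpace E] {ι : Type*} {e : ι → E}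
    (he : Orthonormal ℝ e) : Countable ι := by
  refine Pairwise.countable_of_isOpen_disjoint (s := fun i => Metric.ball (e i) (1 / 2)) ?_
    (fun i => Metric.isOpen_ball) (fun i => ⟨e i, Metric.mem_ball_self (by norm_num)⟩)
  intro i j hij
  refine Metric.ball_disjoint_ball ?_
  rw [dist_eq_norm]
  refine le_of_sq_le_sq ?_ (norm_nonneg _)
  rw [norm_sub_sq_real, he.1 i, he.1 j, he.2 hij]
  norm_num

/-- `W` is a symmetric inverse square root of `T + lam`. -/
structure IsInvSqrt (T : E →L[ℝ] E) (lam : ℝ) (W : E →L[ℝ] E) : Prop where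
  symm : ∀ x y, ⟪W x, y⟫_ℝ = ⟪x, W y⟫_ℝ
  norm_le : ‖W‖ ≤ 1 / √lam
  mul_left : W * W * (T + lam • 1) = 1
  mul_right : (T + lam • 1) * (W * W) = 1
  comm : W * T = T * W

theorem IsInvSqrt.effDim_eq {T W : E →L[ℝ] E} {lam : ℝ} (h : IsInvSqrt T lam W) :
    effDim T lam = posTrace (W * W * T) := by
  unfold effDim
  have : Ring.inverse (T + lam • (1 : E →L[ℝ] E)) = W * W :=
    Ring.inverse_unit (⟨T + lam • 1, W * W, h.mul_right, h.mul_left⟩ : (E →L[ℝ] E)ˣ)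
  rw [this]

theorem IsInvSqrt.inner_eq {T W : E →L[ℝ] E} {lam : ℝ} (h : IsInvSqrt T lam W) (x : E) :
    ⟪(W * W * T) x, x⟫_ℝ = ⟪T (W x), W x⟫_ℝ := by
  rw [mul_assoc, h.comm, mul_apply_eq_comp, mul_apply_eq_comp, h.symm]

/-- The vector `V g = (T + lam)^{1/2} g`. -/
theorem IsInvSqrt.exists_sqrt {T W : E →L[ℝ] E} {lam : ℝ} (h : IsInvSqrt T lam W) (g : E) :
    ∃ x, W x = g ∧ ‖x‖ ^ 2 = ⟪T g, g⟫_ℝ + lam * ‖g‖ ^ 2 := by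
  have hc : W * (T + lam • 1) = (T + lam • 1) * W := by
    rw [mul_add, add_mul, h.comm]
    simp
  have h1 : W (W ((T + lam • 1) g)) = g := congrArg (fun S : E →L[ℝ] E => S g) h.mul_left
  refine ⟨W ((T + lam • 1) g), h1, ?_⟩
  rw [← real_inner_self_eq_norm_sq, ← h.symm, h1, real_inner_comm, add_apply, inner_add_left,
    smul_apply, one_apply_eq_self, inner_smul_left, real_inner_self_eq_norm_sq]
  simp

end TraceBounds

/-! ### Bounded random vectors -/

section Bounded

variable {E Z : Type*} [NormedAddCommGroup E] [InnerProductSpace ℝ E] [MeasurableSpace Z]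
  {ρ : Measure Z} [IsProbabilityMeasure ρ] {ζ : Z → E}

/-- The centered vectors have norm at most `2b`, so `t‖ζ - c‖ ≤ 1` and `exp x - 1 - x ≤ x²` applies.
Centering does not increase the second moment. -/
theorem measure_norm_sum_sub_gt_le (hζ : StronglyMeasurable ζ) {c : E} {b V : ℝ}
    (hmean : ∀ w, ∫ z, ⟪w, ζ z⟫_ℝ ∂ρ = ⟪w, c⟫_ℝ) (hb : ∀ z, ‖ζ z‖ ≤ b) (hV : 0 ≤ V)
    (hvar : ∫⁻ z, ENNReal.ofReal (‖ζ z‖ ^ 2) ∂ρ ≤ ENNReal.ofReal V) {m : ℕ} (hm : 1 ≤ m)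
    {t : ℝ} (ht : 0 < t) (htb : t * (2 * b) ≤ 1) (htV : m * (t ^ 2 * V) ≤ 1) {η : ℝ}
    (hη : 0 < η) :
    (Measure.pi fun _ : Fin m => ρ) {z | 1 / t * (1 + Real.log (4 / η)) < ‖∑ i, (ζ (z i) - c)‖} ≤
      ENNReal.ofReal (η / 2) := by
  have hm0 : (0 : ℝ) < m := by exact_mod_cast hm
  have hint : Integrable ζ ρ := Integrable.of_bound hζ.aestronglyMeasurable b (ae_of_all _ hb)
  have hint2 : Integrable (fun z => ‖ζ z‖ ^ 2) ρ :=
    (memLp_two_iff_integrable_sq_norm hζ.aestronglyMeasurable).1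
      (MemLp.of_bound hζ.aestronglyMeasurable b (ae_of_all _ hb))
  have hb0 : 0 ≤ b := by
    obtain ⟨z⟩ := nonempty_of_isProbabilityMeasure ρ
    exact (norm_nonneg _).trans (hb z)
  have hvar' : ∫ z, ‖ζ z‖ ^ 2 ∂ρ ≤ V := by
    rw [integral_eq_lintegral_of_nonneg_ae (ae_of_all _ fun z => sq_nonneg _)
      hint2.aestronglyMeasurable]
    exact ENNReal.toReal_le_of_le_ofReal hV hvar
  have hc : ‖c‖ ≤ b := by
    have h1 : ‖c‖ ^ 2 ≤ ‖c‖ * b := by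
      rw [← real_inner_self_eq_norm_sq, ← hmean]
      calc ∫ z, ⟪c, ζ z⟫_ℝ ∂ρ ≤ ∫ _, ‖c‖ * b ∂ρ :=
            integral_mono (hint.const_inner c) (integrable_const _) fun z =>
              (real_inner_le_norm _ _).trans (by gcongr; exact hb z)
        _ = ‖c‖ * b := by simp
    rcases (norm_nonneg c).eq_or_lt with h | h
    · rw [← h]; exact hb0
    · nlinarith
  refine measure_norm_sum_gt_le (hζ.sub stronglyMeasurable_const) (fun w => ?_) hm ht ?_ hη
  · simp only [Pi.sub_apply, inner_sub_right]
    rw [integral_sub (hint.const_inner w) (integrable_const _), hmean]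
    simp
  · have hnb : ∀ z, t * ‖ζ z - c‖ ≤ 1 := fun z => by
      refine le_trans ?_ htb
      gcongr
      linarith [norm_sub_le (ζ z) c, hb z]
    have hi : Integrable (fun z => ‖ζ z - c‖ ^ 2) ρ := by
      have := (hint2.sub ((hint.const_inner c).const_mul 2)).add (integrable_const (‖c‖ ^ 2))
      refine this.congr (ae_of_all _ fun z => ?_)
      simp only [Pi.add_apply, Pi.sub_apply]
      rw [norm_sub_sq_real, real_inner_comm]
    calc ∫⁻ z, ENNReal.ofReal (Real.exp (t * ‖ζ z - c‖) - 1 - t * ‖ζ z - c‖) ∂ρ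
        ≤ ∫⁻ z, ENNReal.ofReal (t ^ 2 * ‖ζ z - c‖ ^ 2) ∂ρ := by
          refine lintegral_mono fun z => ENNReal.ofReal_le_ofReal ?_
          rw [← mul_pow]
          exact exp_sub_le_sq (by positivity) (hnb z)
      _ = ENNReal.ofReal (∫ z, t ^ 2 * ‖ζ z - c‖ ^ 2 ∂ρ) :=
          (ofReal_integral_eq_lintegral_ofReal (hi.const_mul _)
            (ae_of_all _ fun z => by positivity)).symm
      _ ≤ ENNReal.ofReal (1 / m) := by
          refine ENNReal.ofReal_le_ofReal ?_
          have h2 : ∫ z, ‖ζ z - c‖ ^ 2 ∂ρ ≤ V := by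
            have h3 : (fun z => ‖ζ z - c‖ ^ 2) =
                fun z => ‖ζ z‖ ^ 2 - 2 * ⟪c, ζ z⟫_ℝ + ‖c‖ ^ 2 := by
              funext z; rw [norm_sub_sq_real, real_inner_comm]
            have h4 : Integrable (fun z => 2 * ⟪c, ζ z⟫_ℝ) ρ := (hint.const_inner c).const_mul 2
            have h5 : Integrable (fun z => ‖ζ z‖ ^ 2 - 2 * ⟪c, ζ z⟫_ℝ) ρ := hint2.sub h4
            rw [h3, integral_add h5 (integrable_const _),
              integral_sub hint2 h4, integral_const_mul, hmean,
              real_inner_self_eq_norm_sq]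
            simp only [integral_const, probReal_univ, one_smul]
            nlinarith [sq_nonneg ‖c‖]
          rw [integral_const_mul, le_div_iff₀ hm0]
          have := mul_le_mul_of_nonneg_left h2 (by positivity : 0 ≤ (m : ℝ) * t ^ 2)
          linarith

end Bounded

/-! ### Sampling operators in the reproducing kernel Hilbert space -/

section Sampling

variable {X Y G : Type*} [MeasurableSpace X] [NormedAddCommGroup Y] [InnerProductSpace ℝ Y]
  [CompleteSpace Y] [TopologicalSpace.SeparableSpace Y]
  [NormedAddCommGroup G] [InnerProductSpace ℝ G] [CompleteSpace G]
  [RKHS ℝ G X Y] {κ : ℝ}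

omit [TopologicalSpace.SeparableSpace Y] in
theorem KernelCondition.norm_kerFun_le (hK : KernelCondition (X := X) (Y := Y) G κ) (x : X) :
    ‖RKHS.kerFun G x‖ ≤ κ :=
  norm_le_of_hsNormSq_le hK.nonneg (hK.hilbertSchmidt x)

theorem inner_embL2 (hK : KernelCondition (X := X) (Y := Y) G κ) (ν : Measure X)
    [IsProbabilityMeasure ν] (f g : G) :
    ⟪embL2 hK ν f, embL2 hK ν g⟫_ℝ = ∫ x, ⟪f x, g x⟫_ℝ ∂ν := by
  rw [L2.inner_def]
  refine integral_congr_ae ?_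
  filter_upwards [(hK.memLp ν f).coeFn_toLp, (hK.memLp ν g).coeFn_toLp] with x h1 h2
  change ⟪(hK.memLp ν f).toLp (fun x => f x) x, (hK.memLp ν g).toLp (fun x => g x) x⟫_ℝ = _
  rw [h1, h2]

theorem inner_covOp (hK : KernelCondition (X := X) (Y := Y) G κ) (ν : Measure X)
    [IsProbabilityMeasure ν] (f g : G) :
    ⟪covOp hK ν f, g⟫_ℝ = ∫ x, ⟪f x, g x⟫_ℝ ∂ν := by
  rw [← inner_embL2 hK ν, covOp, ContinuousLinearMap.comp_apply,
    ContinuousLinearMap.adjoint_inner_left]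

theorem inner_covOp_self (hK : KernelCondition (X := X) (Y := Y) G κ) (ν : Measure X)
    [IsProbabilityMeasure ν] (g : G) : ⟪covOp hK ν g, g⟫_ℝ = ‖embL2 hK ν g‖ ^ 2 := by
  rw [inner_covOp, ← inner_embL2, real_inner_self_eq_norm_sq]

theorem isPos_covOp (hK : KernelCondition (X := X) (Y := Y) G κ) (ν : Measure X)
    [IsProbabilityMeasure ν] : IsPos (covOp hK ν) := by
  refine ⟨fun f g => ?_, fun g => ?_⟩
  · rw [inner_covOp, real_inner_comm, inner_covOp]
    simp only [real_inner_comm]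
  · rw [inner_covOp_self]; positivity

theorem exists_isInvSqrt_covOp (hK : KernelCondition (X := X) (Y := Y) G κ) (ν : Measure X)
    [IsProbabilityMeasure ν] {lam : ℝ} (hlam : 0 < lam) :
    ∃ W, IsInvSqrt (covOp hK ν) lam W := by
  obtain ⟨W, h1, h2, h3, h4, h5⟩ := (isPos_covOp hK ν).exists_inv_sqrt hlam
  exact ⟨W, h1, h2, h3, h4, h5⟩

theorem IsInvSqrt.norm_comp_kerFun_le {ν : Measure X} [IsProbabilityMeasure ν] {lam : ℝ}
    {hK : KernelCondition (X := X) (Y := Y) G κ} {W : G →L[ℝ] G}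
    (hW : IsInvSqrt (covOp hK ν) lam W) (x : X) : ‖W ∘L RKHS.kerFun G x‖ ≤ κ / √lam := by
  refine (ContinuousLinearMap.opNorm_comp_le _ _).trans ?_
  rw [← one_div_mul_eq_div]
  exact mul_le_mul hW.norm_le (hK.norm_kerFun_le x) (norm_nonneg _) (by positivity)

theorem lintegral_norm_sq_apply (hK : KernelCondition (X := X) (Y := Y) G κ) (ν : Measure X)
    [IsProbabilityMeasure ν] (g : G) :
    ∫⁻ x, ENNReal.ofReal (‖g x‖ ^ 2) ∂ν = ENNReal.ofReal ⟪covOp hK ν g, g⟫_ℝ := by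
  rw [inner_covOp, ofReal_integral_eq_lintegral_ofReal]
  · simp only [real_inner_self_eq_norm_sq]
  · simp only [real_inner_self_eq_norm_sq]
    exact (memLp_two_iff_integrable_sq_norm (hK.stronglyMeasurable g).aestronglyMeasurable).1
      (hK.memLp ν g)
  · exact ae_of_all _ fun x => real_inner_self_nonneg

variable [TopologicalSpace.SeparableSpace G]

/-- The squared norm of `W K_x` is at most that of its adjoint in Hilbert-Schmidt norm, `∑ ‖(W
b_i)(x)‖²`. Tonelli turns the integral into `∑ ⟪T W b_i, W b_i⟫`, the trace that defines the
effective dimension. -/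
theorem IsInvSqrt.lintegral_norm_sq_comp_kerFun_le {ν : Measure X} [IsProbabilityMeasure ν]
    {lam N : ℝ} (hN : 0 ≤ N) {hK : KernelCondition (X := X) (Y := Y) G κ} {W : G →L[ℝ] G}
    (hW : IsInvSqrt (covOp hK ν) lam W) (h : effDim (covOp hK ν) lam ≤ ENNReal.ofReal N) :
    ∫⁻ x, ENNReal.ofReal (‖W ∘L RKHS.kerFun G x‖ ^ 2) ∂ν ≤ ENNReal.ofReal N := by
  obtain ⟨w, b, -⟩ := exists_hilbertBasis ℝ G
  have hcount : Countable w := countable_of_orthonormal b.orthonormal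
  rw [hW.effDim_eq] at h
  calc ∫⁻ x, ENNReal.ofReal (‖W ∘L RKHS.kerFun G x‖ ^ 2) ∂ν
      ≤ ∫⁻ x, ∑' i, ENNReal.ofReal (‖(W (b i)) x‖ ^ 2) ∂ν := by
        refine lintegral_mono fun x => ?_
        by_cases htop : ∑' i, ENNReal.ofReal (‖(W (b i)) x‖ ^ 2) = ∞
        · rw [htop]; exact le_top
        set s := (∑' i, ENNReal.ofReal (‖(W (b i)) x‖ ^ 2)).toReal with hs
        have hs0 : 0 ≤ s := ENNReal.toReal_nonneg
        rw [← ENNReal.ofReal_toReal htop, ← hs]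
        refine ENNReal.ofReal_le_ofReal ?_
        have hadj : W ∘L RKHS.kerFun G x =
            ContinuousLinearMap.adjoint (ContinuousLinearMap.adjoint (RKHS.kerFun G x) ∘L W) := by
          rw [ContinuousLinearMap.adjoint_comp, ContinuousLinearMap.adjoint_adjoint,
            ← (ContinuousLinearMap.eq_adjoint_iff W W).2 hW.symm]
        have h1 : ‖W ∘L RKHS.kerFun G x‖ ≤ √s := by
          rw [hadj, LinearIsometryEquiv.norm_map]
          refine ContinuousLinearMap.opNorm_le_bound _ (Real.sqrt_nonneg _)
            (norm_le_of_sum_norm_sq_le b _ (Real.sqrt_nonneg _) fun F => ?_)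
          rw [Real.sq_sqrt hs0, hs, ← ENNReal.ofReal_le_iff_le_toReal htop,
            ENNReal.ofReal_sum_of_nonneg fun i _ => by positivity]
          simp only [ContinuousLinearMap.comp_apply, RKHS.adjoint_kerFun]
          exact ENNReal.sum_le_tsum F
        calc ‖W ∘L RKHS.kerFun G x‖ ^ 2 ≤ √s ^ 2 := by gcongr
          _ = s := Real.sq_sqrt hs0
    _ = ∑' i, ∫⁻ x, ENNReal.ofReal (‖(W (b i)) x‖ ^ 2) ∂ν :=
        lintegral_tsum fun i =>
          ((hK.stronglyMeasurable (W (b i))).norm.measurable.pow_const 2).ennreal_ofReal.aemeasurable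
    _ ≤ ENNReal.ofReal N := by
        rw [ENNReal.tsum_eq_iSup_sum]
        refine iSup_le fun F => ?_
        simp only [lintegral_norm_sq_apply hK ν, ← hW.inner_eq]
        rw [← ENNReal.ofReal_sum_of_nonneg fun i _ => by
          rw [hW.inner_eq]; exact (isPos_covOp hK ν).nonneg _]
        exact ENNReal.ofReal_le_ofReal (sum_inner_le_of_posTrace_le hN h b.orthonormal F)

theorem KernelCondition.stronglyMeasurable_kerFun_apply
    (hK : KernelCondition (X := X) (Y := Y) G κ) {Z : Type*} [MeasurableSpace Z] {π : Z → X}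
    (hπ : Measurable π) {ε : Z → Y} (hε : StronglyMeasurable ε) :
    StronglyMeasurable fun z => RKHS.kerFun G (π z) (ε z) := by
  refine stronglyMeasurable_of_inner fun w => ?_
  simp only [RKHS.kerFun_inner]
  exact (hε.inner ((hK.stronglyMeasurable w).comp_measurable hπ)).measurable

end Sampling

/-! ### Concentration of the sampled noise and of the sampled covariance -/

section ProblemBounds

variable {X Y H G : Type*} [MeasurableSpace X]
  [NormedAddCommGroup Y] [InnerProductSpace ℝ Y] [CompleteSpace Y]
  [TopologicalSpace.SeparableSpace Y] [MeasurableSpace Y] [BorelSpace Y]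
  [NormedAddCommGroup H] [InnerProductSpace ℝ H]
  [NormedAddCommGroup G] [InnerProductSpace ℝ G] [CompleteSpace G] [RKHS ℝ G X Y]

namespace InverseProblem

variable (P : InverseProblem X Y H G)

theorem isProbabilityMeasure_dataLaw : IsProbabilityMeasure P.dataLaw := by
  unfold dataLaw; infer_instance

attribute [instance] isProbabilityMeasure_dataLaw

variable [TopologicalSpace.SeparableSpace G] {P} {κ lam N M Sig : ℝ}
  {hK : KernelCondition (X := X) (Y := Y) G κ} {W : G →L[ℝ] G}

/-- Tail bound for the preconditioned noise. -/
theorem measure_norm_noise_gt_le (hT : P.TrueSolution) (hM : 0 < M) (hN : 0 ≤ N)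
    (hnoise : P.NoiseCondition M Sig) (hW : IsInvSqrt (covOp hK P.ν) lam W) (hlam : 0 < lam)
    (h : effDim (covOp hK P.ν) lam ≤ ENNReal.ofReal N) {m : ℕ} (hm : 1 ≤ m)
    {t : ℝ} (ht : 0 < t) (htb : t * (κ * M) ≤ √lam) (htV : m * (t ^ 2 * (N * Sig ^ 2)) ≤ 2)
    {η : ℝ} (hη : 0 < η) :
    (Measure.pi fun _ : Fin m => P.dataLaw) {z | 1 / t * (1 + Real.log (4 / η)) <
      ‖∑ i, W (RKHS.kerFun G (z i).1 ((z i).2 - P.A P.fhat (z i).1))‖} ≤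
      ENNReal.ofReal (η / 2) := by
  have : SecondCountableTopology Y := UniformSpace.secondCountable_of_separable Y
  have hm0 : (0 : ℝ) < m := by exact_mod_cast hm
  set ε : X × Y → Y := fun z => z.2 - P.A P.fhat z.1
  have hε : StronglyMeasurable ε := measurable_snd.stronglyMeasurable.sub
    ((hK.stronglyMeasurable (P.A P.fhat)).comp_measurable measurable_fst)
  set ξ : X × Y → G := fun z => W (RKHS.kerFun G z.1 (ε z))
  have hξ : StronglyMeasurable ξ := W.continuous.comp_stronglyMeasurable
    (hK.stronglyMeasurable_kerFun_apply measurable_fst hε)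
  have hexp : ∫⁻ z, ENNReal.ofReal (Real.exp (t * ‖ξ z‖) - 1 - t * ‖ξ z‖) ∂P.dataLaw ≤
      ENNReal.ofReal (1 / m) := by
    have hmeas : Measurable fun z => ENNReal.ofReal (Real.exp (t * ‖ξ z‖) - 1 - t * ‖ξ z‖) := by
      have := hξ.norm.measurable
      fun_prop
    rw [dataLaw, Measure.lintegral_compProd hmeas]
    calc ∫⁻ x, ∫⁻ y, ENNReal.ofReal (Real.exp (t * ‖ξ (x, y)‖) - 1 - t * ‖ξ (x, y)‖)
          ∂P.cond x ∂P.ν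
        ≤ ∫⁻ x, ENNReal.ofReal (t ^ 2 * Sig ^ 2 / 2) *
            ENNReal.ofReal (‖W ∘L RKHS.kerFun G x‖ ^ 2) ∂P.ν := by
          refine lintegral_mono_ae ?_
          filter_upwards [hnoise] with x hx
          -- Since `‖W K_x‖ ≤ κ/√lam`, the factor `k` is at most `1`, so `exp_mul_sub_le` pulls `k²`
          -- out of the exponential moment. The noise condition then yields a variance proportional
          -- to `‖W K_x‖²`.
          set k := t * ‖W ∘L RKHS.kerFun G x‖ * M
          have hk0 : 0 ≤ k := by positivity
          have hk1 : k ≤ 1 := by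
            have h1 := hW.norm_comp_kerFun_le x
            rw [le_div_iff₀ (Real.sqrt_pos.2 hlam)] at h1
            have h2 : 0 < √lam := Real.sqrt_pos.2 hlam
            have h3 : k * √lam ≤ 1 * √lam := by
              calc k * √lam = t * (‖W ∘L RKHS.kerFun G x‖ * √lam * M) := by ring
                _ ≤ t * (κ * M) := by gcongr
                _ ≤ 1 * √lam := by rw [one_mul]; exact htb
            exact le_of_mul_le_mul_right h3 h2
          calc ∫⁻ y, ENNReal.ofReal (Real.exp (t * ‖ξ (x, y)‖) - 1 - t * ‖ξ (x, y)‖) ∂P.cond x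
              ≤ ∫⁻ y, ENNReal.ofReal (k ^ 2) * ENNReal.ofReal
                  (Real.exp (‖y - P.A P.fhat x‖ / M) - ‖y - P.A P.fhat x‖ / M - 1) ∂P.cond x := by
                refine lintegral_mono fun y => ?_
                rw [← ENNReal.ofReal_mul (sq_nonneg _)]
                refine ENNReal.ofReal_le_ofReal ?_
                have h1 : t * ‖ξ (x, y)‖ ≤ k * (‖y - P.A P.fhat x‖ / M) := by
                  have h2 := (W ∘L RKHS.kerFun G x).le_opNorm (y - P.A P.fhat x)
                  have h3 : k * (‖y - P.A P.fhat x‖ / M) =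
                      t * (‖W ∘L RKHS.kerFun G x‖ * ‖y - P.A P.fhat x‖) := by
                    simp only [k]; field_simp
                  rw [h3]
                  gcongr
                  exact h2
                have h4 := exp_sub_mono (by positivity) h1
                have h5 := exp_mul_sub_le (x := ‖y - P.A P.fhat x‖ / M) (by positivity) hk0 hk1
                rw [sub_right_comm _ (‖y - P.A P.fhat x‖ / M)]
                exact h4.trans h5
            _ = ENNReal.ofReal (k ^ 2) * ∫⁻ y, ENNReal.ofReal
                  (Real.exp (‖y - P.A P.fhat x‖ / M) - ‖y - P.A P.fhat x‖ / M - 1) ∂P.cond x :=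
                lintegral_const_mul' _ _ ENNReal.ofReal_ne_top
            _ ≤ ENNReal.ofReal (k ^ 2) * ENNReal.ofReal (Sig ^ 2 / (2 * M ^ 2)) := by gcongr
            _ = ENNReal.ofReal (t ^ 2 * Sig ^ 2 / 2) *
                  ENNReal.ofReal (‖W ∘L RKHS.kerFun G x‖ ^ 2) := by
                rw [← ENNReal.ofReal_mul (by positivity), ← ENNReal.ofReal_mul (by positivity)]
                congr 1
                simp only [k]
                field_simp
      _ = ENNReal.ofReal (t ^ 2 * Sig ^ 2 / 2) *
            ∫⁻ x, ENNReal.ofReal (‖W ∘L RKHS.kerFun G x‖ ^ 2) ∂P.ν :=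
          lintegral_const_mul' _ _ ENNReal.ofReal_ne_top
      _ ≤ ENNReal.ofReal (t ^ 2 * Sig ^ 2 / 2) * ENNReal.ofReal N := by
          gcongr
          exact hW.lintegral_norm_sq_comp_kerFun_le hN h
      _ ≤ ENNReal.ofReal (1 / m) := by
          rw [← ENNReal.ofReal_mul (by positivity)]
          refine ENNReal.ofReal_le_ofReal ?_
          rw [le_div_iff₀ hm0]
          linarith
  refine measure_norm_sum_gt_le hξ (fun w => ?_) hm ht hexp hη
  have hint : Integrable (fun z => ξ z) P.dataLaw := by
    have h1 := (integrable_norm_of_exp (hξ.const_smul t) (c := 1 / m) (by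
      simpa only [Pi.smul_apply, norm_smul, Real.norm_of_nonneg ht.le] using hexp)).2
    have h2 := h1.smul t⁻¹
    refine h2.congr (ae_of_all _ fun z => ?_)
    simp [smul_smul, inv_mul_cancel₀ ht.ne']
  have hint' : Integrable (fun z => ⟪w, ξ z⟫_ℝ) (P.ν ⊗ₘ P.cond) := hint.const_inner w
  rw [dataLaw, Measure.integral_compProd hint']
  refine integral_eq_zero_of_ae ?_
  filter_upwards [hT.condMean] with x hx
  have h1 : ∀ y, ⟪w, ξ (x, y)⟫_ℝ = ⟪(W w) x, y - P.A P.fhat x⟫_ℝ := fun y => by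
    simp only [ξ, ε]
    rw [← hW.symm, RKHS.inner_kerFun]
  simp only [h1, Pi.zero_apply]
  have h2 : Integrable (fun y => y - P.A P.fhat x) (P.cond x) := hx.1.sub (integrable_const _)
  rw [integral_inner h2, integral_sub hx.1 (integrable_const _), hx.2]
  simp

/-- Tail bound for the preconditioned deviation of the empirical covariance operator. -/
theorem measure_covariance_deviation_le (hN : 0 ≤ N) (hW : IsInvSqrt (covOp hK P.ν) lam W)
    (hlam : 0 < lam) (h : effDim (covOp hK P.ν) lam ≤ ENNReal.ofReal N) {m : ℕ} (hm : 1 ≤ m)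
    {t : ℝ} (ht : 0 < t) (htb : t * (2 * κ ^ 2) ≤ √lam) (htV : m * (t ^ 2 * (κ ^ 2 * N)) ≤ 1)
    {η : ℝ} (hη : 0 < η) (hη1 : η < 1) :
    (Measure.pi fun _ : Fin m => P.dataLaw) {z | ¬ ∀ g : G,
      ‖∑ i, (W (RKHS.kerFun G (z i).1 (g (z i).1)) - W (covOp hK P.ν g))‖ ≤
        1 / t * (1 + Real.log (4 / η)) * ‖g‖} ≤ ENNReal.ofReal (η / 2) := by
  classical
  obtain ⟨w, b, -⟩ := exists_hilbertBasis ℝ G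
  have hcount : Countable w := countable_of_orthonormal b.orthonormal
  set τ := 1 / t * (1 + Real.log (4 / η))
  have hτ : 0 ≤ τ := by
    have : 0 ≤ Real.log (4 / η) := Real.log_nonneg (by rw [le_div_iff₀ hη]; linarith)
    positivity
  let D : (Fin m → X × Y) → G →L[ℝ] G := fun z => ∑ i, (W ∘L RKHS.kerFun G (z i).1 ∘L
    ContinuousLinearMap.adjoint (RKHS.kerFun G (z i).1) - W ∘L covOp hK P.ν)
  have hD : ∀ z g, D z g =
      ∑ i, (W (RKHS.kerFun G (z i).1 (g (z i).1)) - W (covOp hK P.ν g)) := fun z g => by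
    simp [D, sum_apply]
  -- Finite sections of the Hilbert-Schmidt norm. They increase with `F`, so a tail bound uniform in
  -- `F` passes to the union by continuity of the measure; for fixed `F` it is a vector inequality
  -- in `G^F`, independent of its dimension.
  let B : Finset w → Set (Fin m → X × Y) := fun F => {z | τ < √(∑ i ∈ F, ‖D z (b i)‖ ^ 2)}
  have hBdir : Directed (· ⊆ ·) B := by
    refine Monotone.directed_le fun F F' hF z hz => ?_
    refine lt_of_lt_of_le hz (Real.sqrt_le_sqrt ?_)
    exact Finset.sum_le_sum_of_subset_of_nonneg hF fun _ _ _ => by positivity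
  have hsub : {z | ¬ ∀ g : G,
      ‖∑ i, (W (RKHS.kerFun G (z i).1 (g (z i).1)) - W (covOp hK P.ν g))‖ ≤ τ * ‖g‖} ⊆
      ⋃ F, B F := by
    intro z hz
    by_contra hcon
    simp only [B, mem_iUnion, not_exists, mem_ofPred_eq, not_lt] at hcon
    refine hz fun g => ?_
    rw [← hD]
    refine norm_le_of_sum_norm_sq_le b (D z) hτ (fun F => ?_) g
    rw [← Real.sqrt_le_left hτ]
    exact hcon F
  refine (measure_mono hsub).trans ?_
  rw [hBdir.measure_iUnion]
  refine iSup_le fun F => ?_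
  let ζ : X × Y → PiLp 2 (fun _ : F => G) := fun z =>
    WithLp.toLp 2 fun i => W (RKHS.kerFun G z.1 ((b i) z.1))
  let c : PiLp 2 (fun _ : F => G) := WithLp.toLp 2 fun i => W (covOp hK P.ν (b i))
  have hζi : ∀ g : G, StronglyMeasurable fun x : X => W (RKHS.kerFun G x (g x)) := fun g =>
    W.continuous.comp_stronglyMeasurable
      (hK.stronglyMeasurable_kerFun_apply measurable_id (hK.stronglyMeasurable g))
  have hζ : StronglyMeasurable ζ := by
    refine stronglyMeasurable_of_inner fun v => ?_
    simp only [PiLp.inner_apply]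
    exact Finset.measurable_fun_sum _ fun i _ =>
      (((hζi (b i)).comp_measurable measurable_fst).inner stronglyMeasurable_const).measurable
  have hfst : ∀ f : X → ℝ≥0∞, Measurable f → ∫⁻ z, f z.1 ∂P.dataLaw = ∫⁻ x, f x ∂P.ν := by
    intro f hf
    rw [dataLaw, Measure.lintegral_compProd (f := fun z : X × Y => f z.1) (hf.comp measurable_fst)]
    simp
  have hζn : ∀ z, ‖ζ z‖ ^ 2 ≤ κ ^ 2 * ‖W ∘L RKHS.kerFun G z.1‖ ^ 2 := fun z => by
    rw [PiLp.norm_sq_eq_of_L2]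
    calc ∑ i, ‖(ζ z) i‖ ^ 2
        ≤ ∑ i : F, ‖W ∘L RKHS.kerFun G z.1‖ ^ 2 * ‖(b i) z.1‖ ^ 2 := by
          refine Finset.sum_le_sum fun i _ => ?_
          rw [← mul_pow]
          gcongr
          exact (W ∘L RKHS.kerFun G z.1).le_opNorm _
      _ = ‖W ∘L RKHS.kerFun G z.1‖ ^ 2 * ∑ i ∈ F, ‖(b i) z.1‖ ^ 2 := by
          rw [← Finset.mul_sum, Finset.sum_coe_sort F fun i => ‖(b i) z.1‖ ^ 2]
      _ ≤ ‖W ∘L RKHS.kerFun G z.1‖ ^ 2 * κ ^ 2 := by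
          gcongr
          have := sum_norm_sq_adjoint_le (sq_nonneg κ) (hK.hilbertSchmidt z.1) b.orthonormal F
          simpa only [RKHS.adjoint_kerFun] using this
      _ = _ := mul_comm _ _
  have key := measure_norm_sum_sub_gt_le (ρ := P.dataLaw) hζ (c := c) (b := κ ^ 2 / √lam)
    (V := κ ^ 2 * N) (fun v => ?_) (fun z => ?_) (by positivity) ?_ hm ht ?_ htV hη
  · refine (measure_mono fun z hz => ?_).trans key
    have hz' : τ < √(∑ i ∈ F, ‖D z (b i)‖ ^ 2) := hz
    rw [mem_ofPred_eq]
    refine lt_of_lt_of_eq hz' ?_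
    rw [PiLp.norm_eq_of_L2]
    congr 1
    rw [← Finset.sum_coe_sort F fun i => ‖D z (b i)‖ ^ 2]
    refine Finset.sum_congr rfl fun i _ => ?_
    congr 2
    rw [hD]
    simp [ζ, c]
  · simp only [PiLp.inner_apply]
    rw [integral_finsetSum]
    · refine Finset.sum_congr rfl fun i _ => ?_
      have h1 : ∀ z : X × Y, ⟪v i, (ζ z) i⟫_ℝ = ⟪(W (v i)) z.1, (b i) z.1⟫_ℝ := fun z => by
        simp only [ζ]
        rw [← hW.symm, RKHS.inner_kerFun]
      simp only [h1]
      have hmeas : StronglyMeasurable fun x : X => ⟪(W (v i)) x, (b i) x⟫_ℝ :=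
        (hK.stronglyMeasurable _).inner (hK.stronglyMeasurable _)
      have h2 : P.dataLaw.map Prod.fst = P.ν := Measure.fst_compProd P.ν P.cond
      have h3 := integral_map (μ := P.dataLaw) measurable_fst.aemeasurable
        (f := fun x : X => ⟪(W (v i)) x, (b i) x⟫_ℝ) hmeas.aestronglyMeasurable
      rw [← h3, h2, ← inner_covOp hK, (isPos_covOp hK P.ν).symm, hW.symm]
    · intro i _
      refine Integrable.of_bound (C := ‖v i‖ * (κ / √lam * (κ * ‖b i‖))) ?_ (ae_of_all _ fun z => ?_)
      · exact (stronglyMeasurable_const.inner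
          ((hζi (b i)).comp_measurable measurable_fst)).aestronglyMeasurable
      · refine (norm_inner_le_norm _ _).trans ?_
        gcongr
        refine ((W ∘L RKHS.kerFun G z.1).le_opNorm ((b i) z.1)).trans ?_
        have := hK.nonneg
        gcongr
        · exact hW.norm_comp_kerFun_le _
        · exact hK.norm_apply_le _ _
  · refine le_of_sq_le_sq ((hζn z).trans ?_) (by positivity)
    have := hK.nonneg
    calc κ ^ 2 * ‖W ∘L RKHS.kerFun G z.1‖ ^ 2 ≤ κ ^ 2 * (κ / √lam) ^ 2 := by
          gcongr; exact hW.norm_comp_kerFun_le _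
      _ = (κ ^ 2 / √lam) ^ 2 := by ring
  · have hm1 : Measurable fun x : X => ENNReal.ofReal
        (‖(WithLp.toLp 2 fun i => W (RKHS.kerFun G x ((b i) x)) : PiLp 2 (fun _ : F => G))‖ ^ 2) := by
      simp only [PiLp.norm_sq_eq_of_L2]
      refine (Finset.measurable_fun_sum _ fun i _ => ?_).ennreal_ofReal
      exact (hζi (b i)).norm.measurable.pow_const 2
    obtain ⟨y₀⟩ : Nonempty Y := ⟨0⟩
    calc ∫⁻ z, ENNReal.ofReal (‖ζ z‖ ^ 2) ∂P.dataLaw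
        = ∫⁻ x, ENNReal.ofReal (‖ζ (x, y₀)‖ ^ 2) ∂P.ν := hfst _ hm1
      _ ≤ ∫⁻ x, ENNReal.ofReal (κ ^ 2) * ENNReal.ofReal (‖W ∘L RKHS.kerFun G x‖ ^ 2) ∂P.ν := by
          refine lintegral_mono fun x => ?_
          rw [← ENNReal.ofReal_mul (sq_nonneg _)]
          exact ENNReal.ofReal_le_ofReal (hζn (x, y₀))
      _ = ENNReal.ofReal (κ ^ 2) * ∫⁻ x, ENNReal.ofReal (‖W ∘L RKHS.kerFun G x‖ ^ 2) ∂P.ν :=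
          lintegral_const_mul' _ _ ENNReal.ofReal_ne_top
      _ ≤ ENNReal.ofReal (κ ^ 2) * ENNReal.ofReal N := by
          gcongr
          exact hW.lintegral_norm_sq_comp_kerFun_le hN h
      _ = _ := (ENNReal.ofReal_mul (sq_nonneg _)).symm
  · have h2 : 0 < √lam := Real.sqrt_pos.2 hlam
    rw [show t * (2 * (κ ^ 2 / √lam)) = t * (2 * κ ^ 2) / √lam by ring, div_le_one h2]
    exact htb

end InverseProblem

end ProblemBounds

/-! ### From the energy inequality to the rate -/

/-- The inequalities satisfied by the prediction error `x`, the penalty error `y`, the weak error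
`z` and the errors `t`, `u` in norm of a Tikhonov minimizer relative to a reference point with
prediction error `x0` and error `t0` in norm. -/
structure BasicIneq (p q s α ellA ellL D lam τ R x x0 y z t t0 u : ℝ) : Prop where
  x_nonneg : 0 ≤ x
  x0_nonneg : 0 ≤ x0
  y_nonneg : 0 ≤ y
  z_nonneg : 0 ≤ z
  t_nonneg : 0 ≤ t
  t0_nonneg : 0 ≤ t0
  u_nonneg : 0 ≤ u
  R_nonneg : 0 ≤ R
  τ_nonneg : 0 ≤ τ
  energy : x ^ 2 + lam * y ^ 2 ≤ x0 ^ 2 + τ * (ellA * t) * (x + √lam * (ellA * t)) +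
    τ * (ellA * t0) * (x0 + √lam * (ellA * t0)) + 2 * τ * (x + x0 + √lam * (ellA * u)) +
    2 * lam * R * (z ^ ((q - 1) / (p + 1)) * y ^ (1 - (q - 1) / (p + 1)))
  weak : z ≤ α * (x ^ s + x0 ^ s)
  interpolation : u ≤ z ^ (1 / (p + 1)) * y ^ (1 - 1 / (p + 1))
  lower : ellL * u ≤ y
  triangle : t ≤ u + t0
  t_le : t ≤ D
  t0_le : t0 ≤ D

/-- Either `φ ≤ 2K₁`, or the linear term is absorbed into half of `φ²` and the remaining power can
be divided out because `e < 2`. -/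
theorem le_of_sq_le_add_rpow {φ K₁ K₂ e : ℝ} (hφ : 0 < φ) (he : e < 2)
    (h : φ ^ 2 ≤ K₁ * φ + K₂ * φ ^ e) :
    φ ≤ max (2 * K₁) ((2 * K₂) ^ (1 / (2 - e))) := by
  rcases le_total φ (2 * K₁) with h1 | h1
  · exact h1.trans (le_max_left _ _)
  refine le_trans ?_ (le_max_right _ _)
  have h2 : φ ^ 2 ≤ 2 * K₂ * φ ^ e := by nlinarith
  have h3 : φ ^ (2 - e) ≤ 2 * K₂ := by
    rw [Real.rpow_sub hφ, div_le_iff₀ (by positivity)]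
    exact_mod_cast h2
  have h4 : 0 < 2 - e := by linarith
  calc φ = (φ ^ (2 - e)) ^ (1 / (2 - e)) := by
        rw [← Real.rpow_mul hφ.le, mul_one_div_cancel h4.ne', Real.rpow_one]
    _ ≤ _ := by gcongr

theorem add_add_sq_le (a b c : ℝ) : (a + b + c) ^ 2 ≤ 3 * (a ^ 2 + b ^ 2 + c ^ 2) := by
  nlinarith [sq_nonneg (a - b), sq_nonneg (a - c), sq_nonneg (b - c)]

-- With `F = x + √lam y + μ` and `μ = ℓ lam^ω`, all terms of the energy inequality except the cross
-- term are bounded by multiples of `μF`; in the products quadratic in `t`, one factor is bounded by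
-- `D` and `√lam` times the other by `F`. Dividing by `μ²` leaves an inequality for `F/μ` alone.
set_option maxHeartbeats 1000000 in
theorem BasicIneq.energy_le {p q s α ellA ellL D lam τ R x x0 y z t t0 u ω ℓ c₁ c₂ c₃ c₅ : ℝ}
    (hp : 0 ≤ p) (hs : 0 < s) (hq1 : 1 ≤ q) (hq2 : q ≤ 2 + p) (hqs : q * (s - 1) < p + s)
    (hellL : 0 < ellL) (hellA : 0 ≤ ellA) (hα : 0 < α) (hlam : 0 < lam) (hℓ : 1 ≤ ℓ)
    (hc₁ : 0 ≤ c₁) (hc₂ : 0 ≤ c₂) (hc₃ : 0 ≤ c₃) (hc₅ : 0 ≤ c₅)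
    (hτ : τ ≤ c₁ * (ℓ * lam ^ ω)) (hx0 : x0 ≤ c₂ * lam ^ ω) (ht0 : √lam * t0 ≤ c₃ * lam ^ ω)
    (hR : R * lam ^ ((p + q) / (2 * (p + 1))) ≤
      (c₅ * lam ^ ω) ^ (((p + q) - s * (q - 1)) / (p + 1)))
    (h : BasicIneq p q s α ellA ellL D lam τ R x x0 y z t t0 u) :
    x + √lam * y + ℓ * lam ^ ω ≤ (max (2 * (3 * (1 + c₂ ^ 2 +
        c₁ * (ellA * D) * (1 + ellA * (1 / ellL + c₃)) + c₁ * (ellA * D) * (c₂ + ellA * c₃) +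
        2 * c₁ * (1 + c₂ + ellA / ellL))))
      ((2 * (6 * (α * (1 + c₂ ^ s)) ^ ((q - 1) / (p + 1)) *
        c₅ ^ (((p + q) - s * (q - 1)) / (p + 1)))) ^
          (1 / (2 - (2 - ((p + q) - s * (q - 1)) / (p + 1)))))) * (ℓ * lam ^ ω) := by
  obtain ⟨hx, hx0', hy, hz, ht, ht0', hu, hR0, hτ0, hen, hw, -, hlow, htri, htD, ht0D⟩ := h
  set a := (q - 1) / (p + 1) with ha
  set κ := ((p + q) - s * (q - 1)) / (p + 1) with hκ
  have hp1 : 0 < p + 1 := by linarith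
  have ha0 : 0 ≤ a := div_nonneg (by linarith) hp1.le
  have ha1 : a ≤ 1 := (div_le_one hp1).2 (by linarith)
  have hκ0 : 0 < κ := div_pos (by linarith) hp1
  have hD : 0 ≤ D := ht.trans htD
  set ml := lam ^ ω with hml
  have hml0 : 0 < ml := Real.rpow_pos_of_pos hlam _
  set μ := ℓ * ml with hμ
  have hμ0 : 0 < μ := by positivity
  have hmlμ : ml ≤ μ := le_mul_of_one_le_left hml0.le hℓ
  set sl := √lam with hsl
  have hsl0 : 0 < sl := Real.sqrt_pos.2 hlam
  have hsl2 : sl ^ 2 = lam := Real.sq_sqrt hlam.le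
  set F := x + sl * y + μ with hF
  have hxF : x ≤ F := by have := mul_nonneg hsl0.le hy; linarith
  have hyF : sl * y ≤ F := by linarith
  have hμF : μ ≤ F := by have := mul_nonneg hsl0.le hy; linarith
  have hF0 : 0 < F := hμ0.trans_le hμF
  have hx0μ : x0 ≤ c₂ * μ := hx0.trans (by gcongr)
  have hx0F : x0 ≤ c₂ * F := hx0μ.trans (by gcongr)
  have huF : sl * u ≤ F / ellL := by
    rw [le_div_iff₀ hellL]
    calc sl * u * ellL = sl * (ellL * u) := by ring
      _ ≤ sl * y := by gcongr
      _ ≤ F := hyF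
  have ht0F : sl * t0 ≤ c₃ * F := ht0.trans (by gcongr; linarith)
  have htF : sl * t ≤ (1 / ellL + c₃) * F := by
    calc sl * t ≤ sl * (u + t0) := by gcongr
      _ = sl * u + sl * t0 := by ring
      _ ≤ F / ellL + c₃ * F := add_le_add huF ht0F
      _ = _ := by ring
  have e1 : x0 ^ 2 ≤ c₂ ^ 2 * (μ * F) := by
    calc x0 ^ 2 = x0 * x0 := sq x0
      _ ≤ (c₂ * μ) * (c₂ * F) := by gcongr
      _ = _ := by ring
  have e2 : τ * (ellA * t) * (x + sl * (ellA * t)) ≤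
      c₁ * (ellA * D) * (1 + ellA * (1 / ellL + c₃)) * (μ * F) := by
    calc τ * (ellA * t) * (x + sl * (ellA * t)) = τ * (ellA * t) * (x + ellA * (sl * t)) := by ring
      _ ≤ (c₁ * μ) * (ellA * D) * (F + ellA * ((1 / ellL + c₃) * F)) := by gcongr
      _ = _ := by ring
  have e3 : τ * (ellA * t0) * (x0 + sl * (ellA * t0)) ≤
      c₁ * (ellA * D) * (c₂ + ellA * c₃) * (μ * F) := by
    calc τ * (ellA * t0) * (x0 + sl * (ellA * t0))
        = τ * (ellA * t0) * (x0 + ellA * (sl * t0)) := by ring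
      _ ≤ (c₁ * μ) * (ellA * D) * (c₂ * F + ellA * (c₃ * F)) := by gcongr
      _ = _ := by ring
  have e4 : 2 * τ * (x + x0 + sl * (ellA * u)) ≤
      2 * c₁ * (1 + c₂ + ellA / ellL) * (μ * F) := by
    calc 2 * τ * (x + x0 + sl * (ellA * u)) = 2 * τ * (x + x0 + ellA * (sl * u)) := by ring
      _ ≤ 2 * (c₁ * μ) * (F + c₂ * F + ellA * (F / ellL)) := by gcongr
      _ = _ := by ring
  have hzF : z ≤ α * (1 + c₂ ^ s) * F ^ s := by
    calc z ≤ α * (x ^ s + x0 ^ s) := hw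
      _ ≤ α * (F ^ s + (c₂ * F) ^ s) := by gcongr
      _ = _ := by rw [Real.mul_rpow hc₂ hF0.le]; ring
  have hyF' : y ≤ F / sl := by rw [le_div_iff₀ hsl0]; linarith
  have hA0 : 0 ≤ α * (1 + c₂ ^ s) := by positivity
  -- Here `z ≲ F^s` and `y ≤ F/√lam`. The assumption on `R` converts the power of `lam` left over
  -- into `μ^κ`.
  have e5 : 2 * lam * R * (z ^ a * y ^ (1 - a)) ≤
      2 * (α * (1 + c₂ ^ s)) ^ a * (c₅ ^ κ * (μ ^ κ * F ^ (2 - κ))) := by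
    have hslp : ∀ c : ℝ, sl ^ c = lam ^ (c / 2) := fun c => by
      rw [hsl, Real.sqrt_eq_rpow, ← Real.rpow_mul hlam.le]; congr 1; ring
    have h1 : lam / sl ^ (1 - a) = lam ^ ((p + q) / (2 * (p + 1))) := by
      rw [hslp]
      nth_rewrite 1 [← Real.rpow_one lam]
      rw [← Real.rpow_sub hlam, ha]
      congr 1
      field_simp
      ring
    have h2 : (F ^ s) ^ a * F ^ (1 - a) = F ^ (2 - κ) := by
      rw [← Real.rpow_mul hF0.le, ← Real.rpow_add hF0, ha, hκ]
      congr 1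
      field_simp
      ring
    calc 2 * lam * R * (z ^ a * y ^ (1 - a))
        ≤ 2 * lam * R * ((α * (1 + c₂ ^ s) * F ^ s) ^ a * (F / sl) ^ (1 - a)) := by
          gcongr
      _ = 2 * (α * (1 + c₂ ^ s)) ^ a * (R * (lam / sl ^ (1 - a))) *
            ((F ^ s) ^ a * F ^ (1 - a)) := by
          rw [Real.mul_rpow hA0 (by positivity), Real.div_rpow hF0.le hsl0.le]
          ring
      _ ≤ 2 * (α * (1 + c₂ ^ s)) ^ a * (c₅ ^ κ * μ ^ κ) * F ^ (2 - κ) := by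
          rw [h1, h2]
          have h3 : R * lam ^ ((p + q) / (2 * (p + 1))) ≤ c₅ ^ κ * μ ^ κ := by
            rw [← Real.mul_rpow hc₅ hμ0.le]
            exact hR.trans (by gcongr)
          exact mul_le_mul_of_nonneg_right (mul_le_mul_of_nonneg_left h3 (by positivity))
            (by positivity)
      _ = _ := by ring
  have hF2 : F ^ 2 ≤ 3 * (x ^ 2 + lam * y ^ 2 + μ ^ 2) := by
    have : lam * y ^ 2 = (sl * y) ^ 2 := by rw [mul_pow, hsl2]
    rw [this, hF]
    exact add_add_sq_le x (sl * y) μ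
  have e6 : μ ^ 2 ≤ 1 * (μ * F) := by rw [one_mul, sq]; gcongr
  set K₁ := 3 * (1 + c₂ ^ 2 +
        c₁ * (ellA * D) * (1 + ellA * (1 / ellL + c₃)) + c₁ * (ellA * D) * (c₂ + ellA * c₃) +
        2 * c₁ * (1 + c₂ + ellA / ellL)) with hK₁
  set K₂ := 6 * (α * (1 + c₂ ^ s)) ^ a * c₅ ^ κ with hK₂
  have hfin : F ^ 2 ≤ K₁ * (μ * F) + K₂ * (μ ^ κ * F ^ (2 - κ)) := by
    calc F ^ 2 ≤ 3 * (x ^ 2 + lam * y ^ 2 + μ ^ 2) := hF2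
      _ ≤ 3 * (c₂ ^ 2 * (μ * F) + c₁ * (ellA * D) * (1 + ellA * (1 / ellL + c₃)) * (μ * F) +
            c₁ * (ellA * D) * (c₂ + ellA * c₃) * (μ * F) +
            2 * c₁ * (1 + c₂ + ellA / ellL) * (μ * F) +
            2 * (α * (1 + c₂ ^ s)) ^ a * (c₅ ^ κ * (μ ^ κ * F ^ (2 - κ))) + 1 * (μ * F)) := by
          linarith
      _ = _ := by rw [hK₁, hK₂]; ring
  have hφ : (F / μ) ^ 2 ≤ K₁ * (F / μ) + K₂ * (F / μ) ^ (2 - κ) := by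
    have h1 : μ ^ κ * F ^ (2 - κ) = μ ^ 2 * (F / μ) ^ (2 - κ) := by
      rw [Real.div_rpow hF0.le hμ0.le, Real.rpow_sub hμ0]
      have : 0 < μ ^ κ := by positivity
      norm_cast
      field_simp
    rw [h1] at hfin
    have h2 : μ ^ 2 * (F / μ) ^ 2 = F ^ 2 := by field_simp
    have h3 : μ ^ 2 * (F / μ) = μ * F := by field_simp
    have h4 : μ ^ 2 * (F / μ) ^ 2 ≤ μ ^ 2 * (K₁ * (F / μ) + K₂ * (F / μ) ^ (2 - κ)) := by
      rw [h2]
      calc F ^ 2 ≤ _ := hfin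
        _ = _ := by rw [← h3]; ring
    exact le_of_mul_le_mul_left h4 (by positivity)
  have := le_of_sq_le_add_rpow (div_pos hF0 hμ0) (by linarith : 2 - κ < 2) hφ
  rwa [div_le_iff₀ hμ0] at this

/-- The norm error is interpolated between `z ≲ (ℓ lam^ω)^s` and `y ≲ ℓ lam^ω / √lam` with weights
`1/(p+1)` and `p/(p+1)`. This produces both the rate and the logarithmic exponent `(p+s)/(p+1)`; the
maximum with `1` is a common upper bound. -/
theorem BasicIneq.exists_bound {p q s α ellA ellL : ℝ} (D ω c₁ c₂ c₃ c₄ c₅ : ℝ)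
    (hp : 0 ≤ p) (hs : 0 < s) (hq1 : 1 ≤ q) (hq2 : q ≤ 2 + p) (hqs : q * (s - 1) < p + s)
    (hellL : 0 < ellL) (hellA : 0 ≤ ellA) (hα : 0 < α)
    (hc₁ : 0 ≤ c₁) (hc₂ : 0 ≤ c₂) (hc₃ : 0 ≤ c₃) (hc₅ : 0 ≤ c₅) :
    ∃ C > 0, ∀ lam ℓ τ R x x0 y z t t0 u : ℝ, 0 < lam → 1 ≤ ℓ →
      τ ≤ c₁ * (ℓ * lam ^ ω) → x0 ≤ c₂ * lam ^ ω → √lam * t0 ≤ c₃ * lam ^ ω →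
      t0 ≤ c₄ * lam ^ ((2 * ω * (s + p) - p) / (2 * (p + 1))) →
      R * lam ^ ((p + q) / (2 * (p + 1))) ≤
        (c₅ * lam ^ ω) ^ (((p + q) - s * (q - 1)) / (p + 1)) →
      BasicIneq p q s α ellA ellL D lam τ R x x0 y z t t0 u →
      t ≤ C * lam ^ ((2 * ω * (s + p) - p) / (2 * (p + 1))) * ℓ ^ max 1 ((p + s) / (p + 1)) := by
  obtain ⟨K', key⟩ : ∃ K', ∀ lam ℓ τ R x x0 y z t t0 u : ℝ, 0 < lam → 1 ≤ ℓ →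
      τ ≤ c₁ * (ℓ * lam ^ ω) → x0 ≤ c₂ * lam ^ ω → √lam * t0 ≤ c₃ * lam ^ ω →
      R * lam ^ ((p + q) / (2 * (p + 1))) ≤
        (c₅ * lam ^ ω) ^ (((p + q) - s * (q - 1)) / (p + 1)) →
      BasicIneq p q s α ellA ellL D lam τ R x x0 y z t t0 u →
      x + √lam * y + ℓ * lam ^ ω ≤ K' * (ℓ * lam ^ ω) :=
    ⟨_, fun _ _ _ _ _ _ _ _ _ _ _ hlam hℓ h1 h2 h3 h4 h5 =>
      h5.energy_le hp hs hq1 hq2 hqs hellL hellA hα hlam hℓ hc₁ hc₂ hc₃ hc₅ h1 h2 h3 h4⟩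
  set K := max K' 0
  have hK0 : 0 ≤ K := le_max_right _ _
  set E := (2 * ω * (s + p) - p) / (2 * (p + 1)) with hE
  set a := 1 / (p + 1) with ha
  have hp1 : 0 < p + 1 := by linarith
  have ha0 : 0 < a := by positivity
  have ha1 : a ≤ 1 := (div_le_one hp1).2 (by linarith)
  refine ⟨(α * (K ^ s + c₂ ^ s)) ^ a * K ^ (1 - a) + max c₄ 0 + 1, ?_, ?_⟩
  · have : 0 ≤ (α * (K ^ s + c₂ ^ s)) ^ a * K ^ (1 - a) := by positivity
    linarith [le_max_right c₄ 0]
  intro lam ℓ τ R x x0 y z t t0 u hlam hℓ hτ hx0 ht0 ht0' hR h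
  have hen := key lam ℓ τ R x x0 y z t t0 u hlam hℓ hτ hx0 ht0 hR h
  set ml := lam ^ ω with hml
  have hml0 : 0 < ml := Real.rpow_pos_of_pos hlam _
  have hsl0 : 0 < √lam := Real.sqrt_pos.2 hlam
  have hℓ0 : 0 < ℓ := by linarith
  have hμ0 : 0 < ℓ * ml := by positivity
  have hen' : x + √lam * y ≤ K * (ℓ * ml) := by
    have : K' * (ℓ * ml) ≤ K * (ℓ * ml) := by gcongr; exact le_max_left _ _
    linarith
  have hx : x ≤ K * (ℓ * ml) := by linarith [mul_nonneg hsl0.le h.y_nonneg]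
  have hy : y ≤ K * (ℓ * ml) / √lam := by
    rw [le_div_iff₀ hsl0]; linarith [h.x_nonneg]
  have hx0' : x0 ≤ c₂ * (ℓ * ml) := hx0.trans (by gcongr; exact le_mul_of_one_le_left hml0.le hℓ)
  have hxn := h.x_nonneg
  have hx0n := h.x0_nonneg
  have hzn := h.z_nonneg
  have hyn := h.y_nonneg
  have hz : z ≤ α * (K ^ s + c₂ ^ s) * (ℓ * ml) ^ s := by
    calc z ≤ α * (x ^ s + x0 ^ s) := h.weak
      _ ≤ α * ((K * (ℓ * ml)) ^ s + (c₂ * (ℓ * ml)) ^ s) := by gcongr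
      _ = _ := by rw [Real.mul_rpow hK0 hμ0.le, Real.mul_rpow hc₂ hμ0.le]; ring
  have hpow : (ℓ * ml) ^ (s * a) * ((ℓ * ml) / √lam) ^ (1 - a) =
      ℓ ^ ((p + s) / (p + 1)) * lam ^ E := by
    rw [Real.div_rpow hμ0.le hsl0.le, ← mul_div_assoc, ← Real.rpow_add hμ0,
      Real.mul_rpow hℓ0.le hml0.le, hml, ← Real.rpow_mul hlam.le, Real.sqrt_eq_rpow,
      ← Real.rpow_mul hlam.le, mul_div_assoc, ← Real.rpow_sub hlam]
    congr 2
    · rw [ha]; field_simp; ring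
    · rw [ha, hE]; field_simp; ring
  have hu : u ≤ (α * (K ^ s + c₂ ^ s)) ^ a * K ^ (1 - a) *
      (ℓ ^ ((p + s) / (p + 1)) * lam ^ E) := by
    calc u ≤ z ^ a * y ^ (1 - a) := h.interpolation
      _ ≤ (α * (K ^ s + c₂ ^ s) * (ℓ * ml) ^ s) ^ a * (K * ((ℓ * ml) / √lam)) ^ (1 - a) := by
          rw [mul_div_assoc] at hy
          gcongr
      _ = (α * (K ^ s + c₂ ^ s)) ^ a * K ^ (1 - a) *
            ((ℓ * ml) ^ (s * a) * ((ℓ * ml) / √lam) ^ (1 - a)) := by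
          rw [Real.mul_rpow (by positivity) (by positivity), Real.mul_rpow hK0 (by positivity),
            ← Real.rpow_mul hμ0.le]
          ring
      _ = _ := by rw [hpow]
  set mx := max 1 ((p + s) / (p + 1)) with hmx
  have hℓ1 : ℓ ^ ((p + s) / (p + 1)) ≤ ℓ ^ mx := Real.rpow_le_rpow_of_exponent_le hℓ (le_max_right _ _)
  have hℓ2 : 1 ≤ ℓ ^ mx := Real.one_le_rpow hℓ (zero_le_one.trans (le_max_left _ _))
  have hE0 : 0 < lam ^ E := Real.rpow_pos_of_pos hlam _
  have hA : 0 ≤ (α * (K ^ s + c₂ ^ s)) ^ a * K ^ (1 - a) := by positivity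
  have hc₄ : 0 ≤ max c₄ 0 := le_max_right _ _
  calc t ≤ u + t0 := h.triangle
    _ ≤ (α * (K ^ s + c₂ ^ s)) ^ a * K ^ (1 - a) * (ℓ ^ mx * lam ^ E) +
          max c₄ 0 * (ℓ ^ mx * lam ^ E) := by
        refine add_le_add (hu.trans (by gcongr)) (ht0'.trans ?_)
        gcongr
        · exact le_max_left _ _
        · exact le_mul_of_one_le_left hE0.le hℓ2
    _ ≤ _ := by linarith [mul_pos (by linarith : 0 < ℓ ^ mx) hE0]

/-! ### The error of a Tikhonov minimizer on the good event -/

section Deterministic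

variable {X Y H G : Type*} [MeasurableSpace X]
  [NormedAddCommGroup Y] [InnerProductSpace ℝ Y] [CompleteSpace Y]
  [TopologicalSpace.SeparableSpace Y] [MeasurableSpace Y] [BorelSpace Y]
  [NormedAddCommGroup H] [InnerProductSpace ℝ H] [CompleteSpace H]
  [NormedAddCommGroup G] [InnerProductSpace ℝ G] [CompleteSpace G] [RKHS ℝ G X Y]
  {κ lam τ : ℝ} {hK : KernelCondition (X := X) (Y := Y) G κ} {W : G →L[ℝ] G}

omit [MeasurableSpace Y] [BorelSpace Y] in
theorem IsInvSqrt.exists_preimage {ν : Measure X} [IsProbabilityMeasure ν] (hlam : 0 ≤ lam)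
    (hW : IsInvSqrt (covOp hK ν) lam W) (g : G) :
    ∃ v, W v = g ∧ ‖v‖ ≤ ‖embL2 hK ν g‖ + √lam * ‖g‖ := by
  obtain ⟨v, hv, hvn⟩ := hW.exists_sqrt g
  refine ⟨v, hv, le_of_sq_le_sq ?_ (by positivity)⟩
  rw [hvn, inner_covOp_self, add_sq, mul_pow, Real.sq_sqrt hlam]
  have : 0 ≤ 2 * ‖embL2 hK ν g‖ * (√lam * ‖g‖) := by positivity
  linarith

-- Writing `g = W v` with `v = (T + lam)^{1/2} g` moves the preconditioner onto the random sum; the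
-- price is `‖v‖ ≤ ‖I_ν g‖ + √lam ‖g‖`.
omit [MeasurableSpace Y] [BorelSpace Y] in
theorem IsInvSqrt.abs_sum_norm_sq_sub_le {ν : Measure X} [IsProbabilityMeasure ν] (hlam : 0 ≤ lam)
    (hW : IsInvSqrt (covOp hK ν) lam W) {m : ℕ} {x : Fin m → X} {c : ℝ}
    (hC : ∀ g : G, ‖∑ i, (W (RKHS.kerFun G (x i) (g (x i))) - W (covOp hK ν g))‖ ≤ c * ‖g‖)
    (g : G) : |∑ i, ‖g (x i)‖ ^ 2 - m * ‖embL2 hK ν g‖ ^ 2| ≤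
      c * ‖g‖ * (‖embL2 hK ν g‖ + √lam * ‖g‖) := by
  obtain ⟨v, hv, hvn⟩ := hW.exists_preimage hlam g
  have h1 : ∑ i, ‖g (x i)‖ ^ 2 - m * ‖embL2 hK ν g‖ ^ 2 =
      ⟪∑ i, (W (RKHS.kerFun G (x i) (g (x i))) - W (covOp hK ν g)), v⟫_ℝ := by
    rw [sum_inner]
    simp only [inner_sub_left, hW.symm, hv, RKHS.kerFun_inner, inner_covOp_self,
      real_inner_self_eq_norm_sq]
    simp
  rw [h1]
  refine (abs_real_inner_le_norm _ _).trans ?_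
  exact mul_le_mul (hC g) hvn (norm_nonneg _) ((norm_nonneg _).trans (hC g))

omit [MeasurableSpace Y] [BorelSpace Y] in
theorem IsInvSqrt.abs_sum_inner_le {ν : Measure X} [IsProbabilityMeasure ν] (hlam : 0 ≤ lam)
    (hW : IsInvSqrt (covOp hK ν) lam W) {m : ℕ} {x : Fin m → X} {ε : Fin m → Y} {c : ℝ}
    (hN : ‖∑ i, W (RKHS.kerFun G (x i) (ε i))‖ ≤ c) (g : G) :
    |∑ i, ⟪g (x i), ε i⟫_ℝ| ≤ c * (‖embL2 hK ν g‖ + √lam * ‖g‖) := by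
  obtain ⟨v, hv, hvn⟩ := hW.exists_preimage hlam g
  have h1 : ∑ i, ⟪g (x i), ε i⟫_ℝ = ⟪∑ i, W (RKHS.kerFun G (x i) (ε i)), v⟫_ℝ := by
    rw [sum_inner]
    simp only [hW.symm, hv, RKHS.kerFun_inner, real_inner_comm]
  rw [h1]
  exact (abs_real_inner_le_norm _ _).trans
    (mul_le_mul hN hvn (norm_nonneg _) ((norm_nonneg _).trans hN))

namespace InverseProblem

variable {P : InverseProblem X Y H G} {p q s α ellA ellL D R : ℝ}

theorem sum_norm_residual_sq {m : ℕ} (z : Fin m → X × Y) (f : H) :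
    ∑ i, ‖P.A f (z i).1 - (z i).2‖ ^ 2 =
      ∑ i, ‖(P.A f - P.A P.fhat) (z i).1‖ ^ 2 -
        2 * ∑ i, ⟪(P.A f - P.A P.fhat) (z i).1, (z i).2 - P.A P.fhat (z i).1⟫_ℝ +
        ∑ i, ‖(z i).2 - P.A P.fhat (z i).1‖ ^ 2 := by
  rw [Finset.mul_sum, ← Finset.sum_sub_distrib, ← Finset.sum_add_distrib]
  refine Finset.sum_congr rfl fun i _ => ?_
  rw [← norm_sub_sq_real, RKHS.coe_sub, Pi.sub_apply]
  congr 2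
  abel

/-- Both residuals are expanded around the noise, whose square cancels. Empirical norms are replaced
by `L²` norms through the covariance deviation, the mixed sums are bounded by the noise event, and
the penalty is expanded around `f0`. -/
theorem energy_of_isTikhonovMinimizer {m : ℕ} (hm : 1 ≤ m) (hlam : 0 < lam)
    (hW : IsInvSqrt (covOp hK P.ν) lam W) {z : Fin m → X × Y}
    (hN : ‖∑ i, W (RKHS.kerFun G (z i).1 ((z i).2 - P.A P.fhat (z i).1))‖ ≤ m * τ)
    (hC : ∀ g : G, ‖∑ i, (W (RKHS.kerFun G (z i).1 (g (z i).1)) - W (covOp hK P.ν g))‖ ≤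
      m * τ * ‖g‖) {f f0 : P.L.domain} (hf : P.IsTikhonovMinimizer z lam f)
    (hf0 : (f0 : H) ∈ P.dom) :
    P.predDist hK f ^ 2 + lam * ‖P.L (f - f0)‖ ^ 2 ≤ P.predDist hK f0 ^ 2 +
      τ * ‖P.A f - P.A P.fhat‖ * (P.predDist hK f + √lam * ‖P.A f - P.A P.fhat‖) +
      τ * ‖P.A f0 - P.A P.fhat‖ * (P.predDist hK f0 + √lam * ‖P.A f0 - P.A P.fhat‖) +
      2 * τ * (P.predDist hK f + P.predDist hK f0 + √lam * ‖P.A f - P.A f0‖) +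
      2 * lam * |⟪P.L (f - f0), P.L (f0 - P.fbar)⟫_ℝ| := by
  have hm0 : (0 : ℝ) < m := by exact_mod_cast hm
  have hmin := hf.2 f0 hf0
  unfold tikhonov at hmin
  rw [sum_norm_residual_sq, sum_norm_residual_sq] at hmin
  set g := P.A f - P.A P.fhat with hg
  set g0 := P.A f0 - P.A P.fhat with hg0
  have hgg : P.A f - P.A f0 = g - g0 := by rw [hg, hg0]; abel
  have e1 := (abs_le.1 (hW.abs_sum_norm_sq_sub_le hlam.le hC g)).1
  have e2 := (abs_le.1 (hW.abs_sum_norm_sq_sub_le hlam.le hC g0)).2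
  have e3 := (abs_le.1 (hW.abs_sum_inner_le hlam.le hN (g - g0))).2
  have e4 : ∑ i, ⟪(g - g0) (z i).1, (z i).2 - P.A P.fhat (z i).1⟫_ℝ =
      ∑ i, ⟪g (z i).1, (z i).2 - P.A P.fhat (z i).1⟫_ℝ -
        ∑ i, ⟪g0 (z i).1, (z i).2 - P.A P.fhat (z i).1⟫_ℝ := by
    rw [← Finset.sum_sub_distrib]
    simp only [RKHS.coe_sub, Pi.sub_apply, inner_sub_left]
  have e5 : ‖P.L (f - P.fbar)‖ ^ 2 = ‖P.L (f - f0)‖ ^ 2 +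
      2 * ⟪P.L (f - f0), P.L (f0 - P.fbar)⟫_ℝ + ‖P.L (f0 - P.fbar)‖ ^ 2 := by
    rw [← norm_add_sq_real, ← LinearPMap.map_add, sub_add_sub_cancel]
  have e6 : ‖embL2 hK P.ν (g - g0)‖ ≤ ‖embL2 hK P.ν g‖ + ‖embL2 hK P.ν g0‖ := by
    rw [map_sub]; exact norm_sub_le _ _
  have e7 := neg_abs_le ⟪P.L (f - f0), P.L (f0 - P.fbar)⟫_ℝ
  have hτ : 0 ≤ m * τ := (norm_nonneg _).trans hN
  change ‖embL2 hK P.ν g‖ ^ 2 + _ ≤ ‖embL2 hK P.ν g0‖ ^ 2 +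
    τ * ‖g‖ * (‖embL2 hK P.ν g‖ + √lam * ‖g‖) + τ * ‖g0‖ * (‖embL2 hK P.ν g0‖ + √lam * ‖g0‖) +
    2 * τ * (‖embL2 hK P.ν g‖ + ‖embL2 hK P.ν g0‖ + √lam * ‖P.A f - P.A f0‖) + _
  rw [hgg]
  rw [e5] at hmin
  have e8 := mul_le_mul_of_nonneg_left e6 hτ
  have e9 := mul_le_mul_of_nonneg_left e7 (by positivity : 0 ≤ m * lam)
  refine le_of_mul_le_mul_left ?_ hm0
  have hmin' := mul_le_mul_of_nonneg_left hmin hm0.le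
  have hcl : ∀ a c : ℝ, m * (1 / (m : ℝ) * a + c) = a + m * c := fun a c => by field_simp
  rw [hcl, hcl] at hmin'
  linarith

theorem basicIneq_of_isTikhonovMinimizer {m : ℕ} (hm : 1 ≤ m) (hlam : 0 < lam)
    (hp : 0 ≤ p) (hq1 : 1 ≤ q) (hq2 : q ≤ 2 + p) (hellL : 0 < ellL) (hellA : 0 ≤ ellA)
    (hL : IsScaleGenerator P.L ellL) (hOp : P.OperatorCondition ellA D) (hfh : P.fhat ∈ P.dom)
    (hD : 0 ≤ D) (hW : IsInvSqrt (covOp hK P.ν) lam W) {z : Fin m → X × Y}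
    (hN : ‖∑ i, W (RKHS.kerFun G (z i).1 ((z i).2 - P.A P.fhat (z i).1))‖ ≤ m * τ)
    (hC : ∀ g : G, ‖∑ i, (W (RKHS.kerFun G (z i).1 (g (z i).1)) - W (covOp hK P.ν g))‖ ≤
      m * τ * ‖g‖) {f f0 : P.L.domain} (hf : P.IsTikhonovMinimizer z lam f)
    (hf0 : (f0 : H) ∈ P.dom) (hfD : (f : H) ∈ Metric.closedBall P.fhat D)
    (hf0D : (f0 : H) ∈ Metric.closedBall P.fhat D) {v : H}
    (hv : (f0 : H) - P.fbar = negPow P.L q v) (hvR : ‖v‖ ≤ R)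
    (hst : ‖negPow P.L p (f - P.fhat)‖ ≤ α * P.predDist hK f ^ s)
    (hst0 : ‖negPow P.L p (f0 - P.fhat)‖ ≤ α * P.predDist hK f0 ^ s) :
    BasicIneq p q s α ellA ellL D lam τ R (P.predDist hK f) (P.predDist hK f0)
      ‖P.L (f - f0)‖ ‖negPow P.L p ((f : H) - f0)‖ ‖(f : H) - P.fhat‖ ‖(f0 : H) - P.fhat‖
      ‖(f : H) - f0‖ := by
  have hm0 : (0 : ℝ) < m := by exact_mod_cast hm
  have hτ : 0 ≤ τ := nonneg_of_mul_nonneg_right ((norm_nonneg _).trans hN) hm0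
  have hp1 : 0 < p + 1 := by linarith
  have hR : 0 ≤ R := (norm_nonneg _).trans hvR
  have hfhD : P.fhat ∈ Metric.closedBall P.fhat D := Metric.mem_closedBall_self hD
  have hg : ‖P.A f - P.A P.fhat‖ ≤ ellA * ‖(f : H) - P.fhat‖ :=
    hOp.lipschitz _ ⟨hfD, hf.1⟩ _ ⟨hfhD, hfh⟩
  have hg0 : ‖P.A f0 - P.A P.fhat‖ ≤ ellA * ‖(f0 : H) - P.fhat‖ :=
    hOp.lipschitz _ ⟨hf0D, hf0⟩ _ ⟨hfhD, hfh⟩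
  have hgg : ‖P.A f - P.A f0‖ ≤ ellA * ‖(f : H) - f0‖ :=
    hOp.lipschitz _ ⟨hfD, hf.1⟩ _ ⟨hf0D, hf0⟩
  set w := P.L (f - f0) with hw
  have hBw : (f : H) - f0 = negPow P.L 1 w := by
    rw [hL.negPow_one hellL, hw, (hL.invOp_spec hellL).1]
    rfl
  have hzw : negPow P.L p ((f : H) - f0) = negPow P.L (p + 1) w := by
    rw [hBw, hL.negPow_negPow hellL hp zero_le_one]
  have hLv : P.L (f0 - P.fbar) = negPow P.L (q - 1) v := by
    obtain ⟨h, hh1, hh2⟩ := hL.exists_domain hellL (negPow P.L (q - 1) v)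
    have : f0 - P.fbar = h := by
      refine Subtype.ext ?_
      rw [hh1, ← hL.negPow_one hellL, hL.negPow_negPow hellL zero_le_one (by linarith),
        add_sub_cancel, ← hv]
      rfl
    rw [this, hh2]
  -- `L^{-(q-1)}` moves from `v` to `w`; since `0 ≤ q - 1 ≤ p + 1`, it is interpolated between `w`
  -- and `L^{-(p+1)} w = L^{-p}(f - f0)`.
  have hcross : |⟪w, P.L (f0 - P.fbar)⟫_ℝ| ≤
      R * (‖negPow P.L p ((f : H) - f0)‖ ^ ((q - 1) / (p + 1)) *
        ‖w‖ ^ (1 - (q - 1) / (p + 1))) := by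
    rw [hLv, ← hL.negPow_symm hellL (by linarith), hzw, mul_comm R]
    refine (abs_real_inner_le_norm _ _).trans ?_
    gcongr
    exact hL.negPow_interpolation hellL (by linarith) (by linarith) w
  have hx : 0 ≤ P.predDist hK f := norm_nonneg _
  have hx0 : 0 ≤ P.predDist hK f0 := norm_nonneg _
  refine ⟨hx, hx0, norm_nonneg _, norm_nonneg _, norm_nonneg _, norm_nonneg _, norm_nonneg _, hR,
    hτ, ?_, ?_, ?_, ?_, norm_sub_le_norm_sub_add_norm_sub _ _ _, ?_, ?_⟩
  · refine (energy_of_isTikhonovMinimizer hm hlam hW hN hC hf hf0).trans ?_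
    rw [mul_assoc (2 * lam) R]
    gcongr
  · have h1 : (f : H) - f0 = (f - P.fhat) - (f0 - P.fhat) := by abel
    rw [h1, map_sub, mul_add]
    exact (norm_sub_le _ _).trans (add_le_add hst hst0)
  · rw [hzw, hBw]
    exact hL.negPow_interpolation hellL zero_le_one (by linarith) w
  · exact hL.bounded_below (f - f0)
  · rwa [← dist_eq_norm]
  · rwa [← dist_eq_norm]

variable [TopologicalSpace.SeparableSpace G] {N M Sig b : ℝ}

theorem errorBound_of_basicIneq {Q : Set H} {m : ℕ} (hm : 1 ≤ m) (hlam : 0 < lam)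
    (hp : 0 ≤ p) (hq1 : 1 ≤ q) (hq2 : q ≤ 2 + p) (hellL : 0 < ellL) (hellA : 0 ≤ ellA)
    (hM : 0 < M) (hD : 0 ≤ D)
    (hL : IsScaleGenerator P.L ellL) (hTrue : P.TrueSolution) (hnoise : P.NoiseCondition M Sig)
    (hOp : P.OperatorCondition ellA D) (hQD : Q ⊆ Metric.closedBall P.fhat D)
    (hstab : ∀ f ∈ Q, ‖negPow P.L p (f - P.fhat)‖ ≤ α * P.predDist hK f ^ s)
    (hN : 0 ≤ N) (heff : effDim (covOp hK P.ν) lam ≤ ENNReal.ofReal N)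
    {Λ : ℝ} (hΛ : 0 < Λ) (hΛ1 : κ * M ≤ √lam * Λ) (hΛ2 : 2 * κ ^ 2 ≤ √lam * Λ)
    (hΛ3 : m * (N * Sig ^ 2) ≤ Λ ^ 2) (hΛ4 : m * (κ ^ 2 * N) ≤ Λ ^ 2)
    {η : ℝ} (hη : 0 < η) (hη1 : η < 1) {f0 v : H}
    (hf0 : f0 ∈ P.dom) (hf0D : f0 ∈ Metric.closedBall P.fhat D)
    (hv : f0 - P.fbar = negPow P.L q v) (hvR : ‖v‖ ≤ R)
    (hst0 : ‖negPow P.L p (f0 - P.fhat)‖ ≤ α * P.predDist hK f0 ^ s) {B : ℝ}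
    (hB : ∀ x y z t u : ℝ, BasicIneq p q s α ellA ellL D lam
      (Λ * (1 + Real.log (4 / η)) / m) R x (P.predDist hK f0) y z t ‖f0 - P.fhat‖ u → t ≤ B) :
    P.ErrorBound Q m lam η B := by
  have hm0 : (0 : ℝ) < m := by exact_mod_cast hm
  obtain ⟨W, hW⟩ := exists_isInvSqrt_covOp hK P.ν hlam
  have hT : 1 / Λ * Λ = 1 := by field_simp
  have hT2 : ∀ c : ℝ, c ≤ Λ ^ 2 → (1 / Λ) ^ 2 * c ≤ 1 := fun c hc => by
    rw [div_pow, one_pow, div_mul_eq_mul_div, div_le_one (by positivity), one_mul]; exact hc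
  have hT1 : ∀ c : ℝ, c ≤ √lam * Λ → 1 / Λ * c ≤ √lam := fun c hc => by
    rw [div_mul_eq_mul_div, div_le_iff₀ hΛ, one_mul]; exact hc
  have hbad1 := measure_norm_noise_gt_le hTrue hM hN hnoise hW hlam heff hm (one_div_pos.2 hΛ)
    (hT1 _ hΛ1) (by linarith [hT2 _ hΛ3]) hη
  have hbad2 := measure_covariance_deviation_le (P := P) hN hW hlam heff hm (one_div_pos.2 hΛ)
    (hT1 _ hΛ2) (by linarith [hT2 _ hΛ4]) hη hη1
  rw [one_div_one_div] at hbad1 hbad2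
  set bad := {z : Fin m → X × Y | Λ * (1 + Real.log (4 / η)) <
      ‖∑ i, W (RKHS.kerFun G (z i).1 ((z i).2 - P.A P.fhat (z i).1))‖} ∪
    {z | ¬ ∀ g : G, ‖∑ i, (W (RKHS.kerFun G (z i).1 (g (z i).1)) - W (covOp hK P.ν g))‖ ≤
        Λ * (1 + Real.log (4 / η)) * ‖g‖} with hbad
  set μ := Measure.pi fun _ : Fin m => P.dataLaw
  have hmb : μ bad ≤ ENNReal.ofReal η := by
    refine (measure_union_le _ _).trans ((add_le_add hbad1 hbad2).trans (le_of_eq ?_))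
    rw [← ENNReal.ofReal_add (by positivity) (by positivity), add_halves]
  -- A measurable hull is used, so measurability of the bad event itself is not required.
  refine ⟨(toMeasurable μ bad)ᶜ, (measurableSet_toMeasurable _ _).compl, ?_, ?_⟩
  · rw [prob_compl_eq_one_sub (measurableSet_toMeasurable _ _), measure_toMeasurable,
      ENNReal.ofReal_sub _ hη.le, ENNReal.ofReal_one]
    exact tsub_le_tsub_left hmb 1
  · intro z hz f hf hfQ
    have hz' : z ∉ bad := fun h => hz (subset_toMeasurable μ bad h)
    rw [hbad, mem_union, not_or] at hz'
    have h1 : ‖∑ i, W (RKHS.kerFun G (z i).1 ((z i).2 - P.A P.fhat (z i).1))‖ ≤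
        m * (Λ * (1 + Real.log (4 / η)) / m) := by
      rw [mul_div_cancel₀ _ hm0.ne']
      exact not_lt.1 hz'.1
    have h2 : ∀ g : G, ‖∑ i, (W (RKHS.kerFun G (z i).1 (g (z i).1)) - W (covOp hK P.ν g))‖ ≤
        m * (Λ * (1 + Real.log (4 / η)) / m) * ‖g‖ := by
      rw [mul_div_cancel₀ _ hm0.ne']
      exact not_not.1 hz'.2
    have hf0L : f0 ∈ P.L.domain := by
      obtain ⟨h, hh, -⟩ := hL.exists_domain hellL (negPow P.L (q - 1) v)
      rw [← hL.negPow_one hellL, hL.negPow_negPow hellL zero_le_one (by linarith),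
        add_sub_cancel, ← hv] at hh
      have h3 := P.L.domain.add_mem h.2 P.fbar.2
      rwa [hh, sub_add_cancel] at h3
    exact hB _ _ _ _ _ (basicIneq_of_isTikhonovMinimizer (f0 := ⟨f0, hf0L⟩) hm hlam hp hq1 hq2
      hellL hellA hL hOp (interior_subset hTrue.mem_interior) hD hW h1 h2 hf hf0 (hQD hfQ) hf0D hv
      hvR (hstab _ hfQ) hst0)

end InverseProblem

end Deterministic

/-! ### The choice of the regularization parameter -/

section Parameter

variable {κ M Sig CN b ω c lam : ℝ} {m : ℕ}

theorem parameter_bounds (hm : 1 ≤ m) (hωb : 0 < 2 * ω + b)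
    (hlam : lam = (m : ℝ) ^ (-(1 / (2 * ω + b)))) :
    0 < lam ∧ lam ≤ 1 ∧ 1 / (m : ℝ) = lam ^ (2 * ω + b) := by
  have hm1 : (1 : ℝ) ≤ m := by exact_mod_cast hm
  have hm0 : (0 : ℝ) < m := by linarith
  refine ⟨hlam ▸ Real.rpow_pos_of_pos hm0 _, ?_, ?_⟩
  · rw [hlam]
    refine Real.rpow_le_one_of_one_le_of_nonpos hm1 ?_
    have : 0 < 1 / (2 * ω + b) := by positivity
    linarith
  · rw [hlam, ← Real.rpow_mul hm0.le, neg_mul, one_div_mul_cancel hωb.ne', Real.rpow_neg_one,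
      one_div]

/-- `Λ = 1/t` must exceed both a range term of order `1/√lam` and a variance term of order `√(m N)`;
their sum works. After division by `m` the variance term is of order `lam^ω` because `1/m =
lam^{2ω+b}`. -/
theorem exists_radius (hm : 1 ≤ m) (hωb : 0 < 2 * ω + b) (hM : 0 < M) (hκ : 0 ≤ κ) (hCN : 0 < CN)
    (hlam : lam = (m : ℝ) ^ (-(1 / (2 * ω + b))))
    (hc : 1 / (m * √lam) ≤ c * lam ^ ω) :
    ∃ Λ > 0, κ * M ≤ √lam * Λ ∧ 2 * κ ^ 2 ≤ √lam * Λ ∧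
      m * ((CN * lam ^ (-b)) * Sig ^ 2) ≤ Λ ^ 2 ∧ m * (κ ^ 2 * (CN * lam ^ (-b))) ≤ Λ ^ 2 ∧
      Λ / m ≤ ((κ * M + 2 * κ ^ 2 + 1) * c + √((Sig ^ 2 + κ ^ 2) * CN)) * lam ^ ω := by
  obtain ⟨hl0, hl1, hlm⟩ := parameter_bounds hm hωb hlam
  have hm0 : (0 : ℝ) < m := by exact_mod_cast hm
  have hs0 : 0 < √lam := Real.sqrt_pos.2 hl0
  set c₀ := κ * M + 2 * κ ^ 2 + 1 with hc₀
  have hκM : 0 ≤ κ * M := by positivity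
  have hc₀0 : 0 < c₀ := by positivity
  set V := (Sig ^ 2 + κ ^ 2) * (CN * lam ^ (-b)) with hV
  have hN : 0 < CN * lam ^ (-b) := by positivity
  have hV0 : 0 ≤ V := by positivity
  set Λ := c₀ / √lam + √(m * V) with hΛ
  have h1 : c₀ ≤ √lam * Λ := by
    rw [hΛ, mul_add, mul_div_cancel₀ _ hs0.ne']
    have : 0 ≤ √lam * √(m * V) := by positivity
    linarith
  have h2 : m * V ≤ Λ ^ 2 := by
    calc m * V = √(m * V) ^ 2 := (Real.sq_sqrt (by positivity)).symm
      _ ≤ Λ ^ 2 := by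
        gcongr
        have : 0 ≤ c₀ / √lam := by positivity
        linarith
  refine ⟨Λ, by positivity, ?_, ?_, ?_, ?_, ?_⟩
  · have : 0 ≤ κ ^ 2 := sq_nonneg _
    linarith
  · linarith
  · refine le_trans ?_ h2
    rw [hV, mul_comm (CN * _)]
    gcongr
    linarith [sq_nonneg κ]
  · refine le_trans ?_ h2
    rw [hV]
    gcongr
    linarith [sq_nonneg Sig]
  · have h3 : √(m * V) / m = √((Sig ^ 2 + κ ^ 2) * CN) * lam ^ ω := by
      have h4 : √(m * V) / m = √(V * (1 / m)) := by
        rw [eq_comm, Real.sqrt_eq_iff_eq_sq (by positivity) (by positivity), div_pow,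
          Real.sq_sqrt (by positivity)]
        field_simp
      rw [h4, hlm, hV, Real.rpow_neg hl0.le, Real.rpow_add hl0, mul_comm 2 ω, Real.rpow_mul hl0.le]
      have h5 : 0 < lam ^ b := by positivity
      have h6 : (Sig ^ 2 + κ ^ 2) * (CN * (lam ^ b)⁻¹) * ((lam ^ ω) ^ (2 : ℝ) * lam ^ b) =
          (Sig ^ 2 + κ ^ 2) * CN * (lam ^ ω) ^ 2 := by
        norm_cast
        field_simp
      rw [h6, Real.sqrt_mul (by positivity), Real.sqrt_sq (by positivity)]
    have h7 : c₀ / √lam / m ≤ c₀ * (c * lam ^ ω) := by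
      calc c₀ / √lam / m = c₀ * (1 / (m * √lam)) := by field_simp
        _ ≤ _ := by gcongr
    rw [hΛ, add_div, h3, add_mul _ √_, mul_assoc c₀]
    linarith

/-- The left side is `lam^{2ω+b-1/2}`, and the exponent is at least `ω`. -/
theorem one_div_le_of_half_le (hm : 1 ≤ m) (hb : 0 < b) (hω : 1 / 2 ≤ ω)
    (hlam : lam = (m : ℝ) ^ (-(1 / (2 * ω + b)))) : 1 / (m * √lam) ≤ 1 * lam ^ ω := by
  obtain ⟨hl0, hl1, hlm⟩ := parameter_bounds hm (by linarith) hlam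
  rw [one_mul, ← div_div, hlm, Real.sqrt_eq_rpow, ← Real.rpow_sub hl0]
  exact Real.rpow_le_rpow_of_exponent_ge hl0 hl1 (by linarith)

/-- The square of the left side is `1/(m lam) · 1/m`. The first factor is at most `1/n`, the second
is `lam^{2ω+b} ≤ lam^{2ω}`. -/
theorem one_div_le_of_le_mul {n : ℝ} (hm : 1 ≤ m) (hb : 0 < b) (hω : 0 ≤ ω)
    (hlam : lam = (m : ℝ) ^ (-(1 / (2 * ω + b)))) (hn : 0 < n) (h : n ≤ m * lam) :
    1 / (m * √lam) ≤ 1 / √n * lam ^ ω := by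
  obtain ⟨hl0, hl1, hlm⟩ := parameter_bounds hm (by linarith) hlam
  have hm0 : (0 : ℝ) < m := by exact_mod_cast hm
  refine le_of_sq_le_sq ?_ (by positivity)
  rw [div_pow, mul_pow, mul_pow, div_pow, Real.sq_sqrt hl0.le, Real.sq_sqrt hn.le, one_pow]
  calc 1 / ((m : ℝ) ^ 2 * lam) = 1 / (m * lam) * (1 / m) := by field_simp
    _ ≤ 1 / n * lam ^ (2 * ω) := by
        rw [hlm]
        gcongr 1 / ?_ * ?_
        exact Real.rpow_le_rpow_of_exponent_ge hl0 hl1 (by linarith)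
    _ = _ := by rw [mul_comm 2 ω, Real.rpow_mul hl0.le]; norm_cast

end Parameter

/-! ### Effective dimension -/

section EffDim

variable {E : Type*} [NormedAddCommGroup E] [InnerProductSpace ℝ E] [CompleteSpace E]
  {T : E →L[ℝ] E} {lam : ℝ}

theorem IsPos.exists_effDim_eq (hT : IsPos T) (hlam : 0 < lam) :
    ∃ S, IsFunctionalCalculus T (fun t => t / (t + lam)) S ∧ effDim T lam = posTrace S := by
  have hne : ∀ t ∈ Icc 0 ‖T‖, t + lam ≠ 0 := fun t ht => by linarith [ht.1]
  obtain ⟨S, hS⟩ := hT.exists_isFunctionalCalculus (φ := fun t => t / (t + lam))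
    (ContinuousOn.div (by fun_prop) (by fun_prop) hne)
  obtain ⟨W, h1, h2, h3, h4, h5⟩ := hT.exists_inv_sqrt hlam
  have hW : IsInvSqrt T lam W := ⟨h1, h2, h3, h4, h5⟩
  have h6 : S * (T + lam • 1) = T := (hS.mul hT (isFunctionalCalculus_id.add
    (isFunctionalCalculus_const lam))).unique hT isFunctionalCalculus_id fun t ht =>
      div_mul_cancel₀ _ (hne t ht)
  refine ⟨S, hS, ?_⟩
  rw [hW.effDim_eq]
  congr 1
  calc W * W * T = W * (W * T) := mul_assoc _ _ _
    _ = T * (W * W) := by rw [h5, ← mul_assoc, h5, mul_assoc]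
    _ = S * ((T + lam • 1) * (W * W)) := by rw [← mul_assoc S, h6]
    _ = S := by rw [h4, mul_one]

/-- The symbol `t/(t + lam)` decreases in `lam`. -/
theorem IsPos.effDim_anti (hT : IsPos T) {lam' : ℝ} (hlam : 0 < lam) (h : lam ≤ lam') :
    effDim T lam' ≤ effDim T lam := by
  obtain ⟨S, hS, hSe⟩ := hT.exists_effDim_eq hlam
  obtain ⟨S', hS', hSe'⟩ := hT.exists_effDim_eq (hlam.trans_le h)
  rw [hSe, hSe']
  have hc : ∀ l > 0, ContinuousOn (fun t : ℝ => t / (t + l)) (Icc 0 ‖T‖) := fun l hl =>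
    ContinuousOn.div (by fun_prop) (by fun_prop) fun t ht => by linarith [ht.1]
  have hle : ∀ x, ⟪S' x, x⟫_ℝ ≤ ⟪S x, x⟫_ℝ := fun x => by
    have := (hS.sub hT hS').nonneg hT ((hc _ hlam).sub (hc _ (hlam.trans_le h))) (fun t ht => by
      have := ht.1
      rw [sub_nonneg]
      gcongr) x
    rw [sub_apply, inner_sub_left] at this
    linarith
  refine iSup₂_mono fun s _ => ENNReal.ofReal_le_ofReal (Finset.sum_le_sum fun e _ => hle e)

end EffDim

/-! ### The case of vanishing effective dimension -/

section PredDist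

variable {X Y G : Type*} [MeasurableSpace X] [NormedAddCommGroup Y] [InnerProductSpace ℝ Y]
  [CompleteSpace Y] [TopologicalSpace.SeparableSpace Y]
  [NormedAddCommGroup G] [InnerProductSpace ℝ G] [CompleteSpace G]
  [RKHS ℝ G X Y] {κ lam : ℝ}

/-- Each `g` has the form `W v`; testing the trace on the single unit vector `v/‖v‖` gives `‖I_ν W
v‖ = 0`. -/
theorem embL2_eq_zero_of_effDim (hK : KernelCondition (X := X) (Y := Y) G κ) (ν : Measure X)
    [IsProbabilityMeasure ν] (hlam : 0 < lam) (h : effDim (covOp hK ν) lam ≤ 0) (g : G) :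
    embL2 hK ν g = 0 := by
  obtain ⟨W, hW⟩ := exists_isInvSqrt_covOp hK ν hlam
  obtain ⟨v, rfl, -⟩ := hW.exists_sqrt g
  rcases eq_or_ne v 0 with rfl | hv
  · simp
  rw [hW.effDim_eq, ← ENNReal.ofReal_zero] at h
  have ho : Orthonormal ℝ fun _ : Unit => (‖v‖⁻¹ : ℝ) • v :=
    ⟨fun _ => norm_smul_inv_norm (𝕜 := ℝ) hv, fun i j hij => absurd (Subsingleton.elim i j) hij⟩
  have h1 := sum_inner_le_of_posTrace_le le_rfl h ho Finset.univ
  simp only [Finset.univ_unique, Finset.sum_singleton, hW.inner_eq, inner_covOp_self] at h1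
  have h2 : embL2 hK ν (W ((‖v‖⁻¹ : ℝ) • v)) = 0 := by
    rw [← norm_le_zero_iff]
    exact le_of_sq_le_sq (by simpa using h1) le_rfl
  rw [map_smul, map_smul] at h2
  exact (smul_eq_zero.1 h2).resolve_left (inv_ne_zero (norm_ne_zero_iff.2 hv))

end PredDist

/-! ### The benchmark radius -/

/-- For the explicit radius `R0` the second estimate is an identity up to constants. If `R` solves
the balancing equation, `x0` and `R` determine each other monotonically: for `R ≤ R0` the bound on
`R` gives the one on `x0`, and for `R ≥ R0` the approximation rate bounds `x0`, hence `R`. -/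
theorem benchmark_radius_bounds {p q s r R Rdag lam x0 c : ℝ} (hp : 0 ≤ p)
    (hDq : 0 < (p + q) - s * (q - 1)) (hDr : 0 < (p + r) - s * (r - 1)) (hR : 0 < R)
    (hRdag : 0 < Rdag) (hlam : 0 < lam) (hx0 : 0 ≤ x0)
    (hrate : Rdag ^ (((p + q) - s * (q - 1)) / ((p + r) - s * (r - 1))) *
        lam ^ (s * (r - q) / (2 * (p + r) - 2 * s * (r - 1))) ≤ R →
      x0 ≤ c * lam ^ ((p + r) / (2 * (p + r) - 2 * s * (r - 1))))
    (h : R = Rdag ^ (((p + q) - s * (q - 1)) / ((p + r) - s * (r - 1))) *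
          lam ^ (s * (r - q) / (2 * (p + r) - 2 * s * (r - 1))) ∨
      x0 * R ^ (-((p + 1) / ((p + q) - s * (q - 1)))) =
          lam ^ ((p + q) / (2 * (p + q) - 2 * s * (q - 1)))) :
    x0 ≤ max c (Rdag ^ ((p + 1) / ((p + r) - s * (r - 1)))) *
      lam ^ ((p + r) / (2 * (p + r) - 2 * s * (r - 1))) ∧
    R * lam ^ ((p + q) / (2 * (p + 1))) ≤
      (max c (Rdag ^ ((p + 1) / ((p + r) - s * (r - 1)))) *
        lam ^ ((p + r) / (2 * (p + r) - 2 * s * (r - 1)))) ^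
          (((p + q) - s * (q - 1)) / (p + 1)) := by
  have hp1 : 0 < p + 1 := by linarith
  have hDr2 : 2 * (p + r) - 2 * s * (r - 1) = 2 * ((p + r) - s * (r - 1)) := by ring
  have hDq2 : 2 * (p + q) - 2 * s * (q - 1) = 2 * ((p + q) - s * (q - 1)) := by ring
  rw [hDr2] at hrate h ⊢
  rw [hDq2] at h
  set Dq := (p + q) - s * (q - 1) with hDqd
  set Dr := (p + r) - s * (r - 1) with hDrd
  set R0 := Rdag ^ (Dq / Dr) * lam ^ (s * (r - q) / (2 * Dr)) with hR0
  set ml := lam ^ ((p + r) / (2 * Dr)) with hml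
  have hml0 : 0 < ml := Real.rpow_pos_of_pos hlam _
  set c' := Rdag ^ ((p + 1) / Dr) with hc'
  have hc'0 : 0 < c' := Real.rpow_pos_of_pos hRdag _
  have hmul : ∀ y : ℝ, 0 ≤ y → (y ^ (Dq / (p + 1))) ^ ((p + 1) / Dq) = y := fun y hy => by
    rw [← Real.rpow_mul hy, div_mul_div_cancel₀ hp1.ne', div_self hDq.ne', Real.rpow_one]
  have hmul' : ∀ y : ℝ, 0 ≤ y → (y ^ ((p + 1) / Dq)) ^ (Dq / (p + 1)) = y := fun y hy => by
    rw [← Real.rpow_mul hy, div_mul_div_cancel₀ hDq.ne', div_self hp1.ne', Real.rpow_one]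
  have hR0eq : R0 * lam ^ ((p + q) / (2 * (p + 1))) = (c' * ml) ^ (Dq / (p + 1)) := by
    rw [Real.mul_rpow hc'0.le hml0.le, hc', hml, ← Real.rpow_mul hRdag.le, ← Real.rpow_mul hlam.le,
      hR0, mul_assoc, ← Real.rpow_add hlam]
    congr 2
    · field_simp
    · field_simp
      rw [hDqd, hDrd]
      ring
  have hsmall : R ≤ R0 → R * lam ^ ((p + q) / (2 * (p + 1))) ≤ (c' * ml) ^ (Dq / (p + 1)) :=
    fun hle => hR0eq ▸ by gcongr
  have hm1 : c * ml ≤ max c c' * ml := by gcongr; exact le_max_left _ _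
  have hm2 : c' * ml ≤ max c c' * ml := by gcongr; exact le_max_right _ _
  have hm2' : (c' * ml) ^ (Dq / (p + 1)) ≤ (max c c' * ml) ^ (Dq / (p + 1)) := by gcongr
  rcases h with h | h
  · exact ⟨(hrate h.ge).trans hm1, (hsmall h.le).trans hm2'⟩
  · have hxR : x0 = (R * lam ^ ((p + q) / (2 * (p + 1)))) ^ ((p + 1) / Dq) := by
      rw [Real.mul_rpow hR.le (by positivity), ← Real.rpow_mul hlam.le,
        show (p + q) / (2 * (p + 1)) * ((p + 1) / Dq) = (p + q) / (2 * Dq) by field_simp, ← h,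
        Real.rpow_neg hR.le]
      have : 0 < R ^ ((p + 1) / Dq) := Real.rpow_pos_of_pos hR _
      field_simp
    have hRx : R * lam ^ ((p + q) / (2 * (p + 1))) = x0 ^ (Dq / (p + 1)) := by
      rw [hxR, hmul' _ (by positivity)]
    rcases le_total R R0 with hle | hle
    · refine ⟨?_, (hsmall hle).trans hm2'⟩
      refine le_trans ?_ hm2
      rw [hxR, ← hmul (c' * ml) (by positivity)]
      have := hsmall hle
      gcongr
    · have h1 := (hrate hle).trans hm1
      refine ⟨h1, ?_⟩
      rw [hRx]
      gcongr

/-! ### The rates -/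

/-- All solutions of `BasicIneq` whose data are of the order `lam ^ ω` are bounded with the
constant `C`. -/
def RateBound (p q s α ellA ellL D ω c₁ c₂ c₃ c₄ c₅ C : ℝ) : Prop :=
  ∀ lam ℓ τ R x x0 y z t t0 u : ℝ, 0 < lam → 1 ≤ ℓ →
    τ ≤ c₁ * (ℓ * lam ^ ω) → x0 ≤ c₂ * lam ^ ω → √lam * t0 ≤ c₃ * lam ^ ω →
    t0 ≤ c₄ * lam ^ ((2 * ω * (s + p) - p) / (2 * (p + 1))) →
    R * lam ^ ((p + q) / (2 * (p + 1))) ≤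
      (c₅ * lam ^ ω) ^ (((p + q) - s * (q - 1)) / (p + 1)) →
    BasicIneq p q s α ellA ellL D lam τ R x x0 y z t t0 u →
    t ≤ C * lam ^ ((2 * ω * (s + p) - p) / (2 * (p + 1))) * ℓ ^ max 1 ((p + s) / (p + 1))

/-- The constant in the bound for the stochastic error. -/
def noiseConst (κ M Sig CN c : ℝ) : ℝ :=
  -- The factor `2` comes from `1 + log(4/η) ≤ 2 log(4/η)`. The absolute value makes the constant
  -- nonnegative before a kernel condition supplies `0 ≤ κ`.
  2 * ((|κ| * M + 2 * κ ^ 2 + 1) * c + √((Sig ^ 2 + κ ^ 2) * CN))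

theorem noiseConst_nonneg {κ M Sig CN c : ℝ} (hM : 0 < M) (hc : 0 ≤ c) :
    0 ≤ noiseConst κ M Sig CN c := by
  unfold noiseConst
  positivity

theorem one_le_log_four_div {η : ℝ} (hη : 0 < η) (hη1 : η < 1) : 1 ≤ Real.log (4 / η) := by
  rw [Real.le_log_iff_exp_le (by positivity), le_div_iff₀ hη]
  have := Real.exp_one_lt_d9
  nlinarith [Real.exp_pos 1]

/-! ### Error bound for a given reference point, and estimates for the benchmark -/

section Error

variable {X Y H G : Type*} [MeasurableSpace X]
  [NormedAddCommGroup Y] [InnerProductSpace ℝ Y] [CompleteSpace Y]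
  [TopologicalSpace.SeparableSpace Y] [MeasurableSpace Y] [BorelSpace Y]
  [NormedAddCommGroup H] [InnerProductSpace ℝ H] [CompleteSpace H]
  [NormedAddCommGroup G] [InnerProductSpace ℝ G] [CompleteSpace G] [RKHS ℝ G X Y]
  {P : InverseProblem X Y H G} {p q r s α β ellA ellL D R Rdag b κ M Sig CN ω : ℝ}
  {hK : KernelCondition (X := X) (Y := Y) G κ} {Q : Set H} {m : ℕ} {lam η : ℝ}

namespace InverseProblem

theorem predDist_nonneg (f : H) : 0 ≤ P.predDist hK f := norm_nonneg _

theorem predDist_fhat : P.predDist hK P.fhat = 0 := by simp [predDist]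

/-- The prediction distance is identically zero, so conditional stability and injectivity of
`L^{-p}` force every element of `Q` to be `fhat`. -/
theorem errorBound_of_effDim_le_zero [TopologicalSpace.SeparableSpace G]
    (hL : IsScaleGenerator P.L ellL) (hellL : 0 < ellL)
    (hp : 0 ≤ p) (hs : 0 < s)
    (hstab : ∀ f ∈ Q, ‖negPow P.L p (f - P.fhat)‖ ≤ α * P.predDist hK f ^ s)
    (h : effDim (covOp hK P.ν) lam ≤ 0) (hlam : 0 < lam) (hη : 0 < η) {l B : ℝ} (hB : 0 ≤ B) :
    P.ErrorBound Q m l η B := by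
  refine ⟨univ, MeasurableSet.univ, ?_, fun z _ f _ hf => ?_⟩
  · rw [measure_univ, ← ENNReal.ofReal_one]
    exact ENNReal.ofReal_le_ofReal (by linarith)
  · have h1 := hstab f hf
    rw [predDist, embL2_eq_zero_of_effDim hK P.ν hlam h, norm_zero, Real.zero_rpow hs.ne',
      mul_zero, norm_le_zero_iff] at h1
    rw [hL.negPow_eq_zero hellL hp h1, norm_zero]
    exact hB

theorem errorBound_of_rateBound [TopologicalSpace.SeparableSpace G] (hm : 1 ≤ m)
    (hωb : 0 < 2 * ω + b) (hlam : lam = (m : ℝ) ^ (-(1 / (2 * ω + b))))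
    (hp : 0 ≤ p) (hq1 : 1 ≤ q) (hq2 : q ≤ 2 + p) (hellL : 0 < ellL) (hellA : 0 ≤ ellA)
    (hM : 0 < M) (hD : 0 ≤ D) (hCN : 0 < CN)
    (hL : IsScaleGenerator P.L ellL) (hTrue : P.TrueSolution) (hnoise : P.NoiseCondition M Sig)
    (hOp : P.OperatorCondition ellA D) (hQD : Q ⊆ Metric.closedBall P.fhat D)
    (hstab : ∀ f ∈ Q, ‖negPow P.L p (f - P.fhat)‖ ≤ α * P.predDist hK f ^ s)
    (heff : effDim (covOp hK P.ν) lam ≤ ENNReal.ofReal (CN * lam ^ (-b)))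
    {c : ℝ} (hc : 1 / (m * √lam) ≤ c * lam ^ ω)
    (hη : 0 < η) (hη1 : η < 1) {f0 v : H}
    (hf0 : f0 ∈ P.dom) (hf0D : f0 ∈ Metric.closedBall P.fhat D)
    (hv : f0 - P.fbar = negPow P.L q v) (hvR : ‖v‖ ≤ R)
    (hst0 : ‖negPow P.L p (f0 - P.fhat)‖ ≤ α * P.predDist hK f0 ^ s) {c₂ c₃ c₄ c₅ C : ℝ}
    (h2 : P.predDist hK f0 ≤ c₂ * lam ^ ω) (h3 : √lam * ‖f0 - P.fhat‖ ≤ c₃ * lam ^ ω)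
    (h4 : ‖f0 - P.fhat‖ ≤ c₄ * lam ^ ((2 * ω * (s + p) - p) / (2 * (p + 1))))
    (h5 : R * lam ^ ((p + q) / (2 * (p + 1))) ≤
      (c₅ * lam ^ ω) ^ (((p + q) - s * (q - 1)) / (p + 1)))
    (hC : RateBound p q s α ellA ellL D ω (noiseConst κ M Sig CN c) c₂ c₃ c₄ c₅ C) :
    P.ErrorBound Q m lam η (C * lam ^ ((2 * ω * (s + p) - p) / (2 * (p + 1))) *
      Real.log (4 / η) ^ max 1 ((p + s) / (p + 1))) := by
  obtain ⟨hl0, -, -⟩ := parameter_bounds hm hωb hlam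
  obtain ⟨Λ, hΛ, hΛ1, hΛ2, hΛ3, hΛ4, hΛ5⟩ :=
    exists_radius (Sig := Sig) hm hωb hM hK.nonneg hCN hlam hc
  have hℓ := one_le_log_four_div hη hη1
  refine errorBound_of_basicIneq hm hl0 hp hq1 hq2 hellL hellA hM hD hL hTrue hnoise hOp hQD hstab
    (by positivity) heff hΛ hΛ1 hΛ2 hΛ3 hΛ4 hη hη1 hf0 hf0D hv hvR hst0 fun x y z t u hB =>
      hC _ _ _ _ _ _ _ _ _ _ _ hl0 hℓ ?_ h2 h3 h4 h5 hB
  have hm0 : (0 : ℝ) < m := by exact_mod_cast hm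
  calc Λ * (1 + Real.log (4 / η)) / m = Λ / m * (1 + Real.log (4 / η)) := by ring
    _ ≤ Λ / m * (2 * Real.log (4 / η)) := by gcongr; linarith
    _ ≤ ((κ * M + 2 * κ ^ 2 + 1) * c + √((Sig ^ 2 + κ ^ 2) * CN)) * lam ^ ω *
        (2 * Real.log (4 / η)) := by gcongr
    _ = _ := by rw [noiseConst, abs_of_nonneg hK.nonneg]; ring

/-- Converse stability bounds the prediction error by the `H_{-p}` distance, and the residual
estimate bounds that by a negative power of `R`, so a lower bound on `R` suffices. -/
theorem predDist_benchmark_le (hL : IsScaleGenerator P.L ellL) (hellL : 0 < ellL)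
    (hp : 0 ≤ p) (hs : 0 < s) (hr : 0 ≤ r) (hrq : r ≤ q) (hrp : r + p ≤ 2 * q) (hα : 0 < α)
    (hβ : 0 < β) (hRdag : 0 < Rdag) (hDr : 0 < (p + r) - s * (r - 1)) (hlam : 0 < lam)
    (hR : 0 < R) {fR : H} (hb : P.IsBenchmark q R fR)
    (hsrc : P.fhat ∈ scaleBall P.L r P.fbar Rdag)
    (hconv : α * P.predDist hK fR ^ s ≤ β * ‖negPow P.L p (fR - P.fhat)‖)
    (hle : Rdag ^ (((p + q) - s * (q - 1)) / ((p + r) - s * (r - 1))) *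
      lam ^ (s * (r - q) / (2 * (p + r) - 2 * s * (r - 1))) ≤ R) :
    P.predDist hK fR ≤ (β / α * (Rdag * Rdag ^ ((1 - ((p + q) - s * (q - 1)) /
      ((p + r) - s * (r - 1))) * ((r + p) / (q - r))))) ^ (1 / s) *
        lam ^ ((p + r) / (2 * (p + r) - 2 * s * (r - 1))) := by
  have hDr2 : 2 * (p + r) - 2 * s * (r - 1) = 2 * ((p + r) - s * (r - 1)) := by ring
  rw [hDr2] at hle ⊢
  obtain ⟨v, hv, hvR⟩ := hsrc
  rcases hrq.lt_or_eq with hlt | rfl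
  · obtain ⟨e, he, hev, hμ⟩ := hL.exists_residual hellL (hr.trans hrq) hr hR hb.1 hb.2 hv
    have h1 := hL.norm_negPow_residual_le hellL hp hr hlt hrp hR hRdag hvR hev hμ
    rw [← hL.negPow_negPow hellL hp hr, ← he, ← norm_neg, ← map_neg, neg_sub] at h1
    generalize hDrd : (p + r) - s * (r - 1) = Dr at *
    generalize (p + q) - s * (q - 1) = Dq at *
    have hqr : 0 < q - r := by linarith
    have hR0 : 0 < Rdag ^ (Dq / Dr) * lam ^ (s * (r - q) / (2 * Dr)) := by positivity
    have h2 : (Rdag / R) ^ ((r + p) / (q - r)) ≤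
        Rdag ^ ((1 - Dq / Dr) * ((r + p) / (q - r))) * (lam ^ ((p + r) / (2 * Dr))) ^ s := by
      calc (Rdag / R) ^ ((r + p) / (q - r)) ≤
          (Rdag / (Rdag ^ (Dq / Dr) * lam ^ (s * (r - q) / (2 * Dr)))) ^ ((r + p) / (q - r)) := by
            gcongr
        _ = (Rdag ^ (1 - Dq / Dr) * lam ^ (-(s * (r - q) / (2 * Dr)))) ^ ((r + p) / (q - r)) := by
            rw [Real.rpow_sub hRdag, Real.rpow_one, Real.rpow_neg hlam.le, ← div_div,
              div_eq_mul_inv _ (lam ^ _)]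
        _ = _ := by
            rw [Real.mul_rpow (by positivity) (by positivity), ← Real.rpow_mul hRdag.le,
              ← Real.rpow_mul hlam.le, ← Real.rpow_mul hlam.le]
            congr 2
            field_simp
            ring
    set K := Rdag ^ ((1 - Dq / Dr) * ((r + p) / (q - r))) with hKd
    set ml := lam ^ ((p + r) / (2 * Dr)) with hml
    have hK0 : 0 < K := Real.rpow_pos_of_pos hRdag _
    have hml0 : 0 < ml := Real.rpow_pos_of_pos hlam _
    have h3 : P.predDist hK fR ^ s ≤ β / α * (Rdag * K) * ml ^ s := by
      have : α * P.predDist hK fR ^ s ≤ β * (Rdag * (K * ml ^ s)) :=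
        hconv.trans (by gcongr; exact h1.trans (by gcongr))
      rw [div_mul_eq_mul_div, div_mul_eq_mul_div, le_div_iff₀ hα]
      linarith
    have h4 := Real.rpow_le_rpow (by positivity [predDist_nonneg (hK := hK) (P := P) fR]) h3
      (by positivity : 0 ≤ 1 / s)
    rwa [Real.mul_rpow (by positivity) (by positivity), ← Real.rpow_mul (predDist_nonneg _),
      ← Real.rpow_mul hml0.le, mul_one_div_cancel hs.ne', Real.rpow_one, Real.rpow_one] at h4
  -- For `r = q` the lower bound reads `Rdag ≤ R`, so `fhat` lies in the ball and the benchmark is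
  -- `fhat`.
  · rw [div_self hDr.ne', Real.rpow_one, sub_self, mul_zero, zero_div, Real.rpow_zero,
      mul_one] at hle
    have h1 := hb.2 P.fhat ⟨v, hv, hvR.trans hle⟩
    rw [sub_self, norm_zero, norm_le_zero_iff, sub_eq_zero] at h1
    rw [h1, predDist_fhat]
    positivity

/-- Since `fhat - fR = L^{-r} e`, the norm is interpolated between `‖e‖ ≤ Rdag` and `‖L^{-(p+r)}
e‖`, the weak error that conditional stability controls. -/
theorem norm_benchmark_sub_le (hL : IsScaleGenerator P.L ellL) (hellL : 0 < ellL)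
    (hp : 0 ≤ p) (hs : 0 < s) (hr : 0 ≤ r) (hq : 0 ≤ q) (hα : 0 < α)
    (hDr : 0 < (p + r) - s * (r - 1)) (hlam : 0 < lam)
    (hω : ω = (p + r) / (2 * (p + r) - 2 * s * (r - 1)))
    (hR : 0 < R) {fR : H} (hb : P.IsBenchmark q R fR)
    (hsrc : P.fhat ∈ scaleBall P.L r P.fbar Rdag)
    (hstab : ‖negPow P.L p (fR - P.fhat)‖ ≤ α * P.predDist hK fR ^ s) {c : ℝ} (hc : 0 ≤ c)
    (hx : P.predDist hK fR ≤ c * lam ^ ω) :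
    ‖fR - P.fhat‖ ≤ (α * c ^ s) ^ (r / (p + r)) * Rdag ^ (1 - r / (p + r)) *
      lam ^ ((2 * ω * (s + p) - p) / (2 * (p + 1))) := by
  obtain ⟨v, hv, hvR⟩ := hsrc
  obtain ⟨e, he, hev, -⟩ := hL.exists_residual hellL hq hr hR hb.1 hb.2 hv
  have h1 : ‖negPow P.L (p + r) e‖ ≤ α * c ^ s * lam ^ (ω * s) := by
    rw [← hL.negPow_negPow hellL hp hr, ← he, ← norm_neg, ← map_neg, neg_sub]
    refine hstab.trans ?_
    have h2 := Real.rpow_le_rpow (predDist_nonneg _) hx hs.le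
    rw [Real.mul_rpow hc (by positivity), ← Real.rpow_mul hlam.le] at h2
    rw [mul_assoc]
    gcongr
  have hfr : 0 ≤ 1 - r / (p + r) := sub_nonneg.2 (div_le_one_of_le₀ (by linarith) (by linarith))
  have hE : (2 * ω * (s + p) - p) / (2 * (p + 1)) = ω * s * (r / (p + r)) := by
    -- For `p = r = 0` the quotient `r/(p+r)` is `0` by convention; there `ω = 0`, so both exponents
    -- vanish.
    rcases (add_nonneg hp hr).eq_or_lt with h | h
    · have hp0 : p = 0 := by linarith
      have hr0 : r = 0 := by linarith
      simp [hω, hp0, hr0]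
    · have hDr2 : 2 * (p + r) - 2 * s * (r - 1) = 2 * ((p + r) - s * (r - 1)) := by ring
      rw [hω, hDr2]
      have : p + 1 ≠ 0 := by linarith
      field_simp
      ring
  calc ‖fR - P.fhat‖ = ‖negPow P.L r e‖ := by rw [← he, norm_sub_rev]
    _ ≤ ‖negPow P.L (p + r) e‖ ^ (r / (p + r)) * ‖e‖ ^ (1 - r / (p + r)) :=
        hL.negPow_interpolation hellL hr (by linarith) e
    _ ≤ (α * c ^ s * lam ^ (ω * s)) ^ (r / (p + r)) * Rdag ^ (1 - r / (p + r)) := by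
        gcongr
        exact hev.trans hvR
    _ = _ := by
        rw [Real.mul_rpow (by positivity) (by positivity), ← Real.rpow_mul hlam.le, hE]
        ring

end InverseProblem

end Error

/-! ### The rates in the two smoothness regimes -/

section Rates

variable {X Y H G : Type*} [MeasurableSpace X]
  [NormedAddCommGroup Y] [InnerProductSpace ℝ Y] [CompleteSpace Y]
  [TopologicalSpace.SeparableSpace Y] [MeasurableSpace Y] [BorelSpace Y]
  [NormedAddCommGroup H] [InnerProductSpace ℝ H] [CompleteSpace H]
  [NormedAddCommGroup G] [InnerProductSpace ℝ G] [CompleteSpace G]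
  [TopologicalSpace.SeparableSpace G] [RKHS ℝ G X Y]
  {P : InverseProblem X Y H G} {p q r s α β ellA ellL D R Rdag b κ M Sig CN ω θ d n C : ℝ}
  {hK : KernelCondition (X := X) (Y := Y) G κ} {Q : Set H} {m : ℕ} {lam η : ℝ}

namespace InverseProblem

/-- The rate for solutions that are at least as smooth as the benchmark. -/
theorem errorBound_of_smooth (hp : 0 ≤ p) (hs : 0 < s) (hq1 : 1 ≤ q) (hq2 : q ≤ 2 + p)
    (hqr : q ≤ r) (hDq : 0 < (p + q) - s * (q - 1)) (hb : 0 < b) (hCN : 0 < CN)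
    (hellL : 0 < ellL) (hellA : 0 ≤ ellA) (hD : 0 < D) (hM : 0 < M)
    (hRdag : 0 < Rdag) (hL : IsScaleGenerator P.L ellL) (hTrue : P.TrueSolution)
    (hnoise : P.NoiseCondition M Sig) (hOp : P.OperatorCondition ellA D)
    (hQD : Q ⊆ Metric.closedBall P.fhat D) (hstab : P.ConditionalStability hK Q p s α θ d)
    (hsrc : P.fhat ∈ scaleBall P.L r P.fbar Rdag)
    (heff : ∀ lam : ℝ, 0 < lam → effDim (covOp hK P.ν) lam ≤ ENNReal.ofReal (CN * lam ^ (-b)))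
    (hm : 1 ≤ m) (hη : 0 < η) (hη1 : η < 1) (hlam : lam = (m : ℝ) ^ (-(1 / (2 * ω + b))))
    (hω : ω = (p + q) / (2 * (p + q) - 2 * s * (q - 1)))
    (hC : RateBound p q s α ellA ellL D ω (noiseConst κ M Sig CN 1) 0 0 0
      (((1 / ellL) ^ (r - q) * Rdag) ^ ((p + 1) / ((p + q) - s * (q - 1)))) C) :
    P.ErrorBound Q m lam η (C * lam ^ ((2 * ω * (s + p) - p) / (2 * (p + 1))) *
      Real.log (4 / η) ^ max 1 ((p + s) / (p + 1))) := by
  have hDq2 : 2 * (p + q) - 2 * s * (q - 1) = 2 * ((p + q) - s * (q - 1)) := by ring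
  have hq0 : 0 ≤ q - 1 := by linarith
  have hω1 : 1 / 2 ≤ ω := by
    rw [hω, hDq2, div_le_div_iff₀ two_pos (by positivity)]
    linarith [mul_nonneg hs.le hq0]
  have hωb : 0 < 2 * ω + b := by linarith
  obtain ⟨hl0, -, -⟩ := parameter_bounds hm hωb hlam
  obtain ⟨v, hv, hvR⟩ := hsrc
  -- The reference point is `fhat` itself: the excess smoothness `r - q` goes into the source
  -- element, at the cost of a factor `(1/ellL)^{r-q}` in the radius.
  have hv' : P.fhat - P.fbar = negPow P.L q (negPow P.L (r - q) v) := by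
    rw [hL.negPow_negPow hellL (by linarith) (by linarith), hv, add_sub_cancel]
  have hvR' : ‖negPow P.L (r - q) v‖ ≤ (1 / ellL) ^ (r - q) * Rdag :=
    (hL.norm_negPow_apply_le hellL (by linarith) v).trans (by gcongr)
  have hx0 : P.predDist hK P.fhat ≤ 0 * lam ^ ω := by rw [predDist_fhat, zero_mul]
  refine errorBound_of_rateBound hm hωb hlam hp hq1 hq2 hellL hellA hM hD.le hCN hL hTrue hnoise
    hOp hQD hstab.estimate (heff lam hl0) (one_div_le_of_half_le hm hb hω1 hlam) hη hη1
    (interior_subset hTrue.mem_interior) (Metric.mem_closedBall_self hD.le) hv' hvR' ?_ hx0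
    (by simp) (by simp) (le_of_eq ?_) hC
  · rw [sub_self, map_zero, norm_zero, predDist_fhat, Real.zero_rpow hs.ne', mul_zero]
  · have hRa : 0 < (1 / ellL) ^ (r - q) * Rdag := by positivity
    have hp1 : p + 1 ≠ 0 := by linarith
    rw [Real.mul_rpow (by positivity) (by positivity), ← Real.rpow_mul hRa.le,
      ← Real.rpow_mul hl0.le, div_mul_div_cancel₀ hDq.ne', div_self hp1, Real.rpow_one, hω, hDq2]
    congr 2
    field_simp

/-- The bound for the prediction error of the benchmark. -/
def benchmarkConst (p q r s α β Rdag : ℝ) : ℝ :=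
  max ((β / α * (Rdag * Rdag ^ ((1 - ((p + q) - s * (q - 1)) /
    ((p + r) - s * (r - 1))) * ((r + p) / (q - r))))) ^ (1 / s))
    (Rdag ^ ((p + 1) / ((p + r) - s * (r - 1))))

theorem benchmarkConst_nonneg (hRdag : 0 < Rdag) : 0 ≤ benchmarkConst p q r s α β Rdag :=
  le_max_of_le_right (Real.rpow_nonneg hRdag.le _)

/-- The rate for solutions that are at most as smooth as the benchmark. -/
theorem errorBound_of_benchmark (hp : 0 ≤ p) (hs : 0 < s) (hq1 : 1 ≤ q) (hq2 : q ≤ 2 + p)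
    (hr : 0 ≤ r) (hrq : r ≤ q) (hrp : r + p ≤ 2 * q) (hDq : 0 < (p + q) - s * (q - 1))
    (hDr : 0 < (p + r) - s * (r - 1)) (hb : 0 < b)
    (hCN : 0 < CN) (hellL : 0 < ellL) (hellA : 0 ≤ ellA) (hD : 0 < D) (hM : 0 < M)
    (hα : 0 < α) (hβ : 0 < β)
    (hRdag : 0 < Rdag) (hL : IsScaleGenerator P.L ellL) (hTrue : P.TrueSolution)
    (hnoise : P.NoiseCondition M Sig) (hOp : P.OperatorCondition ellA D)
    (hQD : Q ⊆ Metric.closedBall P.fhat D) (hstab : P.ConditionalStability hK Q p s α θ d)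
    (hconv : P.ConverseStability hK Q p s α β)
    (hsrc : P.fhat ∈ scaleBall P.L r P.fbar Rdag)
    (heff : ∀ lam : ℝ, 0 < lam → effDim (covOp hK P.ν) lam ≤ ENNReal.ofReal (CN * lam ^ (-b)))
    (hn : r < 1 → effDim (covOp hK P.ν) 1 = ENNReal.ofReal n)
    (hm : 1 ≤ m) (hη : 0 < η) (hη1 : η < 1) (hlam : lam = (m : ℝ) ^ (-(1 / (2 * ω + b))))
    (hml : effDim (covOp hK P.ν) lam ≤ ENNReal.ofReal (m * lam))
    (hω : ω = (p + r) / (2 * (p + r) - 2 * s * (r - 1))) {fR : H} (hR : 0 < R)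
    (hfR : P.IsBenchmark q R fR) (hfRQ : fR ∈ Q)
    (hRlam : R = Rdag ^ (((p + q) - s * (q - 1)) / ((p + r) - s * (r - 1))) *
          lam ^ (s * (r - q) / (2 * (p + r) - 2 * s * (r - 1))) ∨
      P.predDist hK fR * R ^ (-((p + 1) / ((p + q) - s * (q - 1)))) =
          lam ^ ((p + q) / (2 * (p + q) - 2 * s * (q - 1)))) {c c₄ : ℝ}
    (hc : c = benchmarkConst p q r s α β Rdag)
    (hc₄ : c₄ = (α * c ^ s) ^ (r / (p + r)) * Rdag ^ (1 - r / (p + r))) (hC0 : 0 < C)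
    (hC : RateBound p q s α ellA ellL D ω (noiseConst κ M Sig CN (max 1 (1 / √n))) c c₄ c₄ c C) :
    P.ErrorBound Q m lam η (C * lam ^ ((2 * ω * (s + p) - p) / (2 * (p + 1))) *
      Real.log (4 / η) ^ max 1 ((p + s) / (p + 1))) := by
  have hDr2 : 2 * (p + r) - 2 * s * (r - 1) = 2 * ((p + r) - s * (r - 1)) := by ring
  have hω0 : 0 ≤ ω := by
    rw [hω, hDr2]
    positivity
  have hωb : 0 < 2 * ω + b := by linarith
  obtain ⟨hl0, hl1, -⟩ := parameter_bounds hm hωb hlam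
  have hm0 : (0 : ℝ) < m := by exact_mod_cast hm
  have hℓ := one_le_log_four_div hη hη1
  -- In this degenerate case `1/√n` would be useless, but the effective dimension at `1` vanishes
  -- and the error is zero.
  by_cases hdeg : r < 1 ∧ n ≤ 0
  · refine errorBound_of_effDim_le_zero hL hellL hp hs hstab.estimate (lam := 1) ?_ one_pos hη
      (by positivity)
    rw [hn hdeg.1, ENNReal.ofReal_of_nonpos hdeg.2]
  have hc₆ : 1 / (m * √lam) ≤ max 1 (1 / √n) * lam ^ ω := by
    rcases lt_or_ge r 1 with hr1 | hr1
    · have hn0 : 0 < n := not_le.1 fun h => hdeg ⟨hr1, h⟩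
      have h1 := ((isPos_covOp hK P.ν).effDim_anti hl0 hl1).trans hml
      rw [hn hr1, ENNReal.ofReal_le_ofReal_iff (by positivity)] at h1
      refine (one_div_le_of_le_mul hm hb hω0 hlam hn0 h1).trans ?_
      gcongr
      exact le_max_right _ _
    · have hω1 : 1 / 2 ≤ ω := by
        rw [hω, hDr2, div_le_div_iff₀ two_pos (by positivity)]
        linarith [mul_nonneg hs.le (sub_nonneg.2 hr1)]
      refine (one_div_le_of_half_le hm hb hω1 hlam).trans ?_
      gcongr
      exact le_max_left _ _
  obtain ⟨h2, h5⟩ := benchmark_radius_bounds hp hDq hDr hR hRdag hl0 (predDist_nonneg fR)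
    (predDist_benchmark_le hL hellL hp hs hr hrq hrp hα hβ hRdag hDr hl0 hR hfR hsrc
      (hconv fR hfRQ)) hRlam
  have hc0 : 0 ≤ c := hc ▸ benchmarkConst_nonneg hRdag
  rw [← hω, ← benchmarkConst, ← hc] at h2 h5
  have h4 := norm_benchmark_sub_le hL hellL hp hs hr (by linarith) hα hDr hl0 hω hR hfR hsrc
    (hstab.estimate fR hfRQ) hc0 h2
  rw [← hc₄] at h4
  have hc₄0 : 0 ≤ c₄ := by rw [hc₄]; positivity
  -- This says that `√lam` times the norm rate is no worse than the prediction rate. It reduces to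
  -- `1 + 2ω(s-1) ≥ 0`, which holds because that number times `(p+r) - s(r-1)` equals `s(p+1)`.
  have hE : ω ≤ 1 / 2 + (2 * ω * (s + p) - p) / (2 * (p + 1)) := by
    have h6 : ω * (2 * ((p + r) - s * (r - 1))) = p + r := by
      rw [hω, hDr2, div_mul_cancel₀ _ (by positivity)]
    have h7 : 0 ≤ 1 + 2 * ω * (s - 1) := by
      have h8 : (1 + 2 * ω * (s - 1)) * ((p + r) - s * (r - 1)) = s * (p + 1) := by
        linear_combination (s - 1) * h6
      have : 0 ≤ s * (p + 1) := by positivity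
      rw [← h8] at this
      exact nonneg_of_mul_nonneg_left this hDr
    have h9 : 1 / 2 + (2 * ω * (s + p) - p) / (2 * (p + 1)) - ω =
        (1 + 2 * ω * (s - 1)) / (2 * (p + 1)) := by
      have : p + 1 ≠ 0 := by linarith
      field_simp
      ring
    have : 0 ≤ (1 + 2 * ω * (s - 1)) / (2 * (p + 1)) := by positivity
    linarith
  have h3 : √lam * ‖fR - P.fhat‖ ≤ c₄ * lam ^ ω := by
    calc √lam * ‖fR - P.fhat‖
        ≤ √lam * (c₄ * lam ^ ((2 * ω * (s + p) - p) / (2 * (p + 1)))) := by gcongr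
      _ = c₄ * lam ^ (1 / 2 + (2 * ω * (s + p) - p) / (2 * (p + 1))) := by
        rw [Real.rpow_add hl0, Real.sqrt_eq_rpow]
        ring
      _ ≤ c₄ * lam ^ ω := by
        gcongr ?_ * ?_
        exact Real.rpow_le_rpow_of_exponent_ge hl0 hl1 hE
  obtain ⟨v, hv, hvR⟩ := hfR.1
  exact errorBound_of_rateBound hm hωb hlam hp hq1 hq2 hellL hellA hM hD.le hCN hL hTrue hnoise
    hOp hQD hstab.estimate (heff lam hl0) hc₆ hη hη1 (hstab.subset hfRQ).2 (hQD hfRQ) hv hvR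
    (hstab.estimate fR hfRQ) h2 h3 h4 h5 hC

theorem ErrorBound.mono {B B' : ℝ} (h : P.ErrorBound Q m lam η B) (hB : B ≤ B') :
    P.ErrorBound Q m lam η B' := by
  obtain ⟨E, hE, h1, h2⟩ := h
  exact ⟨E, hE, h1, fun z hz f hf hfQ => (h2 z hz f hf hfQ).trans hB⟩

end InverseProblem

end Rates

end HilbertScales

end

theorem mainTheorem4
    (p q s r b CN ellL ellA D κ M Sig α β Rdag n₁ : ℝ)
    (hp : 0 ≤ p) (hs : 0 < s) (hr : 0 ≤ r) (hq1 : 1 ≤ q) (hq2 : q ≤ 2 + p)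
    (hqs : q * (s - 1) < p + s) (hb0 : 0 < b) (hb1 : b < 1) (hCN : 0 < CN)
    (hellL : 0 < ellL) (hellA : 0 ≤ ellA) (hD : 0 < D) (hM : 0 < M) (hSig : 0 ≤ Sig)
    (hα : 0 < α) (hβ : 0 < β) (hRdag : 0 < Rdag) :
    ∃ C : ℝ, 0 < C ∧
      ∀ (X Y H G : Type*) [TopologicalSpace X] [PolishSpace X] [MeasurableSpace X] [BorelSpace X]
        [NormedAddCommGroup Y] [InnerProductSpace ℝ Y] [CompleteSpace Y]
        [TopologicalSpace.SeparableSpace Y] [MeasurableSpace Y] [BorelSpace Y]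
        [NormedAddCommGroup H] [InnerProductSpace ℝ H] [CompleteSpace H]
        [TopologicalSpace.SeparableSpace H]
        [NormedAddCommGroup G] [InnerProductSpace ℝ G] [CompleteSpace G]
        [TopologicalSpace.SeparableSpace G] [RKHS ℝ G X Y]
        (P : HilbertScales.InverseProblem X Y H G)
        (hK : HilbertScales.KernelCondition (X := X) (Y := Y) G κ)
        (Q : Set H) (θ d : ℝ),
        HilbertScales.IsScaleGenerator P.L ellL →
        P.TrueSolution →
        P.NoiseCondition M Sig →
        P.OperatorCondition ellA D →
        0 ≤ θ → 0 < d → Q ⊆ Metric.closedBall P.fhat D →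
        P.ConditionalStability hK Q p s α θ d →
        P.ConverseStability hK Q p s α β →
        P.fhat ∈ HilbertScales.scaleBall P.L r P.fbar Rdag →
        (∀ lam : ℝ, 0 < lam →
          HilbertScales.effDim (HilbertScales.covOp hK P.ν) lam ≤
            ENNReal.ofReal (CN * lam ^ (-b))) →
        -- the value at `1` of the effective dimension enters the constant only if `r < 1`
        (r < 1 →
          HilbertScales.effDim (HilbertScales.covOp hK P.ν) 1 = ENNReal.ofReal n₁) →
        ∀ (m : ℕ), 1 ≤ m → ∀ (η : ℝ), 0 < η → η < 1 → ∀ (u lam : ℝ),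
        lam = (m : ℝ) ^ (-(1 / (2 * u + b))) →
        HilbertScales.effDim (HilbertScales.covOp hK P.ν) lam ≤ ENNReal.ofReal (m * lam) →
        (q ≤ r → u = (p + q) / (2 * (p + q) - 2 * s * (q - 1)) →
          P.ErrorBound Q m lam η
            (C * lam ^ ((2 * u * (s + p) - p) / (2 * (p + 1))) *
              Real.log (4 / η) ^ max 1 ((p + s) / (p + 1)))) ∧
        (r ≤ q → r + p ≤ 2 * q → u = (p + r) / (2 * (p + r) - 2 * s * (r - 1)) →
          ∀ (R : ℝ) (fR : H), 0 < R → P.IsBenchmark q R fR → fR ∈ Q →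
          -- `R` is the closed-form radius `R(lam)`, or solves the balancing equation for `d_A(R)`
          (R = Rdag ^ (((p + q) - s * (q - 1)) / ((p + r) - s * (r - 1))) *
                lam ^ (s * (r - q) / (2 * (p + r) - 2 * s * (r - 1))) ∨
            P.predDist hK fR * R ^ (-((p + 1) / ((p + q) - s * (q - 1)))) =
                lam ^ ((p + q) / (2 * (p + q) - 2 * s * (q - 1)))) →
          P.ErrorBound Q m lam η
            (C * lam ^ ((2 * u * (s + p) - p) / (2 * (p + 1))) *
              Real.log (4 / η) ^ max 1 ((p + s) / (p + 1)))) := by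
  have hDq : 0 < (p + q) - s * (q - 1) := by linarith
  set ca := ((1 / ellL) ^ (r - q) * Rdag) ^ ((p + 1) / ((p + q) - s * (q - 1))) with hca
  set cb := HilbertScales.InverseProblem.benchmarkConst p q r s α β Rdag with hcb
  set c₄ := (α * cb ^ s) ^ (r / (p + r)) * Rdag ^ (1 - r / (p + r)) with hc₄
  have hcb0 : 0 ≤ cb := HilbertScales.InverseProblem.benchmarkConst_nonneg hRdag
  have hca0 : 0 ≤ ca := by positivity
  have hc₄0 : 0 ≤ c₄ := by positivity
  obtain ⟨Ca, hCa0, hCa⟩ := HilbertScales.BasicIneq.exists_bound D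
    ((p + q) / (2 * (p + q) - 2 * s * (q - 1))) (HilbertScales.noiseConst κ M Sig CN 1) 0 0 0 ca
    hp hs hq1 hq2 hqs hellL hellA hα (HilbertScales.noiseConst_nonneg hM zero_le_one) le_rfl
    le_rfl hca0
  obtain ⟨Cb, hCb0, hCb⟩ := HilbertScales.BasicIneq.exists_bound D
    ((p + r) / (2 * (p + r) - 2 * s * (r - 1)))
    (HilbertScales.noiseConst κ M Sig CN (max 1 (1 / √n₁))) cb c₄ c₄ cb
    hp hs hq1 hq2 hqs hellL hellA hα
    (HilbertScales.noiseConst_nonneg hM (le_max_of_le_left zero_le_one)) hcb0 hc₄0 hcb0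
  refine ⟨max Ca Cb, lt_max_of_lt_left hCa0, ?_⟩
  intro X Y H G _ _ _ _ _ _ _ _ _ _ _ _ _ _ _ _ _ _ _ P hK Q θ d hL hTrue hnoise hOp _ _ hQD
    hstab hconv hsrc heff hn m hm η hη hη1 u lam hlam hml
  have hlam0 : 0 ≤ lam := hlam ▸ Real.rpow_nonneg m.cast_nonneg _
  have hℓ := HilbertScales.one_le_log_four_div hη hη1
  refine ⟨fun hqr hu => ?_, fun hrq hrp hu R fR hR hfR hfRQ hRlam => ?_⟩
  · subst hu
    refine (HilbertScales.InverseProblem.errorBound_of_smooth hp hs hq1 hq2 hqr hDq hb0 hCN hellL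
      hellA hD hM hRdag hL hTrue hnoise hOp hQD hstab hsrc heff hm hη hη1 hlam rfl hCa).mono ?_
    gcongr
    exact le_max_left _ _
  -- The quantity is `p + s - r(s-1)`. For `s ≤ 1` it is positive at once; for `s ≥ 1` it is bounded
  -- below by its value at `q`, since `r ≤ q`.
  · have hDr : 0 < (p + r) - s * (r - 1) := by
      rcases le_total s 1 with h | h
      · linarith [mul_nonneg hr (sub_nonneg.2 h)]
      · linarith [mul_le_mul_of_nonneg_right hrq (sub_nonneg.2 h)]
    subst hu
    refine (HilbertScales.InverseProblem.errorBound_of_benchmark hp hs hq1 hq2 hr hrq hrp hDq hDr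
      hb0 hCN hellL hellA hD hM hα hβ hRdag hL hTrue hnoise hOp hQD hstab hconv hsrc heff hn hm hη
      hη1 hlam hml rfl hR hfR hfRQ hRlam hcb hc₄ hCb0 hCb).mono ?_
    gcongr
    exact le_max_right _ _
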